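/- All multigraphs are finite and loopless; parallel edges are allowed, and a forest is a multigraph without cycles, where two parallel edges count as a cycle of length two. Let $D\ge 1$ be an integer. A $(D,F,F)$-coloring of a multigraph $G$ is a partition $(M,F)$ of $V(G)$ (a part may be empty) such that the induced subgraph $G[M]$ is a forest of maximum degree at most $D$ and the induced subgraph $G[F]$ is a forest. The multigraph $G$ is $(D,F,F)$-critical if it has no $(D,F,F)$-coloring, but every proper subgraph of $G$ has one. For every integer $D\ge 1$, every $(D,F,F)$-critical multigraph $G$ with at least three vertices satisfies $$|E(G)|\ \ge\ \frac{(4D+3)\,|V(G)|+2}{2(D+1)}.$$ Moreover, the bound is sharp: for every integer $D\ge 1$ and every $n$ there is a $(D,F,F)$-critical multigraph $G$ with at least three vertices and $|V(G)|\ge n$ such that $$|E(G)|=\frac{(4D+3)\,|V(G)|+2}{2(D+1)}.$$ -/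

import Mathlib

namespace Graph

variable {α β : Type*}

/-- A multigraph is a forest if it contains no cycle. A cycle of length `n + 1 ≥ 1` consists of
distinct vertices `v 0, …, v n` and distinct edges `e 0, …, e n` such that `e i` joins `v i` to
`v (i + 1)`, the indices being read modulo `n + 1` (addition in `Fin (n + 1)`). A loop is a cycle of
length one, and two parallel edges form a cycle of length two. -/
def IsForest (G : Graph α β) : Prop :=
  ¬ ∃ (n : ℕ) (v : Fin (n + 1) → α) (e : Fin (n + 1) → β),
    Function.Injective v ∧ Function.Injective e ∧ ∀ i, G.IsLink (e i) (v i) (v (i + 1))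

/-- The degree of a vertex, edges being counted with multiplicity (and loops twice). -/
noncomputable def vertexDegree (G : Graph α β) (x : α) : ℕ∞ :=
  (G.incidenceSet x).encard + (G.loopSet x).encard

/-- `(M, F)` is a partition of the vertex set of `G` (parts may be empty) such that `G[M]` is a
forest of maximum degree at most `D` and `G[F]` is a forest. -/
structure IsDFFColoring (G : Graph α β) (D : ℕ) (M F : Set α) : Prop where
  union_eq : M ∪ F = G.vertexSet
  disjoint : Disjoint M F
  isForest_left : (G.induce M).IsForest
  degree_le : ∀ x ∈ M, (G.induce M).vertexDegree x ≤ D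
  isForest_right : (G.induce F).IsForest

/-- `G` admits a `(D, F, F)`-coloring. -/
def DFFColorable (G : Graph α β) (D : ℕ) : Prop :=
  ∃ M F : Set α, G.IsDFFColoring D M F

/-- `G` admits no `(D, F, F)`-coloring, but every proper subgraph of `G` does. -/
def IsDFFCritical (G : Graph α β) (D : ℕ) : Prop :=
  ¬ G.DFFColorable D ∧ ∀ H : Graph α β, H < G → H.DFFColorable D

end Graph

set_option linter.unusedSectionVars false

namespace DFF

variable {V : Type*} [DecidableEq V]

/-- The number of edges from `v` to `X` in the multigraph with multiplicity function `m`. -/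
def nb (m : V → V → ℕ) (v : V) (X : Finset V) : ℕ := ∑ y ∈ X, m v y

/-- The number of edges from `X` to `Y`; edges inside `X ∩ Y` are counted twice. -/
def cross (m : V → V → ℕ) (X Y : Finset V) : ℕ := ∑ x ∈ X, nb m x Y

/-- `m` is the multiplicity function of a loopless multigraph. -/
structure IsMult (m : V → V → ℕ) : Prop where
  symm : ∀ x y, m x y = m y x
  self : ∀ x, m x x = 0

/-! ### Edge counts in multigraphs. -/

section counting

variable {m : V → V → ℕ} {X Y Z : Finset V} {u v : V}

@[simp] lemma nb_empty : nb m v ∅ = 0 := by simp [nb]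

@[simp] lemma nb_singleton : nb m v {u} = m v u := by simp [nb]

@[simp] lemma cross_empty_left : cross m ∅ Y = 0 := by simp [cross]

@[simp] lemma cross_empty_right : cross m X ∅ = 0 := by simp [cross]

@[simp] lemma cross_singleton_left : cross m {v} Y = nb m v Y := by simp [cross]

lemma nb_insert (h : v ∉ X) : nb m u (insert v X) = m u v + nb m u X := by
  simp [nb, Finset.sum_insert h]

lemma nb_union (h : Disjoint X Y) : nb m u (X ∪ Y) = nb m u X + nb m u Y := by
  simp [nb, Finset.sum_union h]

lemma nb_mono (h : X ⊆ Y) : nb m u X ≤ nb m u Y :=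
  Finset.sum_le_sum_of_subset h

lemma le_nb (h : v ∈ X) : m u v ≤ nb m u X :=
  Finset.single_le_sum (f := fun y => m u y) (fun _ _ => Nat.zero_le _) h

lemma nb_eq_zero : nb m u X = 0 ↔ ∀ y ∈ X, m u y = 0 := by
  simp [nb]

lemma exists_of_nb_pos (h : 0 < nb m u X) : ∃ y ∈ X, 0 < m u y := by
  by_contra! hc
  have : nb m u X = 0 := nb_eq_zero.2 fun y hy => by have := hc y hy; omega
  omega

lemma nb_congr {m' : V → V → ℕ} (h : ∀ y ∈ X, m u y = m' u y) : nb m u X = nb m' u X :=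
  Finset.sum_congr rfl h

lemma nb_erase (h : v ∈ X) : nb m u X = m u v + nb m u (X.erase v) := by
  simp [nb, Finset.add_sum_erase X (fun y => m u y) h]

lemma nb_sdiff (h : X ⊆ Y) : nb m u Y = nb m u X + nb m u (Y \ X) := by
  rw [← nb_union Finset.disjoint_sdiff, Finset.union_sdiff_of_subset h]

lemma cross_union_left (h : Disjoint X Y) :
    cross m (X ∪ Y) Z = cross m X Z + cross m Y Z := by
  simp [cross, Finset.sum_union h]

lemma cross_union_right (h : Disjoint X Y) :
    cross m Z (X ∪ Y) = cross m Z X + cross m Z Y := by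
  simp [cross, nb_union h, Finset.sum_add_distrib]

lemma cross_mono {X' Y' : Finset V} (hX : X ⊆ X') (hY : Y ⊆ Y') : cross m X Y ≤ cross m X' Y' :=
  (Finset.sum_le_sum fun _ _ => nb_mono hY).trans (Finset.sum_le_sum_of_subset hX)

lemma cross_comm (hm : IsMult m) : cross m X Y = cross m Y X := by
  unfold cross nb
  rw [Finset.sum_comm]
  exact Finset.sum_congr rfl fun y _ => Finset.sum_congr rfl fun x _ => hm.symm _ _

lemma cross_congr {m' : V → V → ℕ} (h : ∀ x ∈ X, ∀ y ∈ Y, m x y = m' x y) :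
    cross m X Y = cross m' X Y :=
  Finset.sum_congr rfl fun x hx => nb_congr (h x hx)

lemma cross_eq_zero : cross m X Y = 0 ↔ ∀ x ∈ X, nb m x Y = 0 := by
  simp [cross]

lemma cross_union_self (hm : IsMult m) (h : Disjoint X Y) :
    cross m (X ∪ Y) (X ∪ Y) = cross m X X + cross m Y Y + 2 * cross m X Y := by
  rw [cross_union_left h, cross_union_right h, cross_union_right h, cross_comm hm (X := Y) (Y := X)]
  ring

lemma cross_insert_self (hm : IsMult m) (h : v ∉ X) :
    cross m (insert v X) (insert v X) = cross m X X + 2 * nb m v X := by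
  rw [Finset.insert_eq, cross_union_self hm (by simpa using h)]
  simp [hm.self]

lemma cross_split (hm : IsMult m) (hZ : Z ⊆ X ∪ Y) (h : Disjoint X Y) :
    cross m Z Z = cross m (Z ∩ X) (Z ∩ X) + cross m (Z ∩ Y) (Z ∩ Y)
      + 2 * cross m (Z ∩ X) (Z ∩ Y) ∧ Z.card = (Z ∩ X).card + (Z ∩ Y).card := by
  have hd : Disjoint (Z ∩ X) (Z ∩ Y) :=
    h.mono Finset.inter_subset_right Finset.inter_subset_right
  have hu : Z ∩ X ∪ Z ∩ Y = Z := by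
    rw [← Finset.inter_union_distrib_left, Finset.inter_eq_left]; exact hZ
  refine ⟨?_, ?_⟩
  · rw [← cross_union_self hm hd, hu]
  · rw [← Finset.card_union_of_disjoint hd, hu]

end counting

/-- `X` induces a forest: every nonempty subset `Y` spans fewer than `|Y|` edges. -/
def Forest (m : V → V → ℕ) (X : Finset V) : Prop :=
  ∀ Y ⊆ X, Y.Nonempty → cross m Y Y + 2 ≤ 2 * Y.card

/-! ### Sparsity-type forests and their extensions. -/

section forest

variable {m : V → V → ℕ} {X Y : Finset V} {u v : V}

lemma Forest.mono (h : Forest m Y) (hX : X ⊆ Y) : Forest m X :=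
  fun Z hZ hne => h Z (hZ.trans hX) hne

lemma forest_empty : Forest m ∅ := by
  intro Y hY hne
  simp_all [Finset.subset_empty]

lemma Forest.congr_le {m' : V → V → ℕ} (h : Forest m X)
    (hle : ∀ x ∈ X, ∀ y ∈ X, m' x y ≤ m x y) : Forest m' X := by
  intro Y hY hne
  have h1 : cross m' Y Y ≤ cross m Y Y :=
    Finset.sum_le_sum fun x hx => Finset.sum_le_sum fun y hy => hle x (hY hx) y (hY hy)
  have := h Y hY hne
  omega

lemma Forest.insert_leaf (hm : IsMult m) (h : Forest m X) (hv : nb m v X ≤ 1) :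
    Forest m (insert v X) := by
  by_cases hvX : v ∈ X
  · rwa [Finset.insert_eq_of_mem hvX]
  intro Y hY hne
  by_cases hvY : v ∈ Y
  · have hsub : Y.erase v ⊆ X := by
      intro y hy
      have := hY (Finset.mem_of_mem_erase hy)
      simp_all
    have h1 : cross m Y Y = cross m (Y.erase v) (Y.erase v) + 2 * nb m v (Y.erase v) := by
      rw [← cross_insert_self hm (Finset.notMem_erase v Y), Finset.insert_erase hvY]
    have h2 := nb_mono (m := m) (u := v) hsub
    have h3 := Finset.card_erase_add_one hvY
    rcases (Y.erase v).eq_empty_or_nonempty with h4 | h4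
    · rw [h4] at h1 h3
      simp at h1 h3
      omega
    · have := h _ hsub h4
      omega
  · exact h Y (fun y hy => (Finset.mem_insert.1 (hY hy)).resolve_left (by rintro rfl; exact hvY hy))
      hne

lemma forest_singleton (hm : IsMult m) : Forest m {v} := by
  simpa using (forest_empty (m := m)).insert_leaf hm (v := v) (by simp)

lemma Forest.union_of_cross_le_one (hm : IsMult m) (hX : Forest m X) (hY : Forest m Y)
    (hd : Disjoint X Y) (hc : cross m X Y ≤ 1) : Forest m (X ∪ Y) := by
  intro Z hZ hne
  obtain ⟨h1, h2⟩ := cross_split hm hZ hd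
  have h3 : cross m (Z ∩ X) (Z ∩ Y) ≤ 1 :=
    (cross_mono Finset.inter_subset_right Finset.inter_subset_right).trans hc
  have hne' := hne.card_pos
  rcases (Z ∩ X).eq_empty_or_nonempty with h4 | h4 <;>
    rcases (Z ∩ Y).eq_empty_or_nonempty with h5 | h5
  · simp [h4, h5] at h1 h2; omega
  · have := hY _ Finset.inter_subset_right h5
    simp [h4] at h1 h2; omega
  · have := hX _ Finset.inter_subset_right h4
    simp [h5] at h1 h2; omega
  · have := hY _ Finset.inter_subset_right h5
    have := hX _ Finset.inter_subset_right h4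
    omega

lemma forest_of_nb_le_one (hm : IsMult m) (h : ∀ v ∈ X, nb m v X ≤ 1) : Forest m X := by
  intro Y hY hne
  have h1 : cross m Y Y ≤ Y.card := by
    calc cross m Y Y ≤ ∑ x ∈ Y, 1 :=
          Finset.sum_le_sum fun x hx => (nb_mono hY).trans (h x (hY hx))
      _ = Y.card := by simp
  rcases (Nat.succ_le_of_lt hne.card_pos).eq_or_lt with h2 | h2
  · obtain ⟨y, rfl⟩ := Finset.card_eq_one.1 h2.symm
    simp [hm.self]
  · omega

/-- A forest remains a forest when an edge `pq` is subdivided. -/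
lemma Forest.subdivide {m' : V → V → ℕ} {p q : V} (hm : IsMult m) (hpq : p ≠ q)
    (h : Forest m' X) (hle : ∀ x y, m x y ≤ m' x y)
    (hp : m p q + 1 ≤ m' p q) (hq : m q p + 1 ≤ m' q p)
    (hvX : v ∉ X)
    (hv : ∀ y ∈ X, m v y ≤ if y = p ∨ y = q then 1 else 0) : Forest m (insert v X) := by
  intro Y hY hne
  by_cases hvY : v ∈ Y
  · set Z := Y.erase v with hZ
    have hsub : Z ⊆ X := by
      intro y hy
      have := hY (Finset.mem_of_mem_erase hy)
      have := Finset.ne_of_mem_erase hy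
      simp_all
    have h1 : cross m Y Y = cross m Z Z + 2 * nb m v Z := by
      rw [← cross_insert_self hm (Finset.notMem_erase v Y), Finset.insert_erase hvY]
    have h3 : Z.card + 1 = Y.card := Finset.card_erase_add_one hvY
    have h4 : nb m v Z ≤ (Z.filter fun y => y = p ∨ y = q).card := by
      rw [Finset.card_filter]
      exact Finset.sum_le_sum fun y hy => hv y (hsub hy)
    have h5 : cross m Z Z ≤ cross m' Z Z :=
      Finset.sum_le_sum fun x hx => Finset.sum_le_sum fun y hy => hle x y
    -- If both ends are present, losing the edge `pq` compensates for one of the at most two new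
    -- edges at `v`. Otherwise `v` is a leaf or isolated over `Z`.
    by_cases hb : p ∈ Z ∧ q ∈ Z
    · obtain ⟨hpZ, hqZ⟩ := hb
      have h6 : (Z.filter fun y => y = p ∨ y = q).card ≤ 2 := by
        refine (Finset.card_le_card (t := {p, q}) ?_).trans Finset.card_le_two
        intro y hy
        simp at hy ⊢
        exact hy.2
      have h7 : cross m Z Z + 2 ≤ cross m' Z Z := by
        have e1 : ∀ x ∈ Z, nb m x Z + (if x = p ∨ x = q then 1 else 0) ≤ nb m' x Z := by
          intro x hx
          have key : ∀ s ∈ Z, m x s + 1 ≤ m' x s → nb m x Z + 1 ≤ nb m' x Z := by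
            intro s hs hlt
            rw [nb_erase hs, nb_erase (m := m') hs]
            have : nb m x (Z.erase s) ≤ nb m' x (Z.erase s) :=
              Finset.sum_le_sum fun y _ => hle x y
            omega
          split_ifs with hx'
          · rcases hx' with rfl | rfl
            · exact key q hqZ hp
            · exact key p hpZ hq
          · exact Finset.sum_le_sum fun y _ => hle x y
        have e2 := Finset.sum_le_sum e1
        rw [Finset.sum_add_distrib, ← Finset.card_filter] at e2
        have e3 : 2 ≤ (Z.filter fun y => y = p ∨ y = q).card := by
          rw [← Finset.card_pair hpq]
          refine Finset.card_le_card ?_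
          intro y hy
          simp at hy ⊢
          rcases hy with rfl | rfl <;> simp_all
        unfold cross
        omega
      have := h Z hsub ⟨p, hpZ⟩
      omega
    · have h6 : (Z.filter fun y => y = p ∨ y = q).card ≤ 1 := by
        rw [Finset.card_le_one]
        intro x hx y hy
        simp at hx hy
        rcases hx with ⟨hx, rfl | rfl⟩ <;> rcases hy with ⟨hy, rfl | rfl⟩ <;> simp_all
      rcases Z.eq_empty_or_nonempty with h7 | h7
      · rw [h7] at h1 h3
        simp at h1 h3
        omega
      · have := h Z hsub h7
        omega
  · have hsub : Y ⊆ X := fun y hy =>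
      (Finset.mem_insert.1 (hY hy)).resolve_left (by rintro rfl; exact hvY hy)
    have h5 : cross m Y Y ≤ cross m' Y Y :=
      Finset.sum_le_sum fun x hx => Finset.sum_le_sum fun y hy => hle x y
    have := h Y hsub hne
    omega

end forest

/-- The contribution of a vertex to the potential, where `i v` is the number of virtual neighbours
of `v` in the first class, and `a v = 1` if `v` has to belong to the first class. -/
def wt (D : ℕ) (i a : V → ℕ) (v : V) : ℤ := 4 * D + 3 - 2 * i v - (2 * D + 3) * a v

/-- The potential of a set of vertices. -/
def pot (D : ℕ) (m : V → V → ℕ) (i a : V → ℕ) (X : Finset V) : ℤ :=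
  ∑ v ∈ X, wt D i a v - (D + 1) * cross m X X

/-- The sets `M` and `F` form a colouring respecting the constraints given by `i` and `a`. -/
structure Coloring (D : ℕ) (m : V → V → ℕ) (i a : V → ℕ) (M F : Finset V) : Prop where
  forest_left : Forest m M
  forest_right : Forest m F
  deg : ∀ v ∈ M, nb m v M + i v ≤ D
  free : ∀ v ∈ F, a v = 0

def Colorable (D : ℕ) (m : V → V → ℕ) (i a : V → ℕ) (W : Finset V) : Prop :=
  ∃ M F, Disjoint M F ∧ M ∪ F = W ∧ Coloring D m i a M F

/-! ### Potentials and extension of colourings. -/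

section pot

variable {D : ℕ} {m : V → V → ℕ} {i a : V → ℕ} {X Y M F : Finset V} {v : V}

lemma pot_union (hm : IsMult m) (h : Disjoint X Y) :
    pot D m i a (X ∪ Y) = pot D m i a X + pot D m i a Y - 2 * (D + 1) * cross m X Y := by
  unfold pot
  rw [Finset.sum_union h, cross_union_self hm h]
  push_cast
  ring

lemma pot_insert (hm : IsMult m) (h : v ∉ X) :
    pot D m i a (insert v X) = pot D m i a X + wt D i a v - 2 * (D + 1) * nb m v X := by
  unfold pot
  rw [Finset.sum_insert h, cross_insert_self hm h]
  push_cast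
  ring

lemma pot_singleton (hm : IsMult m) : pot D m i a {v} = wt D i a v := by
  simp [pot, hm.self]

lemma pot_erase (hm : IsMult m) (h : v ∈ X) :
    pot D m i a X = pot D m i a (X.erase v) + wt D i a v - 2 * (D + 1) * nb m v (X.erase v) := by
  rw [← pot_insert hm (Finset.notMem_erase v X), Finset.insert_erase h]

lemma nb_erase_self (hm : IsMult m) : nb m v (X.erase v) = nb m v X := by
  by_cases h : v ∈ X
  · rw [nb_erase (X := X) h, hm.self, zero_add]
  · rw [Finset.erase_eq_of_notMem h]

lemma Coloring.insert_left (hm : IsMult m) (h : Coloring D m i a M F) (hv : v ∉ M)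
    (hf : nb m v M ≤ 1) (hd : nb m v M + i v ≤ D)
    (hn : ∀ z ∈ M, nb m z M + m v z + i z ≤ D) : Coloring D m i a (insert v M) F where
  forest_left := h.forest_left.insert_leaf hm hf
  forest_right := h.forest_right
  deg z hz := by
    rw [nb_insert hv]
    rcases Finset.mem_insert.1 hz with rfl | hz
    · rw [hm.self]; omega
    · have := hn z hz
      rw [hm.symm z v]; omega
  free := h.free

lemma Coloring.insert_right (hm : IsMult m) (h : Coloring D m i a M F)
    (hf : nb m v F ≤ 1) (ha : a v = 0) : Coloring D m i a M (insert v F) where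
  forest_left := h.forest_left
  forest_right := h.forest_right.insert_leaf hm hf
  deg := h.deg
  free z hz := by
    rcases Finset.mem_insert.1 hz with rfl | hz
    · exact ha
    · exact h.free z hz

lemma Coloring.mono {i' a' : V → ℕ} (h : Coloring D m i' a' M F) (hi : ∀ v ∈ M, i v ≤ i' v)
    (ha : ∀ v ∈ F, a v ≤ a' v) : Coloring D m i a M F where
  forest_left := h.forest_left
  forest_right := h.forest_right
  deg v hv := by have := h.deg v hv; have := hi v hv; omega
  free v hv := by have := h.free v hv; have := ha v hv; omega

lemma colorable_empty : Colorable D m i a ∅ :=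
  ⟨∅, ∅, by simp, by simp, forest_empty, forest_empty, by simp, by simp⟩

end pot

/-- A vertex-critical instance of potential at least `-1` such that smaller instances all of whose
subsets have potential at least `-1` are colourable. -/
structure MinCounterexample (D : ℕ) (m : V → V → ℕ) (i a : V → ℕ) (W : Finset V) : Prop where
  mult : IsMult m
  i_le : ∀ v, i v ≤ D + 1
  a_le : ∀ v, a v ≤ 1
  not_colorable : ¬ Colorable D m i a W
  colorable_of_ssubset : ∀ S ⊂ W, Colorable D m i a S
  pot_ge : -1 ≤ pot D m i a W
  ih : ∀ (m' : V → V → ℕ) (i' a' : V → ℕ) (W' : Finset V), IsMult m' → (∀ v, i' v ≤ D + 1) →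
    (∀ v, a' v ≤ 1) → W'.card < W.card →
    (∀ X ⊆ W', X.Nonempty → -1 ≤ pot D m' i' a' X) → Colorable D m' i' a' W'

/-! ### Minimal-potential subsets: no edge leaves from the class `F`. -/

section gap

variable {D : ℕ} {m : V → V → ℕ} {i a : V → ℕ} {W S M F : Finset V}

/-- Adding `X` to `S` changes the potential by `pot X` minus the cost of the crossing edges, and by
the choice of `S` the change is not negative. This is the budget from which edges to `S` are paid.
-/
lemma MinCounterexample.pot_ge_of_ssubset_sdiff (h : MinCounterexample D m i a W) (hS : S ⊂ W)
    (hmin : ∀ S', S ⊂ S' → S' ⊂ W → pot D m i a S ≤ pot D m i a S')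
    {X : Finset V} (hX : X ⊂ W \ S) (hne : X.Nonempty) :
    2 * ((D : ℤ) + 1) * cross m X S ≤ pot D m i a X := by
  have hd : Disjoint X S := Finset.disjoint_of_subset_left hX.1 Finset.sdiff_disjoint
  have h1 := pot_union (D := D) (i := i) (a := a) h.mult hd
  have h2 : S ⊂ X ∪ S := by
    obtain ⟨x, hx⟩ := hne
    refine ⟨Finset.subset_union_right, fun hc => ?_⟩
    exact Finset.disjoint_left.1 hd hx (hc (Finset.mem_union_left _ hx))
  have h3 : X ∪ S ⊂ W := by
    refine ⟨Finset.union_subset (hX.1.trans Finset.sdiff_subset) hS.1, fun hc => hX.2 ?_⟩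
    intro y hy
    rw [Finset.mem_sdiff] at hy
    exact (Finset.mem_union.1 (hc hy.1)).resolve_right hy.2
  have := hmin _ h2 h3
  linarith

lemma pot_sdiff (hm : IsMult m) (hS : S ⊆ W) :
    pot D m i a W = pot D m i a (W \ S) + pot D m i a S
      - 2 * (D + 1) * cross m (W \ S) S := by
  rw [← pot_union hm Finset.sdiff_disjoint, Finset.sdiff_union_of_subset hS]

/-- Here `c` is the price of changing the constraints at each vertex. -/
lemma pot_congr_weights {i' a' : V → ℕ} {X : Finset V} (c : V → ℤ)
    (hc : ∀ x ∈ X, wt D i a x - c x ≤ wt D i' a' x) :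
    pot D m i a X - ∑ x ∈ X, c x ≤ pot D m i' a' X := by
  have := Finset.sum_le_sum hc
  rw [Finset.sum_sub_distrib] at this
  unfold pot
  linarith

/-- The multiplicities after contracting `F` to its element `s`. -/
def contract (m : V → V → ℕ) (F : Finset V) (s : V) (x y : V) : ℕ :=
  if x = s then (if y = s then 0 else nb m y F) else if y = s then nb m x F else m x y

lemma isMult_contract (hm : IsMult m) (s : V) : IsMult (contract m F s) where
  symm x y := by
    unfold contract
    split_ifs <;> simp_all [hm.symm x y]
  self x := by
    unfold contract
    split_ifs <;> simp_all [hm.self]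

lemma cross_contract {s : V} {X Y : Finset V} (hX : s ∉ X) (hY : s ∉ Y) :
    cross (contract m F s) X Y = cross m X Y := by
  refine cross_congr fun x hx y hy => ?_
  have h1 : x ≠ s := by rintro rfl; exact hX hx
  have h2 : y ≠ s := by rintro rfl; exact hY hy
  simp [contract, h1, h2]

lemma nb_contract {s : V} {X : Finset V} (hX : s ∉ X) :
    nb (contract m F s) s X = cross m X F := by
  unfold nb cross
  refine Finset.sum_congr rfl fun x hx => ?_
  have h1 : x ≠ s := by rintro rfl; exact hX hx
  simp [contract, h1]

/-- A cycle in the union of the second classes would survive the contraction of `F`: a subset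
meeting `F` is compared with its part outside `F` together with `s`, and the two sparsity bounds add
up. In the first classes there are no crossing edges at all. -/
lemma Coloring.union_contract (hm : IsMult m) {s : V} {M2 F2 : Finset V}
    (hc : Coloring D m i a M F) (hf2 : Forest m M2) (hf : Forest (contract m F s) F2)
    (hsF2 : s ∈ F2) (hdM : Disjoint M M2) (hdF : Disjoint F (F2.erase s))
    (hM2 : ∀ y ∈ M2, nb m y M = 0 ∧ nb m y M2 + i y ≤ D) (hcM : cross m M M2 = 0)
    (ha : ∀ y ∈ F2.erase s, a y = 0) : Coloring D m i a (M ∪ M2) (F ∪ F2.erase s) where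
  forest_left := hc.forest_left.union_of_cross_le_one hm hf2 hdM (by omega)
  forest_right := by
    intro Y hY hne
    obtain ⟨h1, h2⟩ := cross_split hm hY hdF
    have hsY : s ∉ Y ∩ F2.erase s := by
      intro hx
      exact Finset.notMem_erase s F2 (Finset.mem_inter.1 hx).2
    rcases (Y ∩ F).eq_empty_or_nonempty with h3 | h3
    · have h4 : (Y ∩ F2.erase s).Nonempty := by
        rw [← Finset.card_pos]
        have := hne.card_pos
        rw [h3] at h2
        simp only [Finset.card_empty] at h2
        omega
      have h5 := hf (Y ∩ F2.erase s)
        (Finset.inter_subset_right.trans (Finset.erase_subset _ _)) h4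
      rw [cross_contract hsY hsY] at h5
      rw [h3, cross_empty_left, cross_empty_left] at h1
      rw [h3, Finset.card_empty] at h2
      omega
    · have h4 := hc.forest_right _ Finset.inter_subset_right h3
      have h5 := hf (insert s (Y ∩ F2.erase s)) (by
        refine Finset.insert_subset hsF2
          (Finset.inter_subset_right.trans (Finset.erase_subset _ _))) (by simp)
      rw [cross_insert_self (isMult_contract hm s) hsY, cross_contract hsY hsY,
        nb_contract hsY, Finset.card_insert_of_notMem hsY] at h5
      have h6 : cross m (Y ∩ F) (Y ∩ F2.erase s) ≤ cross m (Y ∩ F2.erase s) F := by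
        rw [cross_comm hm]
        exact cross_mono subset_rfl Finset.inter_subset_right
      omega
  deg v hv := by
    rw [nb_union hdM]
    rcases Finset.mem_union.1 hv with hv | hv
    · have h1 := hc.deg v hv
      have h2 := cross_eq_zero.1 hcM v hv
      omega
    · have := hM2 v hv
      omega
  free v hv := by
    rcases Finset.mem_union.1 hv with hv | hv
    · exact hc.free v hv
    · exact ha v hv

/-- If an edge left `S` from `F`, the outside could be coloured with `F` contracted to one vertex
forced into the second class and with every outside vertex adjacent to `M` forced there too. The two
colourings would then glue. The assumed edge is what keeps the potential of the whole outside from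
being too small. -/
theorem MinCounterexample.cross_right_eq_zero (h : MinCounterexample D m i a W) (hS : S ⊂ W)
    (hmin : ∀ S', S ⊂ S' → S' ⊂ W → pot D m i a S ≤ pot D m i a S')
    (hp : pot D m i a S ≤ 2 * D + 1) (hsize : 2 ≤ S.card ∨ pot D m i a S ≤ 2 * D)
    (hd : Disjoint M F) (hu : M ∪ F = S) (hc : Coloring D m i a M F) :
    cross m (W \ S) F = 0 := by
  by_contra hpos
  have hm := h.mult
  have hFS : F ⊆ S := hu ▸ Finset.subset_union_right
  have hMS : M ⊆ S := hu ▸ Finset.subset_union_left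
  obtain ⟨s, hs⟩ : F.Nonempty := by
    rw [Finset.nonempty_iff_ne_empty]
    rintro rfl
    simp at hpos
  -- The contraction must shrink the instance. A single vertex lying in `F` has `a = 0` and `i ≤ D +
  -- 1`, hence potential at least `2D + 1`, against `hsize`.
  have hcard : 2 ≤ S.card := by
    rcases hsize with h2 | h2
    · exact h2
    · by_contra hlt
      have h1 : S.card = 1 := by
        have := Finset.card_pos.2 ⟨s, hFS hs⟩
        omega
      obtain ⟨x, rfl⟩ := Finset.card_eq_one.1 h1
      have hx : s = x := by simpa using hFS hs
      subst hx
      rw [pot_singleton hm] at h2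
      have h3 := hc.free s hs
      have h4 := h.i_le s
      unfold wt at h2
      rw [h3] at h2
      push_cast at h2
      have h5 : (i s : ℤ) ≤ D + 1 := by exact_mod_cast h4
      linarith
  set T := W \ S with hT
  have hsT : s ∉ T := by
    intro hx
    exact (Finset.mem_sdiff.1 hx).2 (hFS hs)
  set i' : V → ℕ := fun y => if y = s then D + 1 else if 0 < nb m y M then D + 1 else i y with hi'
  set a' : V → ℕ := fun y => if y = s then 0 else a y with ha'
  set m' := contract m F s with hm'
  have hsplit : ∀ X, cross m X S = cross m X M + cross m X F := fun X => by
    rw [← hu, cross_union_right hd]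
  have hwt : ∀ X : Finset V, s ∉ X →
      pot D m i a X - 2 * (D + 1) * cross m X M ≤ pot D m' i' a' X := by
    intro X hX
    have h1 := pot_congr_weights (D := D) (m := m) (i := i) (a := a) (i' := i') (a' := a') (X := X)
      (fun x => 2 * (D + 1) * (nb m x M : ℤ)) (by
        intro x hx
        have hxs : x ≠ s := by rintro rfl; exact hX hx
        simp only [wt, hi', ha', hxs, if_false]
        split_ifs with h0
        · have h6 : (1 : ℤ) ≤ nb m x M := by exact_mod_cast h0
          have h7 : (0 : ℤ) ≤ i x := by positivity
          push_cast
          nlinarith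
        · have h6 : (0 : ℤ) ≤ nb m x M := by positivity
          have : (0 : ℤ) ≤ 2 * (D + 1) * nb m x M := by positivity
          linarith)
    rw [← Finset.mul_sum] at h1
    have h2 : pot D m' i' a' X = pot D m i' a' X := by
      unfold pot
      rw [hm', cross_contract hX hX]
    rw [h2]
    convert h1 using 3
    simp [cross]
  -- A proper part of `T` has its edges to `S` paid by the minimality of `S`. Only `X = T` can fall
  -- short, by at most `1 + (2D + 1)`; with `s`, of weight `2D + 1`, the total is still at least
  -- `-1`.
  have hA : ∀ X ⊆ T, X.Nonempty →
      2 * ((D : ℤ) + 1) * cross m X F - 2 * D - 2 ≤ pot D m' i' a' X ∧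
      (-1 : ℤ) ≤ pot D m' i' a' X := by
    intro X hX hne
    have h1 := hwt X (fun hx => hsT (hX hx))
    have h2 : (cross m X S : ℤ) = cross m X M + cross m X F := by exact_mod_cast hsplit X
    have h0 : (0 : ℤ) ≤ 2 * (D + 1) * cross m X F := by positivity
    rcases hX.eq_or_ssubset with rfl | hlt
    · have h3 := pot_sdiff (D := D) (i := i) (a := a) hm hS.1
      rw [← hT, h2] at h3
      have h4 := h.pot_ge
      have h5 : (1 : ℤ) ≤ cross m T F := by
        exact_mod_cast Nat.one_le_iff_ne_zero.2 hpos
      constructor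
      · linarith
      · nlinarith
    · have h3 := h.pot_ge_of_ssubset_sdiff hS hmin hlt hne
      rw [h2] at h3
      constructor <;> linarith
  have hgood : ∀ X ⊆ insert s T, X.Nonempty → -1 ≤ pot D m' i' a' X := by
    intro X hX hne
    by_cases hsX : s ∈ X
    · have hsub : X.erase s ⊆ T := by
        intro y hy
        exact (Finset.mem_insert.1 (hX (Finset.mem_of_mem_erase hy))).resolve_left
          (Finset.ne_of_mem_erase hy)
      have h1 := pot_erase (D := D) (i := i') (a := a') (isMult_contract (F := F) hm s) hsX
      rw [← hm', hm', nb_contract (Finset.notMem_erase s X), ← hm'] at h1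
      have h2 : wt D i' a' s = 2 * D + 1 := by
        simp [wt, hi', ha']; ring
      rw [h2] at h1
      rcases (X.erase s).eq_empty_or_nonempty with h3 | h3
      · rw [h3] at h1
        simp [pot] at h1 ⊢
        linarith
      · have := (hA _ hsub h3).1
        linarith
    · exact (hA X (fun y hy => (Finset.mem_insert.1 (hX hy)).resolve_left
        (by rintro rfl; exact hsX hy)) hne).2
  have hcW : (insert s T).card < W.card := by
    rw [Finset.card_insert_of_notMem hsT, hT, Finset.card_sdiff_of_subset hS.1]
    have := Finset.card_le_card hS.1
    omega
  obtain ⟨M2, F2, hd2, hu2, hc2⟩ := h.ih m' i' a' (insert s T) (isMult_contract hm s)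
    (by intro v; simp only [hi']; split_ifs <;> simp [h.i_le v])
    (by intro v; simp only [ha']; split_ifs <;> simp [h.a_le v]) hcW hgood
  have hsM2 : s ∉ M2 := by
    intro hs2
    have := hc2.deg s hs2
    simp [hi'] at this
    omega
  have hsF2 : s ∈ F2 := by
    have : s ∈ M2 ∪ F2 := hu2 ▸ Finset.mem_insert_self s T
    exact (Finset.mem_union.1 this).resolve_left hsM2
  set F3 := F2.erase s with hF3
  have hM2T : M2 ⊆ T := by
    intro y hy
    have : y ∈ insert s T := hu2 ▸ Finset.mem_union_left _ hy
    exact (Finset.mem_insert.1 this).resolve_left (by rintro rfl; exact hsM2 hy)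
  have hF3T : F3 ⊆ T := by
    intro y hy
    have : y ∈ insert s T := hu2 ▸ Finset.mem_union_right _ (Finset.mem_of_mem_erase hy)
    exact (Finset.mem_insert.1 this).resolve_left (Finset.ne_of_mem_erase hy)
  have hST : Disjoint S T := Finset.disjoint_sdiff
  have hM2 : ∀ y ∈ M2, nb m y M = 0 ∧ nb m y M2 + i y ≤ D := by
    intro y hy
    have h1 := hc2.deg y hy
    have hys : y ≠ s := by rintro rfl; exact hsM2 hy
    have h2 : nb m' y M2 = nb m y M2 := by
      refine nb_congr fun z hz => ?_
      have : z ≠ s := by rintro rfl; exact hsM2 hz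
      simp [hm', contract, hys, this]
    rw [h2] at h1
    simp only [hi', hys, if_false] at h1
    split_ifs at h1 with h0 <;> omega
  have hcM : cross m M M2 = 0 := by
    rw [cross_comm hm]
    exact cross_eq_zero.2 fun y hy => (hM2 y hy).1
  have hdM : Disjoint M M2 := hST.mono hMS hM2T
  have hdF : Disjoint F F3 := hST.mono hFS hF3T
  refine h.not_colorable ⟨M ∪ M2, F ∪ F3, ?_, ?_, ?_⟩
  · rw [Finset.disjoint_union_left, Finset.disjoint_union_right, Finset.disjoint_union_right]
    exact ⟨⟨hd, hST.mono hMS hF3T⟩, (hST.mono hFS hM2T).symm,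
      hd2.mono_right (Finset.erase_subset _ _)⟩
  · have e1 : M2 ∪ F3 = T := by
      rw [hF3, ← Finset.erase_eq_of_notMem hsM2, ← Finset.erase_union_distrib, hu2,
        Finset.erase_insert hsT]
    rw [Finset.union_union_union_comm, hu, e1, hT, Finset.union_sdiff_of_subset hS.1]
  · refine Coloring.union_contract hm hc ?_ (hm' ▸ hc2.forest_right) hsF2 hdM hdF hM2 hcM ?_
    · refine hc2.forest_left.congr_le fun x hx y hy => ?_
      have h1 : x ≠ s := by rintro rfl; exact hsM2 hx
      have h2 : y ≠ s := by rintro rfl; exact hsM2 hy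
      simp [hm', contract, h1, h2]
    · intro v hv
      have h1 := hc2.free v (Finset.mem_of_mem_erase hv)
      have h2 := Finset.ne_of_mem_erase hv
      simpa [ha', h2] using h1

end gap

/-! ### Reserving slots, and the gap lemmas. -/

section slots

variable {D : ℕ} {m : V → V → ℕ} {i a : V → ℕ} {W S Y M F : Finset V}

/-- A vertex of `Y` sees one vertex of `S`, which has kept a slot for it; any other outside vertex
with an edge to `S` is forced into the second class. Thus degrees in `M ∪ M2` are correct.
Acyclicity holds because at most one edge crosses, or because maximum degree one excludes cycles. -/
lemma Coloring.union_slots (hm : IsMult m) {M2 F2 : Finset V}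
    (hc : Coloring D m (fun b => min (i b + nb m b Y) (D + 1)) a M F)
    (hc2 : Coloring D m (fun y => if y ∈ Y then min (i y + 1) (D + 1)
      else if 0 < nb m y (M ∪ F) then D + 1 else i y) a M2 F2)
    (hdMF : Disjoint M F)
    (hdM : Disjoint M M2) (hdF : Disjoint F F2) (hF : cross m F F2 = 0)
    (hY1 : ∀ y ∈ Y, nb m y (M ∪ F) ≤ 1) (hY : Y.card ≤ 1 ∨ D = 1) :
    Coloring D m i a (M ∪ M2) (F ∪ F2) := by
  have hM2 : ∀ y ∈ M2, y ∉ Y → nb m y M = 0 := by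
    intro y hy hyY
    have h1 := hc2.deg y hy
    simp only [hyY, if_false] at h1
    rw [nb_union hdMF] at h1
    split_ifs at h1 <;> omega
  have hle1 : ∀ y ∈ M2, nb m y M ≤ if y ∈ Y then 1 else 0 := by
    intro y hy
    split_ifs with hyY
    · exact (nb_mono Finset.subset_union_left).trans (hY1 y hyY)
    · exact (hM2 y hy hyY).le
  have hnbY : ∀ b ∈ M, nb m b M2 ≤ nb m b Y := by
    intro b hb
    have : nb m b M2 = nb m b (M2 ∩ Y) := by
      refine (Finset.sum_subset Finset.inter_subset_left fun y hy hyn => ?_).symm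
      have h1 : y ∉ Y := fun hyY => hyn (Finset.mem_inter.2 ⟨hy, hyY⟩)
      rw [hm.symm]
      exact nb_eq_zero.1 (hM2 y hy h1) b hb
    rw [this]
    exact nb_mono Finset.inter_subset_right
  have hdeg : ∀ v ∈ M ∪ M2, nb m v (M ∪ M2) + i v ≤ D := by
    intro v hv
    rw [nb_union hdM]
    rcases Finset.mem_union.1 hv with hv | hv
    · have h1 := hc.deg v hv
      have h2 := hnbY v hv
      omega
    · have h1 := hc2.deg v hv
      have h2 := hle1 v hv
      rw [nb_union hdMF] at h1
      split_ifs at h1 h2 <;> omega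
  refine ⟨?_, ?_, hdeg, ?_⟩
  · rcases hY with hY | hY
    · refine hc.forest_left.union_of_cross_le_one hm hc2.forest_left hdM ?_
      rw [cross_comm hm]
      calc cross m M2 M ≤ ∑ y ∈ M2, if y ∈ Y then 1 else 0 := Finset.sum_le_sum hle1
        _ = (M2 ∩ Y).card := by simp
        _ ≤ Y.card := Finset.card_le_card Finset.inter_subset_right
        _ ≤ 1 := hY
    · refine forest_of_nb_le_one hm fun v hv => ?_
      have := hdeg v hv
      omega
  · exact hc.forest_right.union_of_cross_le_one hm hc2.forest_right hdF (by omega)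
  · intro v hv
    rcases Finset.mem_union.1 hv with hv | hv
    · exact hc.free v hv
    · exact hc2.free v hv

/-- Protecting the outside costs `2` at vertices of `Y` and `2(D + 1)` at other vertices adjacent to
`S`. On proper parts of the outside this is at most the price of the edges to `S`, covered by the
minimality of `S`; only the whole outside needs the hypothesis `hT`. -/
theorem MinCounterexample.false_of_slots (h : MinCounterexample D m i a W) (hS : S ⊂ W)
    (hne : S.Nonempty)
    (hmin : ∀ S', S ⊂ S' → S' ⊂ W → pot D m i a S ≤ pot D m i a S')
    (hp : pot D m i a S ≤ 2 * D + 1) (hsize : 2 ≤ S.card ∨ pot D m i a S ≤ 2 * D)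
    (hY1 : ∀ y ∈ Y, nb m y S = 1) (hY : Y.card ≤ 1 ∨ D = 1)
    (hcol : Colorable D m (fun b => min (i b + nb m b Y) (D + 1)) a S)
    (hT : -1 ≤ pot D m i a (W \ S) - ∑ y ∈ W \ S,
      if y ∈ Y then (2 : ℤ) else if 0 < nb m y S then 2 * ((D : ℤ) + 1) else 0) : False := by
  have hm := h.mult
  obtain ⟨M, F, hd, hu, hc⟩ := hcol
  have hc' : Coloring D m i a M F := hc.mono (by
    intro v hv
    have := hc.deg v hv
    omega) (fun _ _ => le_rfl)
  have hF := h.cross_right_eq_zero hS hmin hp hsize hd hu hc'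
  set T := W \ S with hTdef
  set i' : V → ℕ := fun y => if y ∈ Y then min (i y + 1) (D + 1)
      else if 0 < nb m y S then D + 1 else i y with hi'
  set c : V → ℤ := fun y => if y ∈ Y then (2 : ℤ) else if 0 < nb m y S then 2 * ((D : ℤ) + 1) else 0
    with hcdef
  have hpot : ∀ X, pot D m i a X - ∑ x ∈ X, c x ≤ pot D m i' a X := by
    intro X
    refine pot_congr_weights c fun x _ => ?_
    have h7 : (0 : ℤ) ≤ i x := by positivity
    simp only [wt, hi', hcdef]
    split_ifs
    · have : ((min (i x + 1) (D + 1) : ℕ) : ℤ) ≤ i x + 1 := by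
        exact_mod_cast min_le_left _ _
      linarith
    · push_cast; linarith
    · linarith
  have hcle : ∀ X, ∑ x ∈ X, c x ≤ 2 * ((D : ℤ) + 1) * cross m X S := by
    intro X
    have : (2 * ((D : ℤ) + 1) * cross m X S) = ∑ x ∈ X, 2 * ((D : ℤ) + 1) * nb m x S := by
      rw [← Finset.mul_sum]; simp [cross]
    rw [this]
    refine Finset.sum_le_sum fun x _ => ?_
    have hD : (0 : ℤ) ≤ D := by positivity
    simp only [hcdef]
    split_ifs with h1 h2
    · rw [hY1 x h1]; push_cast; linarith
    · have h6 : (1 : ℤ) ≤ nb m x S := by exact_mod_cast h2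
      nlinarith
    · positivity
  have hgood : ∀ X ⊆ T, X.Nonempty → -1 ≤ pot D m i' a X := by
    intro X hX hXne
    rcases hX.eq_or_ssubset with rfl | hlt
    · exact hT.trans (hpot _)
    · have h1 := h.pot_ge_of_ssubset_sdiff hS hmin hlt hXne
      have h2 := hpot X
      have h3 := hcle X
      linarith
  have hcW : T.card < W.card := by
    rw [hTdef, Finset.card_sdiff_of_subset hS.1]
    have := Finset.card_le_card hS.1
    have := hne.card_pos
    omega
  obtain ⟨M2, F2, hd2, hu2, hc2⟩ := h.ih m i' a T hm (by
    intro v; simp only [hi']; have := h.i_le v; split_ifs <;> simp [this]) h.a_le hcW hgood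
  have hST : Disjoint S T := Finset.disjoint_sdiff
  have hMS : M ⊆ S := hu ▸ Finset.subset_union_left
  have hFS : F ⊆ S := hu ▸ Finset.subset_union_right
  have hM2T : M2 ⊆ T := hu2 ▸ Finset.subset_union_left
  have hF2T : F2 ⊆ T := hu2 ▸ Finset.subset_union_right
  refine h.not_colorable ⟨M ∪ M2, F ∪ F2, ?_, ?_, ?_⟩
  · rw [Finset.disjoint_union_left, Finset.disjoint_union_right, Finset.disjoint_union_right]
    exact ⟨⟨hd, hST.mono hMS hF2T⟩, (hST.mono hFS hM2T).symm, hd2⟩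
  · rw [Finset.union_union_union_comm, hu, hu2, hTdef, Finset.union_sdiff_of_subset hS.1]
  · refine hc.union_slots hm ?_ hd (hST.mono hMS hM2T) (hST.mono hFS hF2T) ?_ ?_ hY
    · rw [hu]; exact hc2
    · have := cross_mono (m := m) hF2T (subset_refl F)
      rw [cross_comm hm]
      omega
    · rw [hu]; exact fun y hy => (hY1 y hy).le

/-- Reserving slots on `S` for the edges to `Y` keeps `S` colourable. -/
lemma MinCounterexample.colorable_slots (h : MinCounterexample D m i a W) (hS : S ⊂ W)
    (hYS : ∀ y ∈ Y, nb m y S = 1)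
    (hX : ∀ X ⊆ S, X.Nonempty → 2 * (Y.card : ℤ) - 1 ≤ pot D m i a X) :
    Colorable D m (fun b => min (i b + nb m b Y) (D + 1)) a S := by
  refine h.ih m _ a S h.mult (fun v => min_le_right _ _) h.a_le (Finset.card_lt_card hS) ?_
  intro X hXS hne
  have h1 := pot_congr_weights (D := D) (m := m) (i := i) (a := a)
    (i' := fun b => min (i b + nb m b Y) (D + 1)) (a' := a) (X := X)
    (fun x => 2 * (nb m x Y : ℤ)) (by
      intro x _
      have : ((min (i x + nb m x Y) (D + 1) : ℕ) : ℤ) ≤ i x + nb m x Y := by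
        exact_mod_cast min_le_left _ _
      simp only [wt]
      linarith)
  have h2 : cross m X Y ≤ Y.card := by
    rw [cross_comm h.mult]
    calc cross m Y X ≤ ∑ y ∈ Y, 1 :=
          Finset.sum_le_sum fun y hy => (nb_mono hXS).trans (hYS y hy).le
      _ = Y.card := by simp
  have h3 : ∑ x ∈ X, 2 * (nb m x Y : ℤ) = 2 * (cross m X Y : ℤ) := by
    rw [← Finset.mul_sum]; simp [cross]
  have h4 := hX X hXS hne
  have h5 : (cross m X Y : ℤ) ≤ Y.card := by exact_mod_cast h2
  rw [h3] at h1
  linarith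

lemma cast_cross (X S : Finset V) : (cross m X S : ℤ) = ∑ y ∈ X, (nb m y S : ℤ) := by
  simp [cross]

/-- The cost of protecting the outside vertex `y` against the edges joining it to `S`. -/
def slotCost (D : ℕ) (m : V → V → ℕ) (S Y : Finset V) (y : V) : ℤ :=
  if y ∈ Y then 2 else if 0 < nb m y S then 2 * ((D : ℤ) + 1) else 0

lemma slotCost_le (hY1 : ∀ y ∈ Y, nb m y S = 1) (y : V) :
    slotCost D m S Y y ≤ 2 * ((D : ℤ) + 1) * nb m y S := by
  have hD : (0 : ℤ) ≤ D := by positivity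
  unfold slotCost
  split_ifs with h1 h2
  · rw [hY1 y h1]; push_cast; linarith
  · have h6 : (1 : ℤ) ≤ nb m y S := by exact_mod_cast h2
    nlinarith
  · positivity

/-- The potential of `W \ S` is at least `-1 - pot S` plus the full price of the crossing edges. It
is therefore enough that the protection is cheaper than that price by at least `pot S`. -/
theorem MinCounterexample.false_of_gain (h : MinCounterexample D m i a W) (hS : S ⊂ W)
    (hne : S.Nonempty)
    (hmin : ∀ S', S ⊂ S' → S' ⊂ W → pot D m i a S ≤ pot D m i a S')
    (hp : pot D m i a S ≤ 2 * D + 1) (hsize : 2 ≤ S.card ∨ pot D m i a S ≤ 2 * D)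
    (hY1 : ∀ y ∈ Y, nb m y S = 1) (hY : Y.card ≤ 1 ∨ D = 1)
    (hcol : Colorable D m (fun b => min (i b + nb m b Y) (D + 1)) a S)
    {Z : Finset V} (hZ : Z ⊆ W \ S)
    (hT : pot D m i a S ≤ ∑ y ∈ Z, (2 * ((D : ℤ) + 1) * nb m y S - slotCost D m S Y y)) :
    False := by
  refine h.false_of_slots hS hne hmin hp hsize hY1 hY hcol ?_
  have h1 := hT.trans (Finset.sum_le_sum_of_subset_of_nonneg hZ fun y _ _ =>
    sub_nonneg.2 (slotCost_le hY1 y))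
  rw [Finset.sum_sub_distrib, ← Finset.mul_sum, ← cast_cross] at h1
  have hps := pot_sdiff (D := D) (i := i) (a := a) h.mult hS.1
  have hW := h.pot_ge
  change -1 ≤ pot D m i a (W \ S) - ∑ y ∈ W \ S, slotCost D m S Y y
  linarith

lemma MinCounterexample.colorable_slots_empty (h : MinCounterexample D m i a W) (hS : S ⊂ W) :
    Colorable D m (fun b => min (i b + nb m b ∅) (D + 1)) a S := by
  have h1 : (fun b => min (i b + nb m b ∅) (D + 1)) = i := by
    funext b; simp [h.i_le b]
  rw [h1]; exact h.colorable_of_ssubset S hS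

lemma sdiff_ssubset_of_nonempty (hS : S ⊂ W) (hne : S.Nonempty) :
    W \ S ⊂ W ∧ (W \ S).Nonempty := by
  refine ⟨⟨Finset.sdiff_subset, fun hc => ?_⟩, Finset.sdiff_nonempty.2 hS.2⟩
  obtain ⟨x, hx⟩ := hne
  exact (Finset.mem_sdiff.1 (hc (hS.1 hx))).2 hx

/-- Outside vertices send at most one edge to a set of small potential. -/
lemma MinCounterexample.nb_le_one (h : MinCounterexample D m i a W) (hS : S ⊂ W)
    (hne : S.Nonempty)
    (hmin : ∀ S', S ⊂ S' → S' ⊂ W → pot D m i a S ≤ pot D m i a S')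
    (hp : pot D m i a S ≤ 2 * D + 1) (hsize : 2 ≤ S.card ∨ pot D m i a S ≤ 2 * D) {y : V}
    (hy : y ∈ W \ S) : nb m y S ≤ 1 := by
  by_contra hc
  -- Forcing `y` into `F` costs `2(D + 1)` once although its edges to `S` are worth at least twice
  -- that. The saving exceeds `2D + 1`.
  refine h.false_of_gain hS hne hmin hp hsize (Y := ∅) (by simp) (by simp)
    (h.colorable_slots_empty hS) (Z := {y}) (by simpa using hy) ?_
  have h6 : (2 : ℤ) ≤ nb m y S := by exact_mod_cast (not_le.1 hc)
  have hD : (0 : ℤ) ≤ D := by positivity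
  simp only [Finset.sum_singleton, slotCost, Finset.notMem_empty, if_false]
  rw [if_pos (by omega)]
  nlinarith

/-- Every proper nonempty subset has large potential. -/
theorem MinCounterexample.gap (h : MinCounterexample D m i a W) (hS : S ⊂ W) (hne : S.Nonempty) :
    2 * (D : ℤ) + 1 ≤ pot D m i a S := by
  by_contra hlt
  obtain ⟨S₀, hS₀, hminS⟩ := (W.ssubsets.filter (·.Nonempty)).exists_min_image
    (pot D m i a) ⟨S, by simp [hS, hne]⟩
  simp only [Finset.mem_filter, Finset.mem_ssubsets] at hS₀ hminS
  have hle : pot D m i a S₀ ≤ 2 * D := by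
    have := hminS S ⟨hS, hne⟩
    linarith
  clear hlt hne hS
  rename' S => S', S₀ => S
  obtain ⟨hS, hne⟩ := hS₀
  have hmin : ∀ S', S ⊂ S' → S' ⊂ W → pot D m i a S ≤ pot D m i a S' :=
    fun S' h1 h2 => hminS S' ⟨h2, hne.mono h1.1⟩
  have hcol0 := h.colorable_slots_empty hS
  have hp : pot D m i a S ≤ 2 * D + 1 := by linarith
  have hpos : 1 ≤ pot D m i a S := by
    by_contra hc
    exact h.false_of_gain hS hne hmin hp (Or.inr hle) (Y := ∅) (by simp) (by simp) hcol0
      (Finset.empty_subset _) (by simp; omega)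
  by_cases hex : ∃ y ∈ W \ S, nb m y S = 1
  · obtain ⟨y, hy, hy1⟩ := hex
    have hY1 : ∀ z ∈ ({y} : Finset V), nb m z S = 1 := by simpa using hy1
    -- One reserved slot saves `2(D + 1) - 2 = 2D`, which is at least `pot S`; reserving it is
    -- affordable in `S` because all potentials there are at least `1`.
    refine h.false_of_gain hS hne hmin hp (Or.inr hle) hY1 (by simp) (h.colorable_slots hS hY1 ?_)
      (Z := {y}) (by simpa using hy) ?_
    · intro X hX hXne
      have := hminS X ⟨Finset.ssubset_of_subset_of_ssubset hX hS, hXne⟩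
      simp
      linarith
    · simp [slotCost, hy1]
      linarith
  · push Not at hex
    have h0 : ∀ y ∈ W \ S, nb m y S = 0 := by
      intro y hy
      have := hex y hy
      have := h.nb_le_one hS hne hmin hp (Or.inr hle) hy
      omega
    refine h.false_of_slots hS hne hmin hp (Or.inr hle) (Y := ∅) (by simp) (by simp) hcol0 ?_
    rw [Finset.sum_eq_zero fun y hy => by simp [h0 y hy]]
    have := hminS _ (sdiff_ssubset_of_nonempty hS hne)
    linarith

/-- For `D = 1`, proper subsets with at least two vertices have potential at least `4`. -/
theorem MinCounterexample.gap_two (h : MinCounterexample 1 m i a W) (hS : S ⊂ W)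
    (h2 : 2 ≤ S.card) : 4 ≤ pot 1 m i a S := by
  by_contra hlt
  obtain ⟨S₀, hS₀, hminS⟩ := (W.ssubsets.filter (2 ≤ ·.card)).exists_min_image
    (pot 1 m i a) ⟨S, by simp [hS, h2]⟩
  simp only [Finset.mem_filter, Finset.mem_ssubsets] at hS₀ hminS
  have hle : pot 1 m i a S₀ ≤ 3 := by
    have := hminS S ⟨hS, h2⟩
    linarith
  clear hlt h2 hS
  rename' S => S', S₀ => S
  obtain ⟨hS, h2⟩ := hS₀
  have hne : S.Nonempty := Finset.card_pos.1 (by omega)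
  have hmin : ∀ S', S ⊂ S' → S' ⊂ W → pot 1 m i a S ≤ pot 1 m i a S' :=
    fun S' h1 h3 => hminS S' ⟨h3, h2.trans (Finset.card_le_card h1.1)⟩
  have hp : pot 1 m i a S ≤ 2 * (1 : ℕ) + 1 := by simpa using hle
  have hX : ∀ X ⊆ S, X.Nonempty → 3 ≤ pot 1 m i a X := fun X hX hXne => by
    simpa using h.gap (Finset.ssubset_of_subset_of_ssubset hX hS) hXne
  have hTpot : 3 ≤ pot 1 m i a (W \ S) := by
    obtain ⟨h3, h4⟩ := sdiff_ssubset_of_nonempty hS hne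
    simpa using h.gap h3 h4
  have hdeg := fun y hy => h.nb_le_one hS hne hmin hp (Or.inl h2) (y := y) hy
  by_cases hex : ∃ y ∈ W \ S, nb m y S = 1
  · obtain ⟨y, hy, hy1⟩ := hex
    by_cases hex2 : ∃ z ∈ W \ S, z ≠ y ∧ nb m z S = 1
    · obtain ⟨z, hz, hzy, hz1⟩ := hex2
      have hY1 : ∀ x ∈ ({y, z} : Finset V), nb m x S = 1 := by simp [hy1, hz1]
      -- Two slots save `2 + 2`, more than `pot S ≤ 3`. Inside `S` they cost at most `4`, and the
      -- previous gap leaves `3 - 4 = -1`. Two slots are permitted only because `D = 1`.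
      refine h.false_of_gain hS hne hmin hp (Or.inl h2) hY1 (by simp)
        (h.colorable_slots hS hY1 ?_) (Z := {y, z}) ?_ ?_
      · intro X hX' hXne
        rw [Finset.card_pair hzy.symm]
        simpa using hX X hX' hXne
      · intro x hx
        simp only [Finset.mem_insert, Finset.mem_singleton] at hx
        rcases hx with rfl | rfl <;> assumption
      · rw [Finset.sum_pair hzy.symm]
        simp [slotCost, hy1, hz1]
        linarith
    · have hY1 : ∀ z ∈ ({y} : Finset V), nb m z S = 1 := by simpa using hy1
      refine h.false_of_slots hS hne hmin hp (Or.inl h2) hY1 (by simp)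
        (h.colorable_slots hS hY1 fun X hX' hXne => ?_) ?_
      · have := hX X hX' hXne
        simp
        linarith
      · rw [Finset.sum_eq_single_of_mem y hy]
        · simp
          linarith
        · intro z hz hzy
          have h3 : nb m z S = 0 := by
            have := hdeg z hz
            have : nb m z S ≠ 1 := fun hc => hex2 ⟨z, hz, hzy, hc⟩
            omega
          simp [hzy, h3]
  · push Not at hex
    have h0 : ∀ y ∈ W \ S, nb m y S = 0 := by
      intro y hy
      have := hex y hy
      have := hdeg y hy
      omega
    refine h.false_of_slots hS hne hmin hp (Or.inl h2) (Y := ∅) (by simp) (by simp)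
      (h.colorable_slots_empty hS) ?_
    rw [Finset.sum_eq_zero fun y hy => by simp [h0 y hy]]
    linarith

end slots

/-! ### Degree conditions and reduction to `D = 1`, potential `-1`. -/

section degrees

variable {D : ℕ} {m : V → V → ℕ} {i a : V → ℕ} {W S X Y M F : Finset V} {v : V}

lemma Coloring.singleton_left (hm : IsMult m) (hi : i v ≤ D) : Coloring D m i a {v} ∅ where
  forest_left := forest_singleton hm
  forest_right := forest_empty
  deg := by simp [hm.self, hi]
  free := by simp

lemma Coloring.singleton_right (hm : IsMult m) (ha : a v = 0) : Coloring D m i a ∅ {v} where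
  forest_left := forest_empty
  forest_right := forest_singleton hm
  deg := by simp
  free := by simp [ha]

lemma MinCounterexample.two_le_card (h : MinCounterexample D m i a W) : 2 ≤ W.card := by
  by_contra hc
  rcases W.eq_empty_or_nonempty with rfl | hne
  · exact h.not_colorable colorable_empty
  · obtain ⟨v, rfl⟩ := Finset.card_eq_one.1 (by have := hne.card_pos; omega : W.card = 1)
    by_cases ha : a v = 0
    · exact h.not_colorable ⟨∅, {v}, by simp, by simp, .singleton_right h.mult ha⟩
    · have ha1 : a v = 1 := by have := h.a_le v; omega
      have h1 := h.pot_ge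
      rw [pot_singleton h.mult, wt, ha1] at h1
      exact h.not_colorable ⟨{v}, ∅, by simp, by simp, .singleton_left h.mult (by omega)⟩

/-- A vertex forced into `M` has weight at most `2D`, below the gap. -/
lemma MinCounterexample.a_eq_zero (h : MinCounterexample D m i a W) (hv : v ∈ W) : a v = 0 := by
  by_contra ha
  have ha1 : a v = 1 := by have := h.a_le v; omega
  have h1 : ({v} : Finset V) ⊂ W := by
    refine Finset.ssubset_iff_subset_ne.2 ⟨by simpa using hv, ?_⟩
    rintro rfl
    have := h.two_le_card
    simp at this
  have h2 := h.gap h1 (by simp)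
  rw [pot_singleton h.mult, wt, ha1] at h2
  push_cast at h2
  omega

/-- A colouring of `W.erase v` together with the splitting of the edges at `v`. -/
lemma nb_of_union_eq_erase (hm : IsMult m) (hd : Disjoint M F) (hu : M ∪ F = W.erase v) :
    nb m v M + nb m v F = nb m v W := by
  rw [← nb_union hd, hu, nb_erase_self hm]

lemma MinCounterexample.two_le_nb_right (h : MinCounterexample D m i a W) (hv : v ∈ W)
    (hd : Disjoint M F) (hu : M ∪ F = W.erase v) (hc : Coloring D m i a M F) :
    2 ≤ nb m v F := by
  by_contra hlt
  have hvn : v ∉ M ∪ F := hu ▸ Finset.notMem_erase v W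
  refine h.not_colorable ⟨M, insert v F, ?_, ?_,
    hc.insert_right h.mult (by omega) (h.a_eq_zero hv)⟩
  · rw [Finset.disjoint_insert_right]
    exact ⟨fun hm => hvn (Finset.mem_union_left _ hm), hd⟩
  · rw [Finset.union_insert, hu, Finset.insert_erase hv]

lemma MinCounterexample.false_of_left (h : MinCounterexample D m i a W) (hv : v ∈ W)
    (hd : Disjoint M F) (hu : M ∪ F = W.erase v) (hc : Coloring D m i a M F)
    (h1 : nb m v M ≤ 1) (h2 : nb m v M + i v ≤ D)
    (h3 : ∀ z ∈ M, nb m z M + m v z + i z ≤ D) : False := by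
  have hvn : v ∉ M ∪ F := hu ▸ Finset.notMem_erase v W
  have hvM : v ∉ M := fun hm => hvn (Finset.mem_union_left _ hm)
  refine h.not_colorable ⟨insert v M, F, ?_, ?_, hc.insert_left h.mult hvM h1 h2 h3⟩
  · rw [Finset.disjoint_insert_left]
    exact ⟨fun hm => hvn (Finset.mem_union_right _ hm), hd⟩
  · rw [Finset.insert_union, hu, Finset.insert_erase hv]

lemma MinCounterexample.false_of_left_zero (h : MinCounterexample D m i a W) (hv : v ∈ W)
    (hd : Disjoint M F) (hu : M ∪ F = W.erase v) (hc : Coloring D m i a M F)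
    (h1 : nb m v M = 0) (h2 : i v ≤ D) : False :=
  h.false_of_left hv hd hu hc (by omega) (by omega) fun z hz => by
    have := nb_eq_zero.1 h1 z hz
    have := hc.deg z hz
    omega

lemma card_erase_lt (hv : v ∈ W) : (W.erase v).card < W.card :=
  Finset.card_lt_card (Finset.erase_ssubset hv)

/-- Adding back a vertex to a set that misses it. -/
lemma MinCounterexample.pot_insert_ge (h : MinCounterexample D m i a W) (hv : v ∈ W)
    (hX : X ⊆ W.erase v) :
    pot D m i a (insert v X) = pot D m i a X + (4 * D + 3 - 2 * i v) - 2 * (D + 1) * nb m v X ∧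
    (X ≠ W.erase v → 2 * (D : ℤ) + 1 ≤ pot D m i a (insert v X)) ∧
    (X = W.erase v → -1 ≤ pot D m i a (insert v X)) := by
  have hvX : v ∉ X := fun hx => Finset.notMem_erase v W (hX hx)
  refine ⟨?_, fun hne => h.gap ?_ (by simp), ?_⟩
  · rw [pot_insert h.mult hvX, wt, h.a_eq_zero hv]
    push_cast
    ring
  · refine Finset.ssubset_iff_subset_ne.2 ⟨Finset.insert_subset hv
      (hX.trans (Finset.erase_subset _ _)), ?_⟩
    intro he
    exact hne (by rw [← he, Finset.erase_insert hvX])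
  · rintro rfl
    rw [Finset.insert_erase hv]
    exact h.pot_ge

/-- When `W.erase v` is coloured, two edges at `v` must go to `F`. With degree at most two none goes
to `M`, so `v` joins `M` unless `i v = D + 1`. In that case the degree is two, and a neighbour is
forced into `M` beforehand, leaving at most one edge from `v` to `F`. -/
theorem MinCounterexample.three_le_nb (h : MinCounterexample D m i a W) (hv : v ∈ W) :
    3 ≤ nb m v W := by
  by_contra hlt
  have hss := Finset.erase_ssubset hv
  by_cases hi : i v ≤ D
  · obtain ⟨M, F, hd, hu, hc⟩ := h.colorable_of_ssubset _ hss
    have h1 := h.two_le_nb_right hv hd hu hc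
    have h2 := nb_of_union_eq_erase h.mult hd hu
    exact h.false_of_left_zero hv hd hu hc (by omega) hi
  · have hiv : i v = D + 1 := by have := h.i_le v; omega
    have h2 : nb m v W = 2 := by
      obtain ⟨M, F, hd, hu, hc⟩ := h.colorable_of_ssubset _ hss
      have h1 := h.two_le_nb_right hv hd hu hc
      have h2 := nb_of_union_eq_erase h.mult hd hu
      omega
    obtain ⟨y, hy, hy1⟩ := exists_of_nb_pos (m := m) (u := v) (X := W) (by omega)
    have hyv : y ≠ v := by
      rintro rfl
      rw [h.mult.self] at hy1
      omega
    have hyW : y ∈ W.erase v := Finset.mem_erase.2 ⟨hyv, hy⟩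
    -- Forcing `y` costs `2D + 3`. Removing `v`, of weight `2D + 1`, regains `1` if it has one edge
    -- to `X` and `2D + 3` if it has two; the gap, respectively `pot W ≥ -1`, then leaves at least
    -- `-1`.
    obtain ⟨M, F, hd, hu, hc⟩ := h.ih m i (Function.update a y 1) (W.erase v) h.mult h.i_le
      (by
        intro z
        by_cases hz : z = y
        · subst hz; simp
        · simp [hz, h.a_le z]) (card_erase_lt hv) (by
        intro X hX hne
        obtain ⟨e1, e2, e3⟩ := h.pot_insert_ge hv hX
        have hg := h.gap (Finset.ssubset_of_subset_of_ssubset hX hss) hne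
        have h4 := pot_congr_weights (D := D) (m := m) (i := i) (a := a) (i' := i)
          (a' := Function.update a y 1) (X := X) (fun z => if z = y then 2 * (D : ℤ) + 3 else 0)
          (by
            intro x hx
            have := h.a_eq_zero (Finset.mem_of_mem_erase (hX hx))
            by_cases hxy : x = y
            · subst hxy; simp [wt, this]
            · simp [wt, hxy])
        rw [Finset.sum_ite_eq'] at h4
        rw [hiv] at e1
        push_cast at e1
        by_cases hyX : y ∈ X
        · rw [if_pos hyX] at h4
          have h5 : nb m v X ≤ 2 := h2 ▸ nb_mono (hX.trans (Finset.erase_subset _ _))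
          have h6 : 1 ≤ nb m v X := (Nat.succ_le_of_lt hy1).trans (le_nb hyX)
          by_cases hXe : X = W.erase v
          · have h7 : nb m v X = 2 := by rw [hXe, nb_erase_self h.mult, h2]
            have := e3 hXe
            rw [h7] at e1
            push_cast at e1
            linarith
          · have := e2 hXe
            have h8 : (1 : ℤ) ≤ nb m v X := by exact_mod_cast h6
            nlinarith
        · rw [if_neg hyX] at h4
          linarith)
    have hc' : Coloring D m i a M F := hc.mono (fun _ _ => le_rfl) fun z hz => by
      rw [h.a_eq_zero (v := z)]
      · omega
      · exact Finset.mem_of_mem_erase (hu ▸ Finset.mem_union_right _ hz)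
    have h3 := h.two_le_nb_right hv hd hu hc'
    have h4 := nb_of_union_eq_erase h.mult hd hu
    have h5 : y ∈ M := by
      have : y ∈ M ∪ F := hu ▸ hyW
      refine (Finset.mem_union.1 this).resolve_right fun hyF => ?_
      have := hc.free y hyF
      simp at this
    have h6 := le_nb (m := m) (u := v) h5
    omega

/-- A vertex of degree three with two free slots makes the potential negative. -/
theorem MinCounterexample.false_of_degree_three (h : MinCounterexample D m i a W) (hv : v ∈ W)
    (h3 : nb m v W = 3) (hi : i v + 1 ≤ D) (hD : 2 ≤ D ∨ 0 ≤ pot D m i a W) : False := by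
  have hss := Finset.erase_ssubset hv
  have hm := h.mult
  -- Every neighbour of `v` reserves a slot for each edge to `v`, costing `6` in all. On `W.erase v`
  -- what remains is at least `pot W + 2D - 3`, which is why `D ≥ 2` or `pot W ≥ 0` is required.
  obtain ⟨M, F, hd, hu, hc⟩ := h.ih m (fun z => min (i z + m v z) (D + 1)) a (W.erase v) hm
    (fun _ => min_le_right _ _) h.a_le (card_erase_lt hv) (by
      intro X hX hne
      obtain ⟨e1, e2, e3⟩ := h.pot_insert_ge hv hX
      have hg := h.gap (Finset.ssubset_of_subset_of_ssubset hX hss) hne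
      have h4 := pot_congr_weights (D := D) (m := m) (i := i) (a := a)
        (i' := fun z => min (i z + m v z) (D + 1)) (a' := a) (X := X)
        (fun z => 2 * (m v z : ℤ)) (by
          intro x _
          have : ((min (i x + m v x) (D + 1) : ℕ) : ℤ) ≤ i x + m v x := by
            exact_mod_cast min_le_left _ _
          simp only [wt]
          linarith)
      have h5 : ∑ z ∈ X, 2 * (m v z : ℤ) = 2 * (nb m v X : ℤ) := by
        rw [← Finset.mul_sum]; simp [nb]
      rw [h5] at h4
      have h6 : nb m v X ≤ 3 := h3 ▸ nb_mono (hX.trans (Finset.erase_subset _ _))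
      have hD1 : (i v : ℤ) + 1 ≤ D := by exact_mod_cast hi
      have hi0 : (0 : ℤ) ≤ i v := by positivity
      have hW : pot D m i a (insert v (W.erase v)) = pot D m i a W := by
        rw [Finset.insert_erase hv]
      have h8 : nb m v X = 3 ∨ (nb m v X ≤ 2 ∧ X ≠ W.erase v) := by
        by_cases h7 : X = W.erase v
        · left; rw [h7, nb_erase_self hm, h3]
        · by_cases h9 : nb m v X = 3
          · exact Or.inl h9
          · exact Or.inr ⟨by omega, h7⟩
      rcases h8 with h8 | ⟨h8, hXe⟩
      · rw [h8] at e1 h4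
        push_cast at e1 h4
        by_cases hXe : X = W.erase v
        · rcases hD with hD | hD
          · have := e3 hXe
            have : (2 : ℤ) ≤ D := by exact_mod_cast hD
            linarith
          · rw [hXe] at e1 h4 ⊢
            rw [hW] at e1
            linarith
        · have := e2 hXe
          linarith
      · have := e2 hXe
        have : nb m v X = 0 ∨ nb m v X = 1 ∨ nb m v X = 2 := by omega
        rcases this with h9 | h9 | h9 <;> rw [h9] at e1 h4 <;> push_cast at e1 h4 <;> linarith)
  have hc' : Coloring D m i a M F := hc.mono (fun z hz => by
    have := hc.deg z hz
    omega) (fun _ _ => le_rfl)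
  have h1 := h.two_le_nb_right hv hd hu hc'
  have h2 := nb_of_union_eq_erase hm hd hu
  refine h.false_of_left hv hd hu hc' (by omega) (by omega) fun z hz => ?_
  have := hc.deg z hz
  omega

lemma pot_eq_sum (m : V → V → ℕ) (X : Finset V) :
    pot D m i a X = ∑ v ∈ X, (wt D i a v - (D + 1) * nb m v X) := by
  unfold pot
  rw [Finset.sum_sub_distrib, ← Finset.mul_sum, ← cast_cross]

lemma MinCounterexample.wt_eq (h : MinCounterexample D m i a W) (hv : v ∈ W) :
    wt D i a v = 4 * D + 3 - 2 * i v := by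
  rw [wt, h.a_eq_zero hv]
  push_cast
  ring

/-- Some vertex of degree three has positive charge. -/
theorem MinCounterexample.exists_degree_three (h : MinCounterexample D m i a W)
    (hD1 : 1 ≤ D) :
    ∃ v ∈ W, nb m v W = 3 ∧ i v + 1 ≤ D := by
  by_contra! hno
  -- Half of each edge is charged to each end. A vertex of degree at least four contributes at most
  -- `4D + 3 - 4(D + 1) = -1`; one of degree three with `i v ≥ D` contributes at most `-D`.
  have h1 : pot D m i a W ≤ ∑ v ∈ W, (-1 : ℤ) := by
    rw [pot_eq_sum]
    refine Finset.sum_le_sum fun v hv => ?_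
    rw [h.wt_eq hv]
    have h3 := h.three_le_nb hv
    have h0 : (0 : ℤ) ≤ i v := by positivity
    have hD : (0 : ℤ) ≤ D := by positivity
    by_cases h4 : nb m v W = 3
    · have h5 := hno v hv h4
      have h6 : (D : ℤ) + 1 ≤ i v + 1 := by exact_mod_cast h5
      rw [h4]
      push_cast
      have : (1 : ℤ) ≤ D := by exact_mod_cast hD1
      linarith
    · have h5 : (4 : ℤ) ≤ nb m v W := by exact_mod_cast (by omega : 4 ≤ nb m v W)
      nlinarith
  have h2 := h.pot_ge
  have h3 := h.two_le_card
  simp at h1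
  omega

theorem MinCounterexample.eq_one (h : MinCounterexample D m i a W) (hD1 : 1 ≤ D) :
    D = 1 ∧ pot D m i a W = -1 := by
  obtain ⟨v, hv, h3, hi⟩ := h.exists_degree_three hD1
  have h1 := h.false_of_degree_three hv h3 hi
  have h2 := h.pot_ge
  constructor <;> by_contra hc <;> exact h1 (by omega)

end degrees

/-! ### The case `D = 1`: vertices of degree three. -/

section one

variable {m : V → V → ℕ} {i a : V → ℕ} {W S X Y M F : Finset V} {v x z : V}

/-- The unconstrained vertices of degree three. -/
def threes (m : V → V → ℕ) (i : V → ℕ) (W : Finset V) : Finset V :=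
  W.filter fun v => i v = 0 ∧ nb m v W = 3

lemma mem_threes : v ∈ threes m i W ↔ v ∈ W ∧ i v = 0 ∧ nb m v W = 3 := by
  simp [threes]

/-- Slots are reserved for the edges at `v`, except one edge to `z`. That costs `4`, just within the
improved gap. The vertex `v` could then join `M` unless the unprotected edge obstructs it, so `z`
lies in `M` and is already saturated. -/
lemma MinCounterexample.exists_saturated (h : MinCounterexample 1 m i a W)
    (hv : v ∈ threes m i W) (hz : z ∈ W) (hvz : 1 ≤ m v z) :
    ∃ M F, Disjoint M F ∧ M ∪ F = W.erase v ∧ Coloring 1 m i a M F ∧ z ∈ M ∧ m v z = 1 ∧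
      nb m v M = 1 ∧ nb m v F = 2 ∧ nb m z M + i z = 1 := by
  obtain ⟨hvW, hi, h3⟩ := mem_threes.1 hv
  have hm := h.mult
  have hss := Finset.erase_ssubset hvW
  set i' : V → ℕ := fun y => min (i y + (m v y - if y = z then 1 else 0)) 2 with hi'
  have hzv : z ∈ W.erase v := Finset.mem_erase.2
    ⟨by rintro rfl; rw [hm.self] at hvz; omega, hz⟩
  obtain ⟨M, F, hd, hu, hc⟩ := h.ih m i' a (W.erase v) hm
    (fun _ => min_le_right _ _) h.a_le (card_erase_lt hvW) (by
      intro X hX hne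
      -- The improved gap does not cover single vertices; these have weight at least `7 - 2 * 2 = 3`
      -- because `i'` is truncated at `2`.
      by_cases hX1 : X.card ≤ 1
      · obtain ⟨y, rfl⟩ := Finset.card_eq_one.1 (by have := hne.card_pos; omega : X.card = 1)
        have hy : y ∈ W := Finset.mem_of_mem_erase (hX (Finset.mem_singleton_self y))
        rw [pot_singleton hm, wt, h.a_eq_zero hy]
        have : i' y ≤ 2 := min_le_right _ _
        push_cast
        omega
      · have h4 := h.gap_two (Finset.ssubset_of_subset_of_ssubset hX hss) (by omega)
        have hz1 : ∀ y, (0 : ℤ) ≤ 2 * (m v y - if y = z then 1 else 0) := by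
          intro y
          split_ifs with hy
          · subst hy
            have : (1 : ℤ) ≤ m v y := by exact_mod_cast hvz
            linarith
          · simp
        have h5 := pot_congr_weights (D := 1) (m := m) (i := i) (a := a)
          (i' := i') (a' := a) (X := X)
          (fun y => 2 * ((m v y : ℤ) - if y = z then 1 else 0)) (by
            intro y _
            have h6 := hz1 y
            have : (i' y : ℤ) ≤ i y + ((m v y : ℤ) - if y = z then 1 else 0) := by
              have h7 : i' y ≤ i y + (m v y - if y = z then 1 else 0) := min_le_left _ _
              split_ifs at h7 h6 ⊢ <;> omega
            simp only [wt]
            push_cast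
            linarith)
        have h6 := Finset.sum_le_sum_of_subset_of_nonneg hX fun y _ _ => hz1 y
        have h7 : ∑ y ∈ W.erase v, 2 * ((m v y : ℤ) - if y = z then 1 else 0) = 4 := by
          rw [← Finset.mul_sum, Finset.sum_sub_distrib, Finset.sum_ite_eq', if_pos hzv]
          have h8 : nb m v (W.erase v) = 3 := by rw [nb_erase_self hm, h3]
          have h9 : ∑ y ∈ W.erase v, (m v y : ℤ) = 3 := by
            exact_mod_cast h8
          rw [h9]; norm_num
        rw [h7] at h6
        linarith)
  have hc' : Coloring 1 m i a M F := hc.mono (fun y hy => by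
    have := hc.deg y hy
    simp only [hi'] at this ⊢
    omega) (fun _ _ => le_rfl)
  have h1 := h.two_le_nb_right hvW hd hu hc'
  have h2 := nb_of_union_eq_erase hm hd hu
  have h4 : nb m v M = 1 := by
    by_contra hne
    exact h.false_of_left_zero hvW hd hu hc' (by omega) (by omega)
  have hother : ∀ y ∈ M, y ≠ z → nb m y M + m v y + i y ≤ 1 := by
    intro y hy hyz
    have := hc.deg y hy
    simp only [hi', hyz, if_false] at this
    omega
  have hzM : z ∈ M := by
    by_contra hzM
    exact h.false_of_left hvW hd hu hc' (by omega) (by omega) fun y hy =>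
      hother y hy (by rintro rfl; exact hzM hy)
  have hvz1 : m v z = 1 := by
    have := le_nb (m := m) (u := v) hzM
    omega
  refine ⟨M, F, hd, hu, hc', hzM, hvz1, h4, by omega, ?_⟩
  have hz2 := hc'.deg z hzM
  by_contra hne
  refine h.false_of_left hvW hd hu hc' (by omega) (by omega) fun y hy => ?_
  by_cases hyz : y = z
  · subst hyz; omega
  · exact hother y hy hyz

/-- In the colouring of `exists_saturated`, `z` has one edge to `v` and contributes one to `nb m z M
+ i z`. It also has two edges to `F`: otherwise moving it to `F` would free `v` for `M`. In
particular vertices of `threes` are never adjacent. -/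
theorem MinCounterexample.neighbor_three (h : MinCounterexample 1 m i a W)
    (hv : v ∈ threes m i W) (hz : z ∈ W) (hvz : 1 ≤ m v z) :
    m v z = 1 ∧ i z ≤ 1 ∧ 4 ≤ nb m z W + i z := by
  obtain ⟨M, F, hd, hu, hc, hzM, h1, h2, h3, h4⟩ := h.exists_saturated hv hz hvz
  obtain ⟨hvW, hi, -⟩ := mem_threes.1 hv
  have hm := h.mult
  refine ⟨h1, by omega, ?_⟩
  have h5 : 2 ≤ nb m z F := by
    by_contra hlt
    have hzF : z ∉ F := Finset.disjoint_left.1 hd hzM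
    have hc2 : Coloring 1 m i a (M.erase z) (insert z F) :=
      (Coloring.mk (hc.forest_left.mono (Finset.erase_subset _ _)) hc.forest_right
        (fun y hy => by
          have := hc.deg y (Finset.mem_of_mem_erase hy)
          have := nb_mono (m := m) (u := y) (Finset.erase_subset z M)
          omega) hc.free).insert_right hm (by omega) (h.a_eq_zero hz)
    refine h.false_of_left_zero hvW ?_ ?_ hc2 ?_ (by omega)
    · rw [Finset.disjoint_insert_right]
      exact ⟨Finset.notMem_erase _ _, hd.mono_left (Finset.erase_subset _ _)⟩
    · rw [Finset.union_insert, ← Finset.insert_union, Finset.insert_erase hzM, hu]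
    · have := nb_erase (m := m) (u := v) hzM
      omega
  have h6 : nb m z W = m z v + (nb m z M + nb m z F) := by
    rw [nb_erase hvW, ← nb_union hd, hu]
  have h7 := hm.symm z v
  omega

lemma MinCounterexample.not_mem_threes (h : MinCounterexample 1 m i a W)
    (hv : v ∈ threes m i W) (hvz : 1 ≤ m v z) : z ∉ threes m i W := by
  intro hz
  obtain ⟨hzW, hi, h3⟩ := mem_threes.1 hz
  have := (h.neighbor_three hv hzW hvz).2.2
  omega

lemma MinCounterexample.threes_indep (h : MinCounterexample 1 m i a W)
    (hv : v ∈ threes m i W) (hz : z ∈ threes m i W) : m v z = 0 := by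
  by_contra hc
  exact h.not_mem_threes hv (Nat.one_le_iff_ne_zero.2 hc) hz

/-- A vertex of degree three adjacent to `x` has exactly two more neighbours. -/
lemma MinCounterexample.exists_other_neighbors (h : MinCounterexample 1 m i a W)
    (hv : v ∈ threes m i W) (hx : x ∈ W) (hvx : 1 ≤ m v x) :
    ∃ p q, p ∈ W ∧ q ∈ W ∧ p ≠ q ∧ p ≠ x ∧ q ≠ x ∧
      ∀ y ∈ W, m v y = if y = x ∨ y = p ∨ y = q then 1 else 0 := by
  obtain ⟨hvW, hi, h3⟩ := mem_threes.1 hv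
  have h01 : ∀ y ∈ W, m v y = if 1 ≤ m v y then 1 else 0 := by
    intro y hy
    split_ifs with h1
    · exact (h.neighbor_three hv hy h1).1
    · omega
  set N := W.filter fun y => 1 ≤ m v y with hN
  have hcard : N.card = 3 := by
    rw [hN, Finset.card_filter, ← h3]
    exact (Finset.sum_congr rfl h01).symm
  have hxN : x ∈ N := by simp [hN, hx, hvx]
  have h2 : (N.erase x).card = 2 := by rw [Finset.card_erase_of_mem hxN, hcard]
  obtain ⟨p, q, hpq, he⟩ := Finset.card_eq_two.1 h2
  have hp : p ∈ N.erase x := by simp [he]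
  have hq : q ∈ N.erase x := by simp [he]
  refine ⟨p, q, ?_, ?_, hpq, Finset.ne_of_mem_erase hp, Finset.ne_of_mem_erase hq, ?_⟩
  · exact (Finset.mem_filter.1 (Finset.mem_of_mem_erase hp)).1
  · exact (Finset.mem_filter.1 (Finset.mem_of_mem_erase hq)).1
  · intro y hy
    rw [h01 y hy]
    have h5 : N = insert x {p, q} := by rw [← he, Finset.insert_erase hxN]
    have h6 : 1 ≤ m v y ↔ y = x ∨ y = p ∨ y = q := by
      have : y ∈ N ↔ 1 ≤ m v y := by simp [hN, hy]
      rw [← this, h5]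
      simp
    simp only [h6]

/-- Adding an edge `pq`. -/
def addEdge (m : V → V → ℕ) (p q : V) (y z : V) : ℕ :=
  m y z + if (y = p ∧ z = q) ∨ (y = q ∧ z = p) then 1 else 0

lemma isMult_addEdge (hm : IsMult m) {p q : V} (hpq : p ≠ q) : IsMult (addEdge m p q) where
  symm y z := by
    unfold addEdge
    rw [hm.symm y z]
    congr 2
    rw [eq_iff_iff]
    tauto
  self y := by
    unfold addEdge
    rw [hm.self, if_neg]
    rintro (⟨rfl, h⟩ | ⟨rfl, h⟩)
    · exact hpq h
    · exact hpq h.symm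

lemma le_addEdge (p q y z : V) : m y z ≤ addEdge m p q y z := by
  unfold addEdge
  omega

lemma pot_addEdge {p q : V} (hpq : p ≠ q) (D : ℕ) (X : Finset V) :
    pot D (addEdge m p q) i a X
      = pot D m i a X - if p ∈ X ∧ q ∈ X then 2 * ((D : ℤ) + 1) else 0 := by
  have key : cross (addEdge m p q) X X = cross m X X + if p ∈ X ∧ q ∈ X then 2 else 0 := by
    unfold cross nb addEdge
    simp_rw [Finset.sum_add_distrib]
    congr 1
    have : ∀ y z, (if (y = p ∧ z = q) ∨ (y = q ∧ z = p) then 1 else 0)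
        = (if y = p then (if z = q then 1 else 0) else 0)
          + (if y = q then (if z = p then 1 else 0) else 0) := by
      intro y z
      by_cases h1 : y = p
      · subst h1
        simp [hpq]
      · by_cases h2 : y = q
        · subst h2; simp [h1]
        · simp [h1, h2]
    simp_rw [this, Finset.sum_add_distrib]
    by_cases hp : p ∈ X <;> by_cases hq : q ∈ X <;> simp [hp, hq, Finset.sum_ite_irrel]
  unfold pot
  rw [key]
  split_ifs <;> push_cast <;> ring

end one

/-! ### Vertices of degree four with all neighbours in `threes`. -/

section four

variable {m : V → V → ℕ} {i a : V → ℕ} {W S X Y M F J : Finset V} {v x z : V}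

lemma MinCounterexample.cross_threes (h : MinCounterexample 1 m i a W)
    (hJ : J ⊆ threes m i W) : cross m J J = 0 :=
  cross_eq_zero.2 fun _ hy => nb_eq_zero.2 fun _ hz => h.threes_indep (hJ hy) (hJ hz)

/-- The potential after adding vertices of degree three with two neighbours in `X` and a common
neighbour `x`. -/
lemma MinCounterexample.pot_insert_union (h : MinCounterexample 1 m i a W)
    (hJ : J ⊆ threes m i W) (hJX : Disjoint X J) (hJ2 : ∀ v ∈ J, nb m v X = 2)
    (hx : x ∈ W) (hix : i x = 0) (hxX : x ∉ X) (hxJ : x ∉ J) (hx0 : nb m x X = 0)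
    (hx1 : ∀ v ∈ J, m x v = 1) :
    pot 1 m i a (X ∪ J) = pot 1 m i a X - J.card ∧
    pot 1 m i a (insert x (X ∪ J)) = pot 1 m i a X + 7 - 5 * J.card := by
  have hm := h.mult
  have h1 : cross m X J = 2 * J.card := by
    rw [cross_comm hm, cross, Finset.sum_congr rfl hJ2]
    simp [mul_comm]
  have h2 : pot 1 m i a J = 7 * J.card := by
    unfold pot
    rw [h.cross_threes hJ]
    have : ∀ v ∈ J, wt 1 i a v = 7 := by
      intro v hv
      obtain ⟨h3, h4, -⟩ := mem_threes.1 (hJ hv)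
      rw [h.wt_eq h3, h4]
      norm_num
    rw [Finset.sum_congr rfl this]
    simp [mul_comm]
  have h3 : pot 1 m i a (X ∪ J) = pot 1 m i a X - J.card := by
    rw [pot_union hm hJX, h1, h2]
    push_cast
    ring
  refine ⟨h3, ?_⟩
  have h4 : nb m x J = J.card := by
    rw [nb, Finset.sum_congr rfl hx1]
    simp
  rw [pot_insert hm (by simp [hxX, hxJ]), h3, nb_union hJX, hx0, h4, h.wt_eq hx, hix]
  push_cast
  ring

/-- The three added edges are subdivided one after another, the last added first. The `u k` are not
ends of these edges, so their own adjacencies never change. -/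
lemma forest_subdivide_three {F : Finset V} {p q u : Fin 3 → V} (hm : IsMult m)
    (hpq : ∀ k, p k ≠ q k) (hF : ∀ k, u k ∉ F) (hu : Function.Injective u)
    (huv : ∀ k l, m (u k) (u l) = 0) (hup : ∀ k l, u k ≠ p l) (huq : ∀ k l, u k ≠ q l)
    (hadj : ∀ k, ∀ y ∈ F, m (u k) y ≤ if y = p k ∨ y = q k then 1 else 0)
    (hf : Forest (addEdge (addEdge (addEdge m (p 0) (q 0)) (p 1) (q 1)) (p 2) (q 2)) F) :
    Forest m (insert (u 0) (insert (u 1) (insert (u 2) F))) := by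
  have hm1 := isMult_addEdge hm (hpq 0)
  have hm2 := isMult_addEdge hm1 (hpq 1)
  have hadd : ∀ (m' : V → V → ℕ) k l y, addEdge m' (p l) (q l) (u k) y = m' (u k) y := by
    intro m' k l y
    simp [addEdge, hup, huq]
  have h01 : u 0 ≠ u 1 := fun hc => by simpa using hu hc
  have h02 : u 0 ≠ u 2 := fun hc => by simpa using hu hc
  have h12 : u 1 ≠ u 2 := fun hc => by simpa using hu hc
  have s1 := hf.subdivide (v := u 2) hm2 (hpq 2) (le_addEdge _ _) (by simp [addEdge])
    (by simp [addEdge]) (hF 2) (by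
      intro y hy
      rw [hadd, hadd]
      exact hadj 2 y hy)
  have s2 := s1.subdivide (v := u 1) hm1 (hpq 1) (le_addEdge _ _) (by simp [addEdge])
    (by simp [addEdge]) (by simp [h12, hF 1]) (by
      intro y hy
      rw [hadd]
      rcases Finset.mem_insert.1 hy with rfl | hy
      · simp [huv]
      · exact hadj 1 y hy)
  refine s2.subdivide (v := u 0) hm (hpq 0) (le_addEdge _ _) (by simp [addEdge])
    (by simp [addEdge]) (by simp [h01, h02, hF 0]) ?_
  intro y hy
  simp only [Finset.mem_insert] at hy
  rcases hy with rfl | rfl | hy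
  · simp [huv]
  · simp [huv]
  · exact hadj 0 y hy

/-- An unconstrained vertex of degree four has a neighbour outside `threes`. -/
theorem MinCounterexample.nb_threes_le (h : MinCounterexample 1 m i a W) (hx : x ∈ W)
    (hix : i x = 0) (hx4 : nb m x W = 4) : nb m x (threes m i W) ≤ 3 := by
  by_contra hlt
  have hm := h.mult
  have hAW : threes m i W ⊆ W := Finset.filter_subset _ _
  have hA4 : nb m x (threes m i W) = 4 := by
    have := nb_mono (m := m) (u := x) hAW
    omega
  have hxA : x ∉ threes m i W := by
    intro hc
    have := (mem_threes.1 hc).2.2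
    omega
  have hout : ∀ y ∈ W, y ∉ threes m i W → m x y = 0 := by
    intro y hy hyA
    have h1 := nb_sdiff (m := m) (u := x) hAW
    have h2 : nb m x (W \ threes m i W) = 0 := by omega
    exact nb_eq_zero.1 h2 y (Finset.mem_sdiff.2 ⟨hy, hyA⟩)
  set N := (threes m i W).filter fun y => 1 ≤ m x y with hN
  have hN1 : ∀ v ∈ N, v ∈ threes m i W ∧ m v x = 1 ∧ m x v = 1 := by
    intro v hv
    obtain ⟨h1, h2⟩ := Finset.mem_filter.1 hv
    have h3 := (h.neighbor_three h1 hx (by rw [hm.symm]; exact h2)).1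
    exact ⟨h1, h3, by rw [hm.symm]; exact h3⟩
  have hNcard : N.card = 4 := by
    rw [hN, Finset.card_filter, ← hA4]
    refine Finset.sum_congr rfl fun y hy => ?_
    split_ifs with h1
    · exact ((hN1 y (Finset.mem_filter.2 ⟨hy, h1⟩)).2.2).symm
    · omega
  obtain ⟨w, hw⟩ : N.Nonempty := Finset.card_pos.1 (by omega)
  obtain ⟨u₀, u₁, u₂, h01, h02, h12, hNe⟩ := Finset.card_eq_three.1
    (by rw [Finset.card_erase_of_mem hw, hNcard] : (N.erase w).card = 3)
  set u : Fin 3 → V := ![u₀, u₁, u₂] with hu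
  have huN : ∀ k, u k ∈ N.erase w := by
    intro k
    rw [hNe]
    fin_cases k <;> simp [hu]
  have huN' : ∀ k, u k ∈ N := fun k => Finset.mem_of_mem_erase (huN k)
  have huinj : Function.Injective u := by
    intro k l hkl
    fin_cases k <;> fin_cases l <;> simp_all [eq_comm]
  choose p q hpW hqW hpq hpx hqx hadj using fun k =>
    h.exists_other_neighbors (hN1 _ (huN' k)).1 hx (hN1 _ (huN' k)).2.1.ge
  have huA : ∀ k, u k ∈ threes m i W := fun k => (hN1 _ (huN' k)).1
  have hpA : ∀ k, p k ∉ threes m i W := fun k =>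
    h.not_mem_threes (huA k) (by rw [hadj k _ (hpW k)]; simp)
  have hqA : ∀ k, q k ∉ threes m i W := fun k =>
    h.not_mem_threes (huA k) (by rw [hadj k _ (hqW k)]; simp)
  set R := W \ insert x N with hR
  have hRW : R ⊆ W := Finset.sdiff_subset
  have hRx : ∀ y ∈ R, y ≠ x ∧ y ∉ N := by
    intro y hy
    have := (Finset.mem_sdiff.1 hy).2
    simpa using this
  set m3 := addEdge (addEdge (addEdge m (p 0) (q 0)) (p 1) (q 1)) (p 2) (q 2) with hm3
  have hm3le : ∀ y z, m y z ≤ m3 y z := fun y z =>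
    (le_addEdge _ _ y z).trans ((le_addEdge _ _ y z).trans (le_addEdge _ _ y z))
  have hm3mult : IsMult m3 :=
    isMult_addEdge (isMult_addEdge (isMult_addEdge hm (hpq 0)) (hpq 1)) (hpq 2)
  have hxR : ∀ X ⊆ R, nb m x X = 0 := by
    intro X hX
    refine nb_eq_zero.2 fun y hy => ?_
    obtain ⟨h1, h2⟩ := hRx y (hX hy)
    by_cases hyA : y ∈ threes m i W
    · by_contra h3
      exact h2 (Finset.mem_filter.2 ⟨hyA, Nat.one_le_iff_ne_zero.2 h3⟩)
    · exact hout y (hRW (hX hy)) hyA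
  have hunb : ∀ k, ∀ X ⊆ R,
      (nb m (u k) X = 2 ↔ p k ∈ X ∧ q k ∈ X) := by
    intro k X hX
    have h1 : nb m (u k) X = ((X.filter fun y => y = p k) ∪ (X.filter fun y => y = q k)).card := by
      rw [← Finset.filter_or, Finset.card_filter]
      refine Finset.sum_congr rfl fun y hy => ?_
      rw [hadj k y (hRW (hX hy))]
      simp [(hRx y (hX hy)).1]
    rw [h1, Finset.filter_eq', Finset.filter_eq']
    have := hpq k
    by_cases h2 : p k ∈ X <;> by_cases h3 : q k ∈ X <;> simp [h2, h3]
    exact Finset.card_pair this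
  have hgood : ∀ X ⊆ R, X.Nonempty → -1 ≤ pot 1 m3 i a X := by
    intro X hX hne
    have hXW : X ⊆ W := hX.trans hRW
    have hxX : x ∉ X := fun hc => (hRx x (hX hc)).1 rfl
    have hXss : X ⊂ W := Finset.ssubset_iff_subset_ne.2 ⟨hXW, by rintro rfl; exact hxX hx⟩
    set J := (Finset.univ.filter fun k => nb m (u k) X = 2).image u with hJ
    have hJN : ∀ v ∈ J, v ∈ N ∧ v ≠ w ∧ nb m v X = 2 := by
      intro v hv
      simp only [hJ, Finset.mem_image, Finset.mem_filter, Finset.mem_univ, true_and] at hv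
      obtain ⟨k, hk, rfl⟩ := hv
      exact ⟨huN' k, Finset.ne_of_mem_erase (huN k), hk⟩
    have hJcard : (J.card : ℤ) = (if p 0 ∈ X ∧ q 0 ∈ X then 1 else 0)
        + (if p 1 ∈ X ∧ q 1 ∈ X then 1 else 0) + (if p 2 ∈ X ∧ q 2 ∈ X then 1 else 0) := by
      rw [hJ, Finset.card_image_of_injective _ huinj, Finset.card_filter, Fin.sum_univ_three]
      simp only [hunb _ X hX]
      push_cast
      rfl
    have h1 : pot 1 m3 i a X = pot 1 m i a X - 4 * J.card := by
      rw [hm3, pot_addEdge (hpq 2), pot_addEdge (hpq 1), pot_addEdge (hpq 0), hJcard]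
      split_ifs <;> push_cast <;> ring
    have hJX : Disjoint X J := Finset.disjoint_right.2 fun v hv hvX =>
      (hRx v (hX hvX)).2 (hJN v hv).1
    have hJA : J ⊆ threes m i W := fun v hv => (hN1 v (hJN v hv).1).1
    have hxJ : x ∉ J := fun hc => hxA (hJA hc)
    obtain ⟨h2, h3⟩ := h.pot_insert_union (X := X) (x := x) hJA hJX (fun v hv => (hJN v hv).2.2)
      hx hix hxX hxJ (hxR X hX) (fun v hv => (hN1 v (hJN v hv).1).2.2)
    have h4 := h.gap hXss hne
    have hwW : w ∈ W := hAW (hN1 w hw).1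
    -- The omission of `w` keeps this set proper, so that the gap applies to it.
    have hwn : w ∉ insert x (X ∪ J) := by
      simp only [Finset.mem_insert, Finset.mem_union, not_or]
      refine ⟨?_, fun hc => (hRx w (hX hc)).2 hw, fun hc => (hJN w hc).2.1 rfl⟩
      rintro rfl
      exact hxA (hN1 w hw).1
    have hss : insert x (X ∪ J) ⊂ W := by
      refine Finset.ssubset_iff_subset_ne.2 ⟨?_, fun hc => hwn (hc ▸ hwW)⟩
      exact Finset.insert_subset hx (Finset.union_subset hXW (hJA.trans hAW))
    have hcard2 : (X ∪ J).card = X.card + J.card := Finset.card_union_of_disjoint hJX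
    have hXpos := hne.card_pos
    have hJ3 : J.card ≤ 3 := by
      have : (J.card : ℤ) ≤ 3 := by
        rw [hJcard]
        split_ifs <;> norm_num
      exact_mod_cast this
    -- With `j` the size of `J`, the gaps for `X ∪ J` and for this set with `x` give `pot X ≥ 4 + j`
    -- and `pot X ≥ 5j - 3`. After the cost `4j` of the new edges, `1`, `-1`, `0` remain for `j = 1,
    -- 2, 3`.
    by_cases hJ0 : J.card = 0
    · rw [h1, hJ0]
      push_cast at h4 ⊢
      linarith
    · have h5 := h.gap_two hss (by
        rw [Finset.card_insert_of_notMem (by simp [hxX, hxJ])]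
        omega)
      have h6 := h.gap_two (Finset.ssubset_of_subset_of_ssubset (Finset.subset_insert x _) hss)
        (by omega)
      omega
  have hcardR : R.card < W.card := by
    refine Finset.card_lt_card (Finset.ssubset_iff_subset_ne.2 ⟨hRW, fun hc => ?_⟩)
    exact (hRx x (hc ▸ hx)).1 rfl
  obtain ⟨M, F, hd, hMF, hc⟩ := h.ih m3 i a R hm3mult h.i_le h.a_le hcardR hgood
  have hMR : M ⊆ R := hMF ▸ Finset.subset_union_left
  have hFR : F ⊆ R := hMF ▸ Finset.subset_union_right
  set F' := insert (u 0) (insert (u 1) (insert (u 2) F)) with hF'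
  have hF'mem : ∀ y, y ∈ F' ↔ y ∈ N.erase w ∨ y ∈ F := by
    intro y
    rw [hNe]
    simp only [hF', hu, Finset.mem_insert, Finset.mem_singleton]
    simp
    tauto
  have hF'forest : Forest m F' := by
    refine forest_subdivide_three (p := p) (q := q) hm hpq
      (fun k hk => (hRx _ (hFR hk)).2 (huN' k)) huinj
      (fun k l => h.threes_indep (huA k) (huA l)) (fun k l hkl => hpA l (hkl ▸ huA k))
      (fun k l hkl => hqA l (hkl ▸ huA k)) ?_ hc.forest_right
    intro k y hy
    rw [hadj k y (hRW (hFR hy))]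
    simp [(hRx y (hFR hy)).1]
  have hxM : x ∉ M := fun hc' => (hRx x (hMR hc')).1 rfl
  have hM0 := hxR M hMR
  have hF'W : ∀ y ∈ F', y ∈ W := by
    intro y hy
    rcases (hF'mem y).1 hy with hy | hy
    · exact hAW (hN1 y (Finset.mem_of_mem_erase hy)).1
    · exact hRW (hFR hy)
  have c0 : Coloring 1 m i a M F' := by
    refine ⟨hc.forest_left.congr_le fun y _ z _ => hm3le y z, hF'forest, fun y hy => ?_,
      fun y hy => h.a_eq_zero (hF'W y hy)⟩
    have := hc.deg y hy
    have : nb m y M ≤ nb m3 y M := Finset.sum_le_sum fun z _ => hm3le y z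
    omega
  have c1 : Coloring 1 m i a (insert x M) F' := c0.insert_left hm hxM (by omega) (by omega)
    fun z hz => by
      have := nb_eq_zero.1 hM0 z hz
      have := c0.deg z hz
      omega
  obtain ⟨hwA, hwx, hxw⟩ := hN1 w hw
  obtain ⟨hwW, hiw, hw3⟩ := mem_threes.1 hwA
  have hdis : Disjoint (insert x M) F' := by
    rw [Finset.disjoint_left]
    intro y hy hy'
    rcases Finset.mem_insert.1 hy with rfl | hy
    · rcases (hF'mem y).1 hy' with h1 | h1
      · exact hxA (hN1 y (Finset.mem_of_mem_erase h1)).1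
      · exact (hRx y (hFR h1)).1 rfl
    · rcases (hF'mem y).1 hy' with h1 | h1
      · exact (hRx y (hMR hy)).2 (Finset.mem_of_mem_erase h1)
      · exact Finset.disjoint_left.1 hd hy h1
  have hxw' : x ≠ w := by rintro rfl; exact hxA hwA
  have hunion : insert x M ∪ F' = W.erase w := by
    ext y
    have e1 : y ∈ R ↔ y ∈ M ∨ y ∈ F := by rw [← hMF, Finset.mem_union]
    have e2 : y ∈ R ↔ y ∈ W ∧ ¬ (y = x ∨ y ∈ N) := by
      rw [hR, Finset.mem_sdiff, Finset.mem_insert]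
    rw [Finset.mem_union, Finset.mem_insert, hF'mem, Finset.mem_erase, Finset.mem_erase]
    constructor
    · rintro ((rfl | hy) | ⟨hyw, hy⟩ | hy)
      · exact ⟨hxw', hx⟩
      · have := e2.1 (e1.2 (Or.inl hy))
        exact ⟨by rintro rfl; exact this.2 (Or.inr hw), this.1⟩
      · exact ⟨hyw, hAW (hN1 y hy).1⟩
      · have := e2.1 (e1.2 (Or.inr hy))
        exact ⟨by rintro rfl; exact this.2 (Or.inr hw), this.1⟩
    · rintro ⟨hyw, hyW⟩
      by_cases hyx : y = x
      · exact Or.inl (Or.inl hyx)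
      by_cases hyN : y ∈ N
      · exact Or.inr (Or.inl ⟨hyw, hyN⟩)
      · rcases e1.1 (e2.2 ⟨hyW, by simp [hyx, hyN]⟩) with h1 | h1
        · exact Or.inl (Or.inr h1)
        · exact Or.inr (Or.inr h1)
  -- Two of the three edges at `w` go to `F'`, so `x` is its only neighbour in the first class.
  -- Since `x` has no neighbour in `M`, `w` can join them.
  have h5 := h.two_le_nb_right hwW hdis hunion c1
  have h6 := nb_of_union_eq_erase hm hdis hunion
  have h7 : nb m w (insert x M) = m w x + nb m w M := nb_insert hxM
  refine h.false_of_left hwW hdis hunion c1 (by omega) (by omega) fun z hz => ?_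
  rcases Finset.mem_insert.1 hz with rfl | hz
  · rw [nb_insert hxM, hm.self]
    omega
  · have h8 : m w z ≤ nb m w M := le_nb hz
    have := c1.deg z (Finset.mem_insert_of_mem hz)
    omega

end four

/-! ### Discharging and the covering criterion. -/

section final

variable {m : V → V → ℕ} {i a : V → ℕ} {W X Y M F : Finset V} {v x y z : V}

lemma threes_subset : threes m i W ⊆ W := Finset.filter_subset _ _

/-- The charge is three times the contribution to the potential, plus `1` for each edge to `threes`.
Values from `-3` to `0` can occur only when `i x + deg x = 4`; for degree four this uses
`nb_threes_le`. -/
lemma MinCounterexample.charge_le (h : MinCounterexample 1 m i a W)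
    (hx : x ∈ W \ threes m i W) :
    (21 : ℤ) - 6 * i x - 6 * nb m x W + nb m x (threes m i W) ≤ 0 ∧
    ((21 : ℤ) - 6 * i x - 6 * nb m x W + nb m x (threes m i W) ≤ -4 ∨
      (i x + nb m x W = 4 ∧ i x ≤ 1 ∧ nb m x (threes m i W) ≤ 3)) := by
  obtain ⟨hxW, hxA⟩ := Finset.mem_sdiff.1 hx
  have h3 := h.three_le_nb hxW
  have hle : nb m x (threes m i W) ≤ nb m x W := nb_mono threes_subset
  have h4 : i x ≤ 1 → 4 ≤ i x + nb m x W := by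
    intro h1
    by_contra hc
    exact hxA (mem_threes.2 ⟨hxW, by omega, by omega⟩)
  by_cases h0 : nb m x (threes m i W) = 0
  · have := h.i_le x
    by_cases h1 : i x ≤ 1
    · have := h4 h1
      omega
    · omega
  · obtain ⟨v, hv, hxv⟩ := exists_of_nb_pos (Nat.pos_of_ne_zero h0)
    obtain ⟨-, h1, h2⟩ := h.neighbor_three hv hxW (by rw [h.mult.symm]; exact hxv)
    by_cases h5 : i x = 0 ∧ nb m x W = 4
    · have := h.nb_threes_le hxW h5.1 h5.2
      omega
    · omega

/-- Each vertex of `threes` contributes `7 - 6 = 1` to the potential. Three times this is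
distributed over its three edges, all leading out of `threes`, so the total is `3 * (-1)`. -/
lemma MinCounterexample.sum_charge (h : MinCounterexample 1 m i a W)
    (hpot : pot 1 m i a W = -1) :
    ∑ x ∈ W \ threes m i W,
      ((21 : ℤ) - 6 * i x - 6 * nb m x W + nb m x (threes m i W)) = -3 := by
  have hm := h.mult
  have hAW := threes_subset (m := m) (i := i) (W := W)
  have h1 := pot_eq_sum (D := 1) (i := i) (a := a) m W
  rw [hpot, ← Finset.sum_sdiff hAW] at h1
  have h2 : ∑ v ∈ threes m i W, (wt 1 i a v - ((1 : ℕ) + 1) * nb m v W)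
      = (threes m i W).card := by
    have : ∀ v ∈ threes m i W, wt 1 i a v - ((1 : ℕ) + 1) * nb m v W = 1 := by
      intro v hv
      obtain ⟨hvW, hi, h3⟩ := mem_threes.1 hv
      rw [h.wt_eq hvW, hi, h3]
      norm_num
    rw [Finset.sum_congr rfl this]
    simp
  have h3 : ∑ v ∈ W \ threes m i W, (wt 1 i a v - ((1 : ℕ) + 1) * nb m v W)
      = ∑ v ∈ W \ threes m i W, ((7 : ℤ) - 2 * i v - 2 * nb m v W) := by
    refine Finset.sum_congr rfl fun v hv => ?_
    rw [h.wt_eq (Finset.mem_sdiff.1 hv).1]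
    push_cast
    ring
  have h4 : cross m (threes m i W) (W \ threes m i W) = 3 * (threes m i W).card := by
    have : ∀ v ∈ threes m i W, nb m v (W \ threes m i W) = 3 := by
      intro v hv
      have h5 := nb_sdiff (m := m) (u := v) hAW
      have h6 := cross_eq_zero.1 (h.cross_threes (J := threes m i W) subset_rfl) v hv
      have := (mem_threes.1 hv).2.2
      omega
    rw [cross, Finset.sum_congr rfl this]
    simp [mul_comm]
  have h5 : ∑ v ∈ W \ threes m i W, (nb m v (threes m i W) : ℤ)
      = 3 * (threes m i W).card := by
    rw [← cast_cross, cross_comm hm, h4]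
    push_cast
    ring
  have h6 : ∑ x ∈ W \ threes m i W,
      ((21 : ℤ) - 6 * i x - 6 * nb m x W + nb m x (threes m i W))
      = 3 * ∑ v ∈ W \ threes m i W, ((7 : ℤ) - 2 * i v - 2 * nb m v W)
        + ∑ v ∈ W \ threes m i W, (nb m v (threes m i W) : ℤ) := by
    rw [Finset.mul_sum, ← Finset.sum_add_distrib]
    exact Finset.sum_congr rfl fun v _ => by ring
  rw [h6, h5]
  rw [h2, h3] at h1
  linarith

/-- No charge is positive and the total is `-3`, so no vertex can have charge `-4` or less. -/
lemma MinCounterexample.outside_threes (h : MinCounterexample 1 m i a W)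
    (hpot : pot 1 m i a W = -1) (hx : x ∈ W \ threes m i W) :
    nb m x (W \ threes m i W) + i x + nb m x (threes m i W) = 4 ∧ i x ≤ 1 ∧
      nb m x (threes m i W) ≤ 3 := by
  have h1 := h.sum_charge hpot
  have h2 := (h.charge_le hx).2
  have h3 : ∑ x ∈ W \ threes m i W,
      ((21 : ℤ) - 6 * i x - 6 * nb m x W + nb m x (threes m i W))
      ≤ (21 : ℤ) - 6 * i x - 6 * nb m x W + nb m x (threes m i W) := by
    rw [← Finset.add_sum_erase _ _ hx]
    have : ∑ x ∈ (W \ threes m i W).erase x,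
      ((21 : ℤ) - 6 * i x - 6 * nb m x W + nb m x (threes m i W)) ≤ 0 :=
      Finset.sum_nonpos fun y hy => (h.charge_le (Finset.mem_of_mem_erase hy)).1
    linarith
  have h4 := nb_sdiff (m := m) (u := x) (threes_subset (m := m) (i := i) (W := W))
  rcases h2 with h2 | h2
  · omega
  · omega

/-- When `i x + deg x = 4`, the charge is the number of neighbours in `threes` minus three. -/
lemma MinCounterexample.sum_deficit (h : MinCounterexample 1 m i a W)
    (hpot : pot 1 m i a W = -1) :
    ∑ x ∈ W \ threes m i W, (3 - nb m x (threes m i W)) = 3 := by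
  have h1 := h.sum_charge hpot
  have h2 : ∑ x ∈ W \ threes m i W,
      ((21 : ℤ) - 6 * i x - 6 * nb m x W + nb m x (threes m i W))
      = - ∑ x ∈ W \ threes m i W, ((3 - nb m x (threes m i W) : ℕ) : ℤ) := by
    rw [← Finset.sum_neg_distrib]
    refine Finset.sum_congr rfl fun x hx => ?_
    have h3 := h.outside_threes hpot hx
    have h4 := nb_sdiff (m := m) (u := x) (threes_subset (m := m) (i := i) (W := W))
    omega
  rw [h2] at h1
  have h5 : (∑ x ∈ W \ threes m i W, ((3 - nb m x (threes m i W) : ℕ) : ℤ)) = 3 := by linarith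
  exact_mod_cast h5

/-- The number of vertices of `threes` whose neighbours in `X` are exactly `y` and `z`. -/
def shared (m : V → V → ℕ) (i : V → ℕ) (W X : Finset V) (y z : V) : ℕ :=
  ∑ v ∈ (threes m i W).filter (fun v => nb m v X = 2), m v y * m v z

/-- The multigraph on `X` in which paths through `threes` are replaced by edges. -/
def reduced (m : V → V → ℕ) (i : V → ℕ) (W X : Finset V) (y z : V) : ℕ :=
  if y = z then 0 else m y z + shared m i W X y z

lemma isMult_reduced (hm : IsMult m) : IsMult (reduced m i W X) where
  symm y z := by
    unfold reduced shared
    rw [hm.symm y z]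
    simp only [eq_comm (a := y) (b := z), mul_comm]
  self y := by simp [reduced]

/-- Vertices of `threes` with at most one neighbour in `X` are leaves or isolated, and those with
two subdivide edges of the reduced multigraph. The proof counts edges: such a vertex with `t`
neighbours in a subset adds `t * t - t` to the reduced `cross`. -/
lemma MinCounterexample.forest_of_reduced (h : MinCounterexample 1 m i a W)
    (hX : X ⊆ W \ threes m i W) (hf : Forest (reduced m i W X) X) :
    Forest m (X ∪ (threes m i W).filter fun v => nb m v X ≤ 2) := by
  have hm := h.mult
  set A := threes m i W with hA
  set A2 := A.filter fun v => nb m v X ≤ 2 with hA2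
  set A3 := A.filter fun v => nb m v X = 2 with hA3
  have hd : Disjoint X A2 := Finset.disjoint_left.2 fun y hy hy2 =>
    (Finset.mem_sdiff.1 (hX hy)).2 (Finset.mem_filter.1 hy2).1
  intro Z hZ hne
  obtain ⟨h1, h2⟩ := cross_split hm hZ hd
  have hZ2A : Z ∩ A2 ⊆ A := Finset.inter_subset_right.trans (Finset.filter_subset _ _)
  rw [h.cross_threes hZ2A] at h1
  rcases (Z ∩ X).eq_empty_or_nonempty with h3 | h3
  · have := hne.card_pos
    rw [h3, cross_empty_left, cross_empty_left] at h1
    omega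
  · set P := Z ∩ X with hP
    set Q := Z ∩ A2 with hQ
    have hPX : P ⊆ X := Finset.inter_subset_right
    have h4 := hf P hPX h3
    have h01 : ∀ v ∈ A, ∀ y ∈ P, m v y * m v y = m v y := by
      intro v hv y hy
      by_cases h5 : 1 ≤ m v y
      · have := (h.neighbor_three hv (Finset.mem_sdiff.1 (hX (hPX hy))).1 h5).1
        rw [this]
      · have : m v y = 0 := by omega
        rw [this]
    -- the reduced graph counts pairs of neighbours of each vertex of degree two
    have h5 : cross (reduced m i W X) P P + ∑ v ∈ A3, nb m v P
        = cross m P P + ∑ v ∈ A3, nb m v P * nb m v P := by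
      have e1 : ∀ y ∈ P, ∀ z ∈ P, reduced m i W X y z + (if y = z then ∑ v ∈ A3, m v y else 0)
          = m y z + ∑ v ∈ A3, m v y * m v z := by
        intro y hy z _
        unfold reduced shared
        by_cases hyz : y = z
        · subst hyz
          rw [if_pos rfl, if_pos rfl, hm.self, zero_add, zero_add]
          exact Finset.sum_congr rfl fun v hv => (h01 v (Finset.mem_filter.1 hv).1 y hy).symm
        · simp [hyz, hA3, hA]
      have e2 := Finset.sum_congr rfl fun y hy => Finset.sum_congr rfl (e1 y hy)
      simp only [Finset.sum_add_distrib, Finset.sum_ite_eq] at e2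
      have e3 : ∑ y ∈ P, (if y ∈ P then ∑ v ∈ A3, m v y else 0) = ∑ v ∈ A3, nb m v P := by
        unfold nb
        rw [Finset.sum_comm (s := A3)]
        exact Finset.sum_congr rfl fun y hy => by rw [if_pos hy]
      have e4 : ∑ y ∈ P, ∑ z ∈ P, ∑ v ∈ A3, m v y * m v z
          = ∑ v ∈ A3, nb m v P * nb m v P := by
        unfold nb
        rw [Finset.sum_congr rfl fun y _ => Finset.sum_comm, Finset.sum_comm]
        exact Finset.sum_congr rfl fun v _ => (Finset.sum_mul_sum _ _ _ _).symm
      rw [e3, e4] at e2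
      exact e2
    have h6 : 2 * ∑ v ∈ Q, nb m v P + ∑ v ∈ A3, nb m v P
        ≤ 2 * Q.card + ∑ v ∈ A3, nb m v P * nb m v P := by
      have e1 : ∀ v ∈ A3, nb m v P ≤ nb m v P * nb m v P := fun v _ => Nat.le_mul_self _
      have e2 : ∑ v ∈ Q \ A3, nb m v P ≤ (Q \ A3).card := by
        rw [Finset.card_eq_sum_ones]
        refine Finset.sum_le_sum fun v hv => ?_
        obtain ⟨h7, h8⟩ := Finset.mem_sdiff.1 hv
        have h9 := (Finset.mem_filter.1 (Finset.mem_inter.1 h7).2)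
        have : nb m v X ≠ 2 := fun hc => h8 (Finset.mem_filter.2 ⟨h9.1, hc⟩)
        have := nb_mono (m := m) (u := v) hPX
        omega
      have e3 : ∑ v ∈ Q ∩ A3, (2 * nb m v P + nb m v P)
          ≤ ∑ v ∈ Q ∩ A3, (2 + nb m v P * nb m v P) := by
        refine Finset.sum_le_sum fun v hv => ?_
        have h9 := (Finset.mem_filter.1 (Finset.mem_inter.1 hv).2).2
        have := nb_mono (m := m) (u := v) hPX
        have : nb m v P = 0 ∨ nb m v P = 1 ∨ nb m v P = 2 := by omega
        -- This is `3t ≤ 2 + t * t` for `t = 0, 1, 2`, with equality at `1` and `2`.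
        rcases this with h | h | h <;> simp [h]
      have e4 : ∑ v ∈ A3 \ Q, nb m v P ≤ ∑ v ∈ A3 \ Q, nb m v P * nb m v P :=
        Finset.sum_le_sum fun v hv => e1 v (Finset.mem_sdiff.1 hv).1
      have e5 := Finset.sum_inter_add_sum_sdiff Q A3 (fun v => nb m v P)
      have e6 := Finset.sum_inter_add_sum_sdiff A3 Q (fun v => nb m v P)
      have e7 := Finset.sum_inter_add_sum_sdiff A3 Q (fun v => nb m v P * nb m v P)
      have e8 := Finset.card_inter_add_card_sdiff Q A3
      rw [Finset.inter_comm A3 Q] at e6 e7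
      simp only [Finset.sum_add_distrib, Finset.sum_const, smul_eq_mul, ← Finset.mul_sum] at e3
      omega
    have h7 : cross m P Q = ∑ v ∈ Q, nb m v P := cross_comm hm
    omega

/-- If the vertices outside `threes` that keep too many neighbours can be covered by a set `X`
which is a forest in the reduced multigraph, the instance is colourable. -/
theorem MinCounterexample.false_of_cover (h : MinCounterexample 1 m i a W)
    (hpot : pot 1 m i a W = -1) (hX : X ⊆ W \ threes m i W)
    (hcov : ∀ y ∈ W \ threes m i W, y ∉ X → 3 ≤ nb m y (threes m i W) + nb m y X)
    (hf : Forest (reduced m i W X) X) : False := by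
  have hm := h.mult
  have hF := h.forest_of_reduced hX hf
  set A := threes m i W with hA
  set A2 := A.filter fun v => nb m v X ≤ 2 with hA2
  set A' := A.filter fun v => ¬ nb m v X ≤ 2 with hA'
  set B := W \ A with hB
  have hAW : A ⊆ W := threes_subset
  have hXW : X ⊆ W := hX.trans Finset.sdiff_subset
  have hdBA : Disjoint (B \ X) A' := by
    refine Finset.disjoint_left.2 fun y hy hy2 => ?_
    exact (Finset.mem_sdiff.1 (Finset.mem_sdiff.1 hy).1).2 (Finset.mem_filter.1 hy2).1
  have hfull : ∀ v ∈ A', nb m v (B \ X) = 0 := by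
    intro v hv
    obtain ⟨h1, h2⟩ := Finset.mem_filter.1 hv
    have h3 := (mem_threes.1 h1).2.2
    have h4 : nb m v X + nb m v (B \ X) ≤ nb m v W := by
      rw [← nb_union Finset.disjoint_sdiff]
      exact nb_mono (Finset.union_subset hXW (Finset.sdiff_subset.trans Finset.sdiff_subset))
    omega
  have hdeg : ∀ v ∈ (B \ X) ∪ A', nb m v ((B \ X) ∪ A') + i v ≤ 1 := by
    intro y hy
    rw [nb_union hdBA]
    rcases Finset.mem_union.1 hy with hy | hy
    · obtain ⟨h1, h2⟩ := Finset.mem_sdiff.1 hy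
      have h3 : nb m y A' = 0 := nb_eq_zero.2 fun v hv => by
        rw [hm.symm]
        exact nb_eq_zero.1 (hfull v hv) y hy
      have h4 := nb_sdiff (m := m) (u := y) hX
      have h5 := h.outside_threes hpot h1
      have h6 := hcov y h1 h2
      rw [← hA, ← hB] at h5
      omega
    · have h1 := hfull y hy
      have h2 : nb m y A' = 0 := nb_eq_zero.2 fun v hv =>
        h.threes_indep (Finset.mem_filter.1 hy).1 (Finset.mem_filter.1 hv).1
      have h3 := (mem_threes.1 (Finset.mem_filter.1 hy).1).2.1
      omega
  -- Vertices of `A'` have all three neighbours in `X` and are isolated in the first class. A vertex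
  -- `y` of `B \ X` has `4 - i y` edges in total, of which at least three lead to `A` or `X`; hence
  -- its degree plus `i y` is at most one there.
  refine h.not_colorable ⟨(B \ X) ∪ A', X ∪ A2, ?_, ?_, ⟨?_, hF, hdeg, ?_⟩⟩
  · rw [Finset.disjoint_union_left, Finset.disjoint_union_right, Finset.disjoint_union_right]
    refine ⟨⟨Finset.sdiff_disjoint, ?_⟩, ?_, (Finset.disjoint_filter_filter_not A A _).symm⟩
    · refine Finset.disjoint_left.2 fun y hy hy2 => ?_
      exact (Finset.mem_sdiff.1 (Finset.mem_sdiff.1 hy).1).2 (Finset.mem_filter.1 hy2).1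
    · refine Finset.disjoint_right.2 fun y hy hy2 => ?_
      exact (Finset.mem_sdiff.1 (hX hy)).2 (Finset.mem_filter.1 hy2).1
  · have e1 : A2 ∪ A' = A := Finset.filter_union_filter_not_eq _ A
    rw [Finset.union_union_union_comm, Finset.sdiff_union_of_subset hX, Finset.union_comm A' A2,
      e1, hB, Finset.sdiff_union_of_subset hAW]
  · refine forest_of_nb_le_one hm fun v hv => ?_
    have := hdeg v hv
    omega
  · intro v hv
    refine h.a_eq_zero ?_
    rcases Finset.mem_union.1 hv with hv | hv
    · exact hXW hv
    · exact hAW (Finset.mem_filter.1 hv).1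

end final

/-! ### Small covers, and three deficient vertices with an adjacent pair. -/

section cases

variable {m : V → V → ℕ} {i a : V → ℕ} {W X : Finset V} {n p q r s t u u' v w x y z : V}

lemma MinCounterexample.mult_le_one (h : MinCounterexample 1 m i a W) (hv : v ∈ threes m i W)
    (hy : y ∈ W) : m v y ≤ 1 := by
  by_contra hc
  have := (h.neighbor_three hv hy (by omega)).1
  omega

lemma MinCounterexample.exists_of_two_le (h : MinCounterexample 1 m i a W) {T : Finset V}
    (hT : T ⊆ threes m i W) (hy : y ∈ W) (h2 : 2 ≤ nb m y T) :
    ∃ u ∈ T, ∃ u' ∈ T, u ≠ u' ∧ m u y = 1 ∧ m u' y = 1 := by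
  have hm := h.mult
  obtain ⟨u, hu, h1⟩ := exists_of_nb_pos (m := m) (u := y) (X := T) (by omega)
  have h3 := h.mult_le_one (hT hu) hy
  rw [hm.symm] at h1
  have h4 := nb_erase (m := m) (u := y) hu
  rw [hm.symm y u] at h4
  obtain ⟨u', hu', h5⟩ := exists_of_nb_pos (m := m) (u := y) (X := T.erase u) (by omega)
  obtain ⟨h6, h7⟩ := Finset.mem_erase.1 hu'
  have h8 := h.mult_le_one (hT h7) hy
  rw [hm.symm] at h5
  exact ⟨u, hu, u', h7, h6.symm, by omega, by omega⟩

lemma MinCounterexample.eq_or_eq_of_adj (h : MinCounterexample 1 m i a W)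
    (hy : nb m y (threes m i W) ≤ 2)
    (hu : u ∈ threes m i W) (hu' : u' ∈ threes m i W) (hv : v ∈ threes m i W) (huu : u ≠ u')
    (h1 : m u y = 1) (h2 : m u' y = 1) (h3 : m v y = 1) : v = u ∨ v = u' := by
  by_contra! hc
  have hsub : ({v, u, u'} : Finset V) ⊆ threes m i W := by
    intro z hz
    simp only [Finset.mem_insert, Finset.mem_singleton] at hz
    rcases hz with rfl | rfl | rfl <;> assumption
  have h4 := nb_mono (m := m) (u := y) hsub
  rw [nb_insert (by simp [hc]), nb_insert (by simp [huu]), nb_singleton,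
    h.mult.symm y, h.mult.symm y, h.mult.symm y] at h4
  omega

lemma not_four_adj (hv : nb m v X ≤ 3) (hp : p ∈ X) (hq : q ∈ X) (hr : r ∈ X) (hs : s ∈ X)
    (hpq : p ≠ q) (hpr : p ≠ r) (hps : p ≠ s) (hqr : q ≠ r) (hqs : q ≠ s) (hrs : r ≠ s)
    (h1 : m v p = 1) (h2 : m v q = 1) (h3 : m v r = 1) (h4 : m v s = 1) : False := by
  have hsub : ({p, q, r, s} : Finset V) ⊆ X := by
    intro z hz
    simp only [Finset.mem_insert, Finset.mem_singleton] at hz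
    rcases hz with rfl | rfl | rfl | rfl <;> assumption
  have h5 := nb_mono (m := m) (u := v) hsub
  rw [nb_insert (by simp [*]), nb_insert (by simp [*]), nb_insert (by simp [*]),
    nb_singleton] at h5
  omega

lemma not_three_adj (hv : nb m v X ≤ 2) (hp : p ∈ X) (hq : q ∈ X) (hr : r ∈ X)
    (hpq : p ≠ q) (hpr : p ≠ r) (hqr : q ≠ r)
    (h1 : m v p = 1) (h2 : m v q = 1) (h3 : m v r = 1) : False := by
  have hsub : ({p, q, r} : Finset V) ⊆ X := by
    intro z hz
    simp only [Finset.mem_insert, Finset.mem_singleton] at hz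
    rcases hz with rfl | rfl | rfl <;> assumption
  have h5 := nb_mono (m := m) (u := v) hsub
  rw [nb_insert (by simp [*]), nb_insert (by simp [*]), nb_singleton] at h5
  omega

lemma exists_of_shared_pos (hs : 1 ≤ shared m i W X y z) :
    ∃ u ∈ threes m i W, nb m u X = 2 ∧ 1 ≤ m u y ∧ 1 ≤ m u z := by
  obtain ⟨u, hu, h1⟩ := Finset.exists_ne_zero_of_sum_ne_zero (Nat.one_le_iff_ne_zero.1 hs)
  obtain ⟨h2, h3⟩ := Finset.mem_filter.1 hu
  refine ⟨u, h2, h3, ?_, ?_⟩ <;> by_contra hc <;> simp_all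

lemma MinCounterexample.exists_of_one_le_shared (h : MinCounterexample 1 m i a W) (hy : y ∈ W)
    (hz : z ∈ W) (hs : 1 ≤ shared m i W X y z) :
    ∃ u ∈ threes m i W, nb m u X = 2 ∧ m u y = 1 ∧ m u z = 1 := by
  obtain ⟨u, hu, h1, h2, h3⟩ := exists_of_shared_pos hs
  have := h.mult_le_one hu hy
  have := h.mult_le_one hu hz
  exact ⟨u, hu, h1, by omega, by omega⟩

lemma MinCounterexample.exists_of_two_le_shared (h : MinCounterexample 1 m i a W) (hy : y ∈ W)
    (hz : z ∈ W) (hs : 2 ≤ shared m i W X y z) :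
    ∃ u ∈ threes m i W, ∃ u' ∈ threes m i W, u ≠ u' ∧ nb m u X = 2 ∧ nb m u' X = 2 ∧
      m u y = 1 ∧ m u z = 1 ∧ m u' y = 1 ∧ m u' z = 1 := by
  have h1 : shared m i W X y z ≤ ((threes m i W).filter fun v =>
      nb m v X = 2 ∧ m v y = 1 ∧ m v z = 1).card := by
    unfold shared
    rw [← Finset.filter_filter, Finset.card_filter]
    refine Finset.sum_le_sum fun v hv => ?_
    have hv := (Finset.mem_filter.1 hv).1
    have h2 : m v y = 0 ∨ m v y = 1 := by have := h.mult_le_one hv hy; omega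
    have h3 : m v z = 0 ∨ m v z = 1 := by have := h.mult_le_one hv hz; omega
    rcases h2 with h2 | h2 <;> rcases h3 with h3 | h3 <;> simp [h2, h3]
  obtain ⟨u, hu, u', hu', hne⟩ := Finset.one_lt_card.1 (lt_of_lt_of_le (by omega) h1)
  simp only [Finset.mem_filter] at hu hu'
  exact ⟨u, hu.1, u', hu'.1, hne, hu.2.1, hu'.2.1, hu.2.2.1, hu.2.2.2, hu'.2.2.1, hu'.2.2.2⟩

lemma reduced_of_ne (h : y ≠ z) : reduced m i W X y z = m y z + shared m i W X y z := by
  simp [reduced, h]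

lemma MinCounterexample.false_of_cover_one (h : MinCounterexample 1 m i a W)
    (hpot : pot 1 m i a W = -1) (hs : s ∈ W \ threes m i W)
    (hcov : ∀ y ∈ W \ threes m i W, y ≠ s → 3 ≤ nb m y (threes m i W) + m y s) : False := by
  refine h.false_of_cover hpot (X := {s}) (by simpa using Finset.mem_sdiff.1 hs) ?_
    (forest_singleton (isMult_reduced h.mult))
  intro y hy hys
  rw [nb_singleton]
  exact hcov y hy (by simpa using hys)

lemma MinCounterexample.false_of_cover_two (h : MinCounterexample 1 m i a W)
    (hpot : pot 1 m i a W = -1) (hs : s ∈ W \ threes m i W) (ht : t ∈ W \ threes m i W)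
    (hst : s ≠ t) (hr : m s t + shared m i W {s, t} s t ≤ 1)
    (hcov : ∀ y ∈ W \ threes m i W, y ≠ s → y ≠ t →
      3 ≤ nb m y (threes m i W) + (m y s + m y t)) : False := by
  have hm := isMult_reduced (i := i) (W := W) (X := {s, t}) h.mult
  refine h.false_of_cover hpot (X := {s, t}) ?_ ?_ ?_
  · intro z hz
    simp only [Finset.mem_insert, Finset.mem_singleton] at hz
    rcases hz with rfl | rfl <;> assumption
  · intro y hy hy2
    simp only [Finset.mem_insert, Finset.mem_singleton, not_or] at hy2
    rw [nb_insert (by simpa using hst), nb_singleton]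
    exact hcov y hy hy2.1 hy2.2
  · refine Forest.insert_leaf hm (forest_singleton hm) ?_
    rwa [nb_singleton, reduced_of_ne hst]

/-- Three vertices with simple edges, not all three present, form a forest. -/
lemma MinCounterexample.false_of_cover_three (h : MinCounterexample 1 m i a W)
    (hpot : pot 1 m i a W = -1) (hs : s ∈ W \ threes m i W) (ht : t ∈ W \ threes m i W)
    (hr : r ∈ W \ threes m i W)
    (hst : s ≠ t) (hsr : s ≠ r) (htr : t ≠ r)
    (h1 : m s t + shared m i W {s, t, r} s t ≤ 1)
    (h2 : m s r + shared m i W {s, t, r} s r ≤ 1)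
    (h3 : m t r + shared m i W {s, t, r} t r ≤ 1)
    (h4 : m s t + shared m i W {s, t, r} s t = 0 ∨ m s r + shared m i W {s, t, r} s r = 0 ∨
      m t r + shared m i W {s, t, r} t r = 0)
    (hcov : ∀ y ∈ W \ threes m i W, y ≠ s → y ≠ t → y ≠ r →
      3 ≤ nb m y (threes m i W) + (m y s + (m y t + m y r))) : False := by
  have hm := isMult_reduced (i := i) (W := W) (X := {s, t, r}) h.mult
  refine h.false_of_cover hpot (X := {s, t, r}) ?_ ?_ ?_
  · intro z hz
    simp only [Finset.mem_insert, Finset.mem_singleton] at hz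
    rcases hz with rfl | rfl | rfl <;> assumption
  · intro y hy hy2
    simp only [Finset.mem_insert, Finset.mem_singleton, not_or] at hy2
    rw [nb_insert (by simp [*]), nb_insert (by simp [*]), nb_singleton]
    exact hcov y hy hy2.1 hy2.2.1 hy2.2.2
  · set R := reduced m i W {s, t, r} with hR
    have e1 : R s t = m s t + shared m i W {s, t, r} s t := reduced_of_ne hst
    have e2 : R s r = m s r + shared m i W {s, t, r} s r := reduced_of_ne hsr
    have e3 : R t r = m t r + shared m i W {s, t, r} t r := reduced_of_ne htr
    have f1 := hm.symm s t
    have f2 := hm.symm s r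
    have f3 := hm.symm t r
    rw [← e1] at h1 h4
    rw [← e2] at h2 h4
    rw [← e3] at h3 h4
    have key : ∀ {x y z : V}, y ≠ z → R y z ≤ 1 → R x y + R x z ≤ 1 → Forest R {x, y, z} := by
      intro x y z hyz hle hle2
      refine Forest.insert_leaf hm (Forest.insert_leaf hm (forest_singleton hm) ?_) ?_
      · simpa using hle
      · rwa [nb_insert (by simpa using hyz), nb_singleton]
    rcases h4 with h4 | h4 | h4
    · exact key htr h3 (by omega)
    · exact key htr h3 (by omega)
    · have : ({s, t, r} : Finset V) = {t, s, r} := Finset.insert_comm s t {r}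
      have hf := key (x := t) hsr h2 (by omega)
      rwa [← this] at hf

/-- Exactly the three vertices `s`, `t`, `r` outside `threes` have fewer than three neighbours
in `threes`. -/
structure DeficientTriple (m : V → V → ℕ) (i : V → ℕ) (W : Finset V) (s t r : V) : Prop where
  hs : s ∈ W \ threes m i W
  ht : t ∈ W \ threes m i W
  hr : r ∈ W \ threes m i W
  st : s ≠ t
  sr : s ≠ r
  tr : t ≠ r
  cs : nb m s (threes m i W) = 2
  ct : nb m t (threes m i W) = 2
  cr : nb m r (threes m i W) = 2
  full : ∀ y ∈ W \ threes m i W, y ≠ s → y ≠ t → y ≠ r → nb m y (threes m i W) = 3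

lemma DeficientTriple.swap (d : DeficientTriple m i W s t r) : DeficientTriple m i W t s r :=
  ⟨d.ht, d.hs, d.hr, d.st.symm, d.tr, d.sr, d.ct, d.cs, d.cr,
    fun y hy h1 h2 h3 => d.full y hy h2 h1 h3⟩

lemma DeficientTriple.rotate (d : DeficientTriple m i W s t r) : DeficientTriple m i W t r s :=
  ⟨d.ht, d.hr, d.hs, d.tr, d.st.symm, d.sr.symm, d.ct, d.cr, d.cs,
    fun y hy h1 h2 h3 => d.full y hy h3 h1 h2⟩

/-- Two adjacent pairs. -/
lemma MinCounterexample.false_of_two_adj (h : MinCounterexample 1 m i a W)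
    (hpot : pot 1 m i a W = -1) (d : DeficientTriple m i W s t r) (h1 : 1 ≤ m s t)
    (h2 : 1 ≤ m s r) : False := by
  -- The set `{s}` suffices: its edges to `t` and `r` make up for their deficits of one.
  refine h.false_of_cover_one hpot d.hs fun y hy hys => ?_
  rw [h.mult.symm y s]
  by_cases hyt : y = t
  · subst hyt; have := d.ct; omega
  by_cases hyr : y = r
  · subst hyr; have := d.cr; omega
  have := d.full y hy hys hyt hyr
  omega

/-- One adjacent pair. -/
lemma MinCounterexample.false_of_one_adj (h : MinCounterexample 1 m i a W)
    (hpot : pot 1 m i a W = -1) (d : DeficientTriple m i W s t r) (h1 : 1 ≤ m s t)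
    (h2 : m s r = 0) (h3 : m t r = 0) : False := by
  have hm := h.mult
  have hsW := (Finset.mem_sdiff.1 d.hs).1
  have htW := (Finset.mem_sdiff.1 d.ht).1
  have hrW := (Finset.mem_sdiff.1 d.hr).1
  -- The set `{s, r}` covers `t` through the edge `st`, so it can only fail because `s` and `r` have
  -- two common neighbours in `threes`. As `r` has just two, `s`, `t` and `r` all share the same
  -- pair.
  have key : ∀ {s t : V}, DeficientTriple m i W s t r → 1 ≤ m s t → m s r = 0 →
      2 ≤ shared m i W {s, r} s r := by
    intro s t d h1 h2
    by_contra hc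
    refine h.false_of_cover_two hpot d.hs d.hr d.sr (by omega) fun y hy hys hyr => ?_
    by_cases hyt : y = t
    · subst hyt; have := d.ct; rw [hm.symm y s]; omega
    have := d.full y hy hys hyt hyr
    omega
  obtain ⟨u, hu, u', hu', huu, -, -, h4, h5, h6, h7⟩ :=
    h.exists_of_two_le_shared hsW hrW (key d h1 h2)
  obtain ⟨w, hw, w', hw', hww, -, -, g4, g5, g6, g7⟩ :=
    h.exists_of_two_le_shared htW hrW (key d.swap (by rwa [hm.symm]) h3)
  have e1 := h.eq_or_eq_of_adj d.cr.le hw hw' hu hww g5 g7 h5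
  have e2 := h.eq_or_eq_of_adj d.cr.le hw hw' hu' hww g5 g7 h7
  have h8 : m u t = 1 := by rcases e1 with rfl | rfl <;> assumption
  have h9 : m u' t = 1 := by rcases e2 with rfl | rfl <;> assumption
  by_cases hst : m s t = 1
  -- The common neighbours `u`, `u'` have all their neighbours in `{s, t, r}` and create no reduced
  -- edge, so `st` is the only edge.
  · have hshared : ∀ {x y z : V}, x ∈ W → y ∈ W → ({x, y, z} : Finset V) = {s, t, r} →
        nb m x (threes m i W) = 2 → m u x = 1 → m u' x = 1 → x ≠ y → x ≠ z → y ≠ z →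
        m u z = 1 → m u' z = 1 → shared m i W {s, t, r} x y = 0 := by
      intro x y z hx hy he hcx hux hux' hxy hxz hyz huz huz'
      by_contra hc
      obtain ⟨v, hv, b1, b2, b3⟩ := h.exists_of_one_le_shared hx hy (Nat.one_le_iff_ne_zero.2 hc)
      have b4 : m v z = 1 := by
        rcases h.eq_or_eq_of_adj hcx.le hu hu' hv huu hux hux' b2 with rfl | rfl <;> assumption
      rw [← he] at b1
      exact not_three_adj b1.le (by simp) (by simp) (by simp) hxy hxz hyz b2 b3 b4
    have c1 := hshared hsW htW rfl d.cs h4 h6 d.st d.sr d.tr h5 h7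
    have c2 := hshared hsW hrW (by rw [Finset.pair_comm]) d.cs h4 h6 d.sr d.st d.tr.symm h8 h9
    have c3 := hshared htW hrW (z := s)
      (by rw [Finset.pair_comm, Finset.insert_comm]) d.ct h8 h9 d.tr d.st.symm d.sr.symm h4 h6
    exact h.false_of_cover_three hpot d.hs d.ht d.hr d.st d.sr d.tr (by omega) (by omega)
      (by omega) (by omega) fun y hy b1 b2 b3 => by have := d.full y hy b1 b2 b3; omega
  · have hnot : ∀ {v y : V}, v ∈ threes m i W → y ∈ W \ threes m i W → v ≠ y := by
      rintro v y hv hy rfl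
      exact (Finset.mem_sdiff.1 hy).2 hv
    -- Five vertices span at least eight edges, so the potential is at most `35 - 32 = 3`. If `Z` is
    -- all of `W`, then `r` has no outside neighbour, which would require `i r = 2`.
    set Z : Finset V := {s, t, r, u, u'} with hZ
    have hZW : Z ⊆ W := by
      intro z hz
      simp only [hZ, Finset.mem_insert, Finset.mem_singleton] at hz
      rcases hz with rfl | rfl | rfl | rfl | rfl
      exacts [hsW, htW, hrW, threes_subset hu, threes_subset hu']
    have n1 := hnot hu d.hs
    have n2 := hnot hu d.ht
    have n3 := hnot hu d.hr
    have n4 := hnot hu' d.hs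
    have n5 := hnot hu' d.ht
    have n6 := hnot hu' d.hr
    have hcard : Z.card = 5 := by
      rw [hZ, Finset.card_insert_of_notMem, Finset.card_insert_of_notMem,
        Finset.card_insert_of_notMem, Finset.card_pair huu] <;>
        simp [d.st, d.sr, d.tr, n1.symm, n2.symm, n3.symm, n4.symm, n5.symm, n6.symm]
    have hp : pot 1 m i a Z ≤ 3 := by
      have w1 : ∀ v, wt 1 i a v ≤ 7 := by
        intro v; unfold wt; push_cast; omega
      have m1 : s ∉ ({t, r, u, u'} : Finset V) := by simp [d.st, d.sr, n1.symm, n4.symm]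
      have m2 : t ∉ ({r, u, u'} : Finset V) := by simp [d.tr, n2.symm, n5.symm]
      have m3 : r ∉ ({u, u'} : Finset V) := by simp [n3.symm, n6.symm]
      have m4 : u ∉ ({u'} : Finset V) := by simp [huu]
      rw [hZ, pot_insert hm m1, pot_insert hm m2, pot_insert hm m3, pot_insert hm m4,
        pot_singleton hm, nb_insert m2, nb_insert m3, nb_insert m4, nb_insert m3, nb_insert m4,
        nb_insert m4]
      simp only [nb_singleton]
      rw [hm.symm s u, hm.symm s u', hm.symm t u, hm.symm t u', hm.symm r u, hm.symm r u']
      have := w1 s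
      have := w1 t
      have := w1 r
      have := w1 u
      have := w1 u'
      push_cast
      omega
    by_cases hWZ : Z = W
    · have hr0 : nb m r (W \ threes m i W) = 0 := by
        refine nb_eq_zero.2 fun y hy => ?_
        obtain ⟨b1, b2⟩ := Finset.mem_sdiff.1 hy
        rw [← hWZ, hZ] at b1
        simp only [Finset.mem_insert, Finset.mem_singleton] at b1
        rcases b1 with rfl | rfl | rfl | rfl | rfl
        · rw [hm.symm]; exact h2
        · rw [hm.symm]; exact h3
        · exact hm.self _
        · exact absurd hu b2
        · exact absurd hu' b2
      have := h.outside_threes hpot d.hr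
      have := d.cr
      omega
    · have := h.gap_two (Finset.ssubset_iff_subset_ne.2 ⟨hZW, hWZ⟩) (by omega)
      omega

/-- The remaining neighbour outside `threes` of a deficient vertex. -/
lemma MinCounterexample.exists_outside_neighbor (h : MinCounterexample 1 m i a W)
    (hpot : pot 1 m i a W = -1) (d : DeficientTriple m i W s t r)
    (h1 : m s t = 0) (h2 : m s r = 0) :
    ∃ n ∈ W \ threes m i W, n ≠ s ∧ n ≠ t ∧ n ≠ r ∧ m n s = 1 ∧
      ∀ y ∈ W \ threes m i W, y ≠ s → m n y = 0 := by
  have hm := h.mult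
  have h3 := h.outside_threes hpot d.hs
  have h4 := d.cs
  obtain ⟨n, hn, hsn⟩ := exists_of_nb_pos (m := m) (u := s) (X := W \ threes m i W) (by omega)
  have n1 : n ≠ s := by rintro rfl; rw [hm.self] at hsn; omega
  have n2 : n ≠ t := by rintro rfl; omega
  have n3 : n ≠ r := by rintro rfl; omega
  have h5 := h.outside_threes hpot hn
  have h6 := d.full n hn n1 n2 n3
  -- A vertex that is not deficient has at most one edge staying outside `threes`; for `n` this is
  -- the edge to `s`.
  have h7 := nb_erase (m := m) (u := n) d.hs
  rw [hm.symm] at hsn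
  refine ⟨n, hn, n1, n2, n3, by omega, fun y hy hys => ?_⟩
  exact nb_eq_zero.1 (by omega : nb m n ((W \ threes m i W).erase s) = 0) y
    (Finset.mem_erase.2 ⟨hys, hy⟩)

/-- Two deficient vertices `s`, `t` and the outside neighbour of `t` share two neighbours. -/
lemma MinCounterexample.false_of_shared_neighbor (h : MinCounterexample 1 m i a W)
    (hpot : pot 1 m i a W = -1) (d : DeficientTriple m i W s t r)
    (h1 : m s t = 0) (h2 : m s r = 0) (h3 : m t r = 0)
    (hu : u ∈ threes m i W) (hu' : u' ∈ threes m i W) (huu : u ≠ u')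
    (us : m u s = 1) (ut : m u t = 1) (us' : m u' s = 1) (ut' : m u' t = 1)
    (hn : n ∈ W \ threes m i W) (ns : n ≠ s) (nt : n ≠ t) (nr : n ≠ r) (hnt : m n t = 1)
    (hn0 : ∀ y ∈ W \ threes m i W, y ≠ t → m n y = 0) (un : m u n = 1) (un' : m u' n = 1) :
    False := by
  have hm := h.mult
  have hsW := (Finset.mem_sdiff.1 d.hs).1
  have htW := (Finset.mem_sdiff.1 d.ht).1
  have hrW := (Finset.mem_sdiff.1 d.hr).1
  have hnW := (Finset.mem_sdiff.1 hn).1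
  have four : ∀ {v}, v ∈ threes m i W → m v s = 1 → m v t = 1 → m v n = 1 → m v r = 1 →
      False := fun hv b1 b2 b3 b4 =>
    not_four_adj (mem_threes.1 hv).2.2.le hsW htW hnW hrW d.st ns.symm d.sr nt.symm d.tr nr
      b1 b2 b3 b4
  set X : Finset V := {s, r, n, t} with hX
  have cs : ∀ v ∈ threes m i W, m v s = 1 → v = u ∨ v = u' := fun v hv b =>
    h.eq_or_eq_of_adj d.cs.le hu hu' hv huu us us' b
  have ct : ∀ v ∈ threes m i W, m v t = 1 → v = u ∨ v = u' := fun v hv b =>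
    h.eq_or_eq_of_adj d.ct.le hu hu' hv huu ut ut' b
  have hX2 : ∀ v, v = u ∨ v = u' → nb m v X ≠ 2 := by
    intro v hv hc
    have : m v s = 1 ∧ m v t = 1 ∧ m v n = 1 := by
      rcases hv with rfl | rfl
      exacts [⟨us, ut, un⟩, ⟨us', ut', un'⟩]
    exact not_three_adj hc.le (by simp [hX]) (by simp [hX]) (by simp [hX]) d.st ns.symm nt.symm
      this.1 this.2.1 this.2.2
  have zs : ∀ y ∈ W, shared m i W X s y = 0 := by
    intro y hy
    by_contra hc
    obtain ⟨v, hv, b1, b2, b3⟩ := h.exists_of_one_le_shared hsW hy (Nat.one_le_iff_ne_zero.2 hc)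
    exact hX2 v (cs v hv b2) b1
  have zt : ∀ y ∈ W, shared m i W X y t = 0 := by
    intro y hy
    by_contra hc
    obtain ⟨v, hv, b1, b2, b3⟩ := h.exists_of_one_le_shared hy htW (Nat.one_le_iff_ne_zero.2 hc)
    exact hX2 v (ct v hv b3) b1
  -- Since `n` already has the neighbours `u` and `u'`, which are not adjacent to `r`, only one
  -- neighbour in `threes` is left to share with `r`.
  have zr : shared m i W X r n ≤ 1 := by
    by_contra hc
    obtain ⟨v, hv, v', hv', hvv, -, -, b3, b4, b5, b6⟩ :=
      h.exists_of_two_le_shared hrW hnW (Nat.lt_of_not_le hc)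
    have hsub : ({u, u', v, v'} : Finset V) ⊆ threes m i W := by
      intro z hz
      simp only [Finset.mem_insert, Finset.mem_singleton] at hz
      rcases hz with rfl | rfl | rfl | rfl <;> assumption
    have hne : ∀ {x y}, x ∈ threes m i W → m x s = 1 → m x t = 1 → m x n = 1 → m y r = 1 →
        x ≠ y := by
      rintro x y hx b1 b2 b3 b4 rfl
      exact four hx b1 b2 b3 b4
    have q := not_four_adj (m := m) (v := n) (X := threes m i W) (d.full n hn ns nt nr).le
      hu hu' hv hv' huu (hne hu us ut un b3) (hne hu us ut un b5) (hne hu' us' ut' un' b3)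
      (hne hu' us' ut' un' b5) hvv
    rw [hm.symm n, hm.symm n, hm.symm n, hm.symm n] at q
    exact q un un' b4 b6
  have hR := isMult_reduced (i := i) (W := W) (X := X) hm
  refine h.false_of_cover hpot (X := X) ?_ ?_ ?_
  · intro z hz
    simp only [hX, Finset.mem_insert, Finset.mem_singleton] at hz
    rcases hz with rfl | rfl | rfl | rfl
    exacts [d.hs, d.hr, hn, d.ht]
  · intro y hy hyX
    simp only [hX, Finset.mem_insert, Finset.mem_singleton, not_or] at hyX
    have := d.full y hy hyX.1 hyX.2.2.2 hyX.2.1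
    omega
  -- In the reduced multigraph `s` is isolated, because `u` and `u'` have three neighbours in `X`.
  -- What remains is the edge `nt` and at most one edge `rn`.
  · have key : Forest (reduced m i W X) (insert s (insert r (insert n {t}))) := by
      refine Forest.insert_leaf hR (Forest.insert_leaf hR (Forest.insert_leaf hR
        (forest_singleton hR) ?_) ?_) ?_
      · rw [nb_singleton, reduced_of_ne nt, zt n hnW, hnt]
      · rw [nb_insert (by simpa using nt), nb_singleton, reduced_of_ne nr.symm,
          reduced_of_ne d.tr.symm, zt r hrW, hm.symm r t, h3, hm.symm r n, hn0 r d.hr d.tr.symm]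
        omega
      · have e1 : r ∉ ({n, t} : Finset V) := by simp [nr.symm, d.tr.symm]
        have e2 : n ∉ ({t} : Finset V) := by simp [nt]
        rw [nb_insert e1, nb_insert e2, nb_singleton, reduced_of_ne d.sr, reduced_of_ne d.st,
          reduced_of_ne ns.symm, zs r hrW, zs n hnW, zs t htW, h1, h2, hm.symm s n,
          hn0 s d.hs d.st]
        omega
    exact key

/-- Covering a deficient triple by `s`, `r` and the outside neighbour of `t`. -/
lemma MinCounterexample.shared_of_triple (h : MinCounterexample 1 m i a W)
    (hpot : pot 1 m i a W = -1) (d : DeficientTriple m i W s t r) (h2 : m s r = 0)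
    (hn : n ∈ W \ threes m i W) (ns : n ≠ s) (nr : n ≠ r) (hnt : m n t = 1)
    (hn0 : ∀ y ∈ W \ threes m i W, y ≠ t → m n y = 0) :
    2 ≤ shared m i W {s, n, r} s n ∨ 2 ≤ shared m i W {s, n, r} s r ∨
      2 ≤ shared m i W {s, n, r} n r ∨ (1 ≤ shared m i W {s, n, r} s n ∧
        1 ≤ shared m i W {s, n, r} s r ∧ 1 ≤ shared m i W {s, n, r} n r) := by
  by_contra! hc
  have hm := h.mult
  have e1 : m s n = 0 := by rw [hm.symm]; exact hn0 s d.hs d.st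
  have e2 : m n r = 0 := hn0 r d.hr d.tr.symm
  refine h.false_of_cover_three hpot d.hs hn d.hr ns.symm d.sr nr (by omega) (by omega)
    (by omega) (by omega) fun y hy b1 b2 b3 => ?_
  -- The uncovered vertex `t` gets its missing neighbour from `n`.
  by_cases hyt : y = t
  · subst hyt
    rw [hm.symm y n]
    have := d.ct
    omega
  · have := d.full y hy b1 hyt b3
    omega

end cases

/-! ### Three pairwise nonadjacent deficient vertices, and the end of `D = 1`. -/

section independent

variable {m : V → V → ℕ} {i a : V → ℕ} {W X : Finset V} {n p q r s t u u' v w x y z : V}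

/-- Three pairwise nonadjacent deficient vertices, two of which share both their neighbours. -/
lemma MinCounterexample.false_of_shared_pair (h : MinCounterexample 1 m i a W)
    (hpot : pot 1 m i a W = -1) (d : DeficientTriple m i W s t r)
    (h1 : m s t = 0) (h2 : m s r = 0) (h3 : m t r = 0)
    (hu : u ∈ threes m i W) (hu' : u' ∈ threes m i W) (huu : u ≠ u')
    (us : m u s = 1) (ut : m u t = 1) (us' : m u' s = 1) (ut' : m u' t = 1)
    (ur : m u r ≠ 1) (ur' : m u' r ≠ 1) : False := by
  have hm := h.mult
  have hsW := (Finset.mem_sdiff.1 d.hs).1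
  have htW := (Finset.mem_sdiff.1 d.ht).1
  have hrW := (Finset.mem_sdiff.1 d.hr).1
  have key : ∀ {s t : V}, DeficientTriple m i W s t r → m s t = 0 → m s r = 0 → m t r = 0 →
      m u s = 1 → m u t = 1 → m u' s = 1 → m u' t = 1 →
      ∃ n ∈ W \ threes m i W, n ≠ s ∧ n ≠ t ∧ n ≠ r ∧ m n t = 1 ∧
        (∀ y ∈ W \ threes m i W, y ≠ t → m n y = 0) ∧
        ∀ v ∈ threes m i W, m v r = 1 → m v n = 1 := by
    intro s t d h1 h2 h3 us ut us' ut'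
    have hsW := (Finset.mem_sdiff.1 d.hs).1
    obtain ⟨n, hn, nt, ns, nr, hnt, hn0⟩ :=
      h.exists_outside_neighbor hpot d.swap (by rwa [hm.symm]) h3
    have hnW := (Finset.mem_sdiff.1 hn).1
    refine ⟨n, hn, ns, nt, nr, hnt, hn0, ?_⟩
    have cs : ∀ v ∈ threes m i W, m v s = 1 → v = u ∨ v = u' := fun v hv b =>
      h.eq_or_eq_of_adj d.cs.le hu hu' hv huu us us' b
    have z1 : ¬ 1 ≤ shared m i W {s, n, r} s r := by
      intro hc
      obtain ⟨v, hv, -, b1, b2⟩ := h.exists_of_one_le_shared hsW hrW hc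
      rcases cs v hv b1 with rfl | rfl <;> contradiction
    have z2 : ¬ 2 ≤ shared m i W {s, n, r} s n := by
      intro hc
      obtain ⟨v, hv, v', hv', hvv, -, -, b1, b2, b3, b4⟩ := h.exists_of_two_le_shared hsW hnW hc
      have b5 : m u n = 1 ∧ m u' n = 1 := by
        rcases cs v hv b1 with rfl | rfl <;> rcases cs v' hv' b3 with rfl | rfl
        exacts [absurd rfl hvv, ⟨b2, b4⟩, ⟨b4, b2⟩, absurd rfl hvv]
      exact h.false_of_shared_neighbor hpot d h1 h2 h3 hu hu' huu us ut us' ut' hn ns nt nr hnt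
        hn0 b5.1 b5.2
    -- The cover `{s, n, r}` must fail. As `s` and `r` share nothing and `s` and `n` at most one,
    -- `n` is adjacent to both neighbours of `r` in `threes`.
    have z3 : 2 ≤ shared m i W {s, n, r} n r := by
      have := h.shared_of_triple hpot d h2 hn ns nr hnt hn0
      omega
    obtain ⟨v, hv, v', hv', hvv, -, -, b1, b2, b3, b4⟩ := h.exists_of_two_le_shared hnW hrW z3
    intro w hw hwr
    rcases h.eq_or_eq_of_adj d.cr.le hv hv' hw hvv b2 b4 hwr with rfl | rfl <;> assumption
  obtain ⟨p, hp, ps, pt, pr, hpt, hp0, hpr⟩ := key d h1 h2 h3 us ut us' ut'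
  obtain ⟨q, hq, qt, qs, qr, hqs, hq0, hqr⟩ :=
    key d.swap (by rwa [hm.symm]) h3 h2 ut us ut' us'
  have hpW := (Finset.mem_sdiff.1 hp).1
  have hqW := (Finset.mem_sdiff.1 hq).1
  have hpq : p ≠ q := by
    rintro rfl
    have := hq0 t d.ht d.st.symm
    omega
  -- The neighbours of `r` in `threes` are adjacent to both `p` and `q`, so they give no reduced
  -- edge on `{p, q, r}`. Each of `p`, `q` has only one further neighbour in `threes`.
  have hthree : ∀ v, m v r = 1 → nb m v {p, q, r} ≠ 2 ∨ ¬ (m v p = 1 ∧ m v q = 1) := by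
    intro v b1
    by_contra! hc
    exact not_three_adj hc.1.le (by simp) (by simp) (by simp) hpq pr qr hc.2.1 hc.2.2 b1
  have z1 : ¬ 1 ≤ shared m i W {p, q, r} p r := by
    intro hc
    obtain ⟨v, hv, b0, b1, b2⟩ := h.exists_of_one_le_shared hpW hrW hc
    rcases hthree v b2 with b3 | b3
    exacts [b3 b0, b3 ⟨b1, hqr v hv b2⟩]
  have z2 : ¬ 1 ≤ shared m i W {p, q, r} q r := by
    intro hc
    obtain ⟨v, hv, b0, b1, b2⟩ := h.exists_of_one_le_shared hqW hrW hc
    rcases hthree v b2 with b3 | b3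
    exacts [b3 b0, b3 ⟨hpr v hv b2, b1⟩]
  have z3 : ¬ 2 ≤ shared m i W {p, q, r} p q := by
    intro hc
    obtain ⟨v, hv, v', hv', hvv, b0, b0', b1, b2, b3, b4⟩ :=
      h.exists_of_two_le_shared hpW hqW hc
    obtain ⟨w, hw, w', hw', hww, c1, c2⟩ := h.exists_of_two_le subset_rfl hrW d.cr.ge
    have hne : ∀ {x y}, nb m x {p, q, r} = 2 → m x p = 1 → m x q = 1 → m y r = 1 → y ≠ x := by
      rintro x y e1 e2 e3 e4 rfl
      rcases hthree y e4 with b3 | b3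
      exacts [b3 e1, b3 ⟨e2, e3⟩]
    have e := not_four_adj (m := m) (v := p) (X := threes m i W) (d.full p hp ps pt pr).le
      hw hw' hv hv' hww (hne b0 b1 b2 c1) (hne b0' b3 b4 c1) (hne b0 b1 b2 c2)
      (hne b0' b3 b4 c2) hvv
    rw [hm.symm p, hm.symm p, hm.symm p, hm.symm p] at e
    exact e (hpr w hw c1) (hpr w' hw' c2) b1 b3
  have e1 : m p q = 0 := hp0 q hq qt
  have e2 : m p r = 0 := hp0 r d.hr d.tr.symm
  have e3 : m q r = 0 := hq0 r d.hr d.sr.symm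
  refine h.false_of_cover_three hpot hp hq d.hr hpq pr qr (by omega) (by omega) (by omega)
    (by omega) fun y hy b1 b2 b3 => ?_
  by_cases hys : y = s
  · subst hys
    rw [hm.symm y q]
    have := d.cs
    omega
  by_cases hyt : y = t
  · subst hyt
    rw [hm.symm y p]
    have := d.ct
    omega
  have := d.full y hy hys hyt b3
  omega

/-- Three pairwise nonadjacent deficient vertices, any two of which share a neighbour. -/
lemma MinCounterexample.false_of_shared_triangle (h : MinCounterexample 1 m i a W)
    (hpot : pot 1 m i a W = -1) (d : DeficientTriple m i W s t r)
    (h1 : m s t = 0) (h2 : m s r = 0) (h3 : m t r = 0)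
    (hx : x ∈ threes m i W) (hy : y ∈ threes m i W) (hz : z ∈ threes m i W)
    (xs : m x s = 1) (xt : m x t = 1) (xr : m x r ≠ 1)
    (ys : m y s = 1) (yr : m y r = 1) (yt : m y t ≠ 1)
    (zt : m z t = 1) (zr : m z r = 1) (zs : m z s ≠ 1) : False := by
  have hm := h.mult
  have hsW := (Finset.mem_sdiff.1 d.hs).1
  have htW := (Finset.mem_sdiff.1 d.ht).1
  have key : ∀ {s t y z : V}, DeficientTriple m i W s t r → m s t = 0 → m s r = 0 → m t r = 0 →
      y ∈ threes m i W → z ∈ threes m i W → m x s = 1 → m x t = 1 →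
      m y s = 1 → m y r = 1 → m y t ≠ 1 → m z t = 1 → m z r = 1 → m z s ≠ 1 →
      ∃ n ∈ W \ threes m i W, n ≠ s ∧ n ≠ t ∧ m n t = 1 ∧
        (∀ y ∈ W \ threes m i W, y ≠ t → m n y = 0) ∧ m x n = 1 := by
    intro s t y z d h1 h2 h3 hy hz xs xt ys yr yt zt zr zs
    have hsW := (Finset.mem_sdiff.1 d.hs).1
    have hrW := (Finset.mem_sdiff.1 d.hr).1
    obtain ⟨n, hn, nt, ns, nr, hnt, hn0⟩ :=
      h.exists_outside_neighbor hpot d.swap (by rwa [hm.symm]) h3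
    have hnW := (Finset.mem_sdiff.1 hn).1
    refine ⟨n, hn, ns, nt, hnt, hn0, ?_⟩
    have hxy : x ≠ y := by rintro rfl; exact yt xt
    have hyz : y ≠ z := by rintro rfl; exact zs ys
    have hxz : x ≠ z := by rintro rfl; exact zs xs
    have hthree : ∀ v, nb m v {s, n, r} = 2 → m v s = 1 → m v n = 1 → m v r = 1 → False :=
      fun v b0 b1 b2 b3 =>
        not_three_adj b0.le (by simp) (by simp) (by simp) ns.symm d.sr nr b1 b2 b3
    have z1 : ∀ v ∈ threes m i W, nb m v {s, n, r} = 2 → m v s = 1 → m v n = 1 → v = x := by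
      intro v hv b0 b1 b2
      rcases h.eq_or_eq_of_adj d.cs.le hx hy hv hxy xs ys b1 with rfl | rfl
      · rfl
      · exact (hthree _ b0 b1 b2 yr).elim
    have z2 : ∀ v ∈ threes m i W, nb m v {s, n, r} = 2 → m v n = 1 → m v r = 1 → v = z := by
      intro v hv b0 b1 b2
      rcases h.eq_or_eq_of_adj d.cr.le hy hz hv hyz yr zr b2 with rfl | rfl
      · exact (hthree _ b0 ys b1 b2).elim
      · rfl
    have z3 : ∀ v ∈ threes m i W, m v s = 1 → m v r = 1 → v = y := by
      intro v hv b1 b2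
      rcases h.eq_or_eq_of_adj d.cs.le hx hy hv hxy xs ys b1 with rfl | rfl
      · contradiction
      · rfl
    -- On `{s, n, r}` only `x` can join `s` to `n`, only `y` joins `s` to `r`, and only `z` joins
    -- `n` to `r`. Failure of the cover thus means a triangle, which makes `x` adjacent to `n`.
    rcases h.shared_of_triple hpot d h2 hn ns nr hnt hn0 with hc | hc | hc | hc
    · obtain ⟨v, hv, v', hv', hvv, b0, b0', b1, b2, b3, b4⟩ :=
        h.exists_of_two_le_shared hsW hnW hc
      exact absurd ((z1 v hv b0 b1 b2).trans (z1 v' hv' b0' b3 b4).symm) hvv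
    · obtain ⟨v, hv, v', hv', hvv, b0, b0', b1, b2, b3, b4⟩ :=
        h.exists_of_two_le_shared hsW hrW hc
      exact absurd ((z3 v hv b1 b2).trans (z3 v' hv' b3 b4).symm) hvv
    · obtain ⟨v, hv, v', hv', hvv, b0, b0', b1, b2, b3, b4⟩ :=
        h.exists_of_two_le_shared hnW hrW hc
      exact absurd ((z2 v hv b0 b1 b2).trans (z2 v' hv' b0' b3 b4).symm) hvv
    · obtain ⟨v, hv, b0, b1, b2⟩ := h.exists_of_one_le_shared hsW hnW hc.1
      rw [← z1 v hv b0 b1 b2]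
      exact b2
  obtain ⟨p, hp, ps, pt, hpt, hp0, hpx⟩ := key d h1 h2 h3 hy hz xs xt ys yr yt zt zr zs
  obtain ⟨q, hq, qt, qs, hqs, hq0, hqx⟩ :=
    key d.swap (by rwa [hm.symm]) h3 h2 hz hy xt xs zt zr zs ys yr yt
  have hpq : p ≠ q := by
    rintro rfl
    have := hq0 t d.ht d.st.symm
    omega
  -- By symmetry `x` is adjacent to both outside neighbours as well as to `s` and `t`, too many for
  -- degree three.
  exact not_four_adj (mem_threes.1 hx).2.2.le hsW htW (Finset.mem_sdiff.1 hp).1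
    (Finset.mem_sdiff.1 hq).1 d.st ps.symm qs.symm pt.symm qt.symm hpq xs xt hpx hqx

/-- The cover `{s, t, r}` fails only through a double reduced edge or a triangle, the two
configurations already excluded. -/
lemma MinCounterexample.false_of_not_adj (h : MinCounterexample 1 m i a W)
    (hpot : pot 1 m i a W = -1) (d : DeficientTriple m i W s t r)
    (h1 : m s t = 0) (h2 : m s r = 0) (h3 : m t r = 0) : False := by
  have hm := h.mult
  have hsW := (Finset.mem_sdiff.1 d.hs).1
  have htW := (Finset.mem_sdiff.1 d.ht).1
  have hrW := (Finset.mem_sdiff.1 d.hr).1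
  have hthree : ∀ v, nb m v {s, t, r} = 2 → m v s = 1 → m v t = 1 → m v r = 1 → False :=
    fun v b0 b1 b2 b3 =>
      not_three_adj b0.le (by simp) (by simp) (by simp) d.st d.sr d.tr b1 b2 b3
  have c1 : shared m i W {s, t, r} s t ≤ 1 := by
    by_contra hc
    obtain ⟨v, hv, v', hv', hvv, b0, b0', b1, b2, b3, b4⟩ :=
      h.exists_of_two_le_shared hsW htW (Nat.lt_of_not_le hc)
    exact h.false_of_shared_pair hpot d h1 h2 h3 hv hv' hvv b1 b2 b3 b4
      (hthree v b0 b1 b2) (hthree v' b0' b3 b4)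
  have c2 : shared m i W {s, t, r} s r ≤ 1 := by
    by_contra hc
    obtain ⟨v, hv, v', hv', hvv, b0, b0', b1, b2, b3, b4⟩ :=
      h.exists_of_two_le_shared hsW hrW (Nat.lt_of_not_le hc)
    exact h.false_of_shared_pair hpot d.swap.rotate h2 h1 (by rwa [hm.symm])
      hv hv' hvv b1 b2 b3 b4
      (fun e => hthree v b0 b1 e b2) (fun e => hthree v' b0' b3 e b4)
  have c3 : shared m i W {s, t, r} t r ≤ 1 := by
    by_contra hc
    obtain ⟨v, hv, v', hv', hvv, b0, b0', b1, b2, b3, b4⟩ :=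
      h.exists_of_two_le_shared htW hrW (Nat.lt_of_not_le hc)
    exact h.false_of_shared_pair hpot d.rotate h3 (by rwa [hm.symm]) (by rwa [hm.symm])
      hv hv' hvv b1 b2 b3 b4
      (fun e => hthree v b0 e b1 b2) (fun e => hthree v' b0' e b3 b4)
  by_cases hz : 1 ≤ shared m i W {s, t, r} s t ∧ 1 ≤ shared m i W {s, t, r} s r ∧
      1 ≤ shared m i W {s, t, r} t r
  · obtain ⟨x, hx, b0, b1, b2⟩ := h.exists_of_one_le_shared hsW htW hz.1
    obtain ⟨y, hy, b3, b4, b5⟩ := h.exists_of_one_le_shared hsW hrW hz.2.1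
    obtain ⟨z, hz, b6, b7, b8⟩ := h.exists_of_one_le_shared htW hrW hz.2.2
    exact h.false_of_shared_triangle hpot d h1 h2 h3 hx hy hz b1 b2 (hthree x b0 b1 b2)
      b4 b5 (fun e => hthree y b3 b4 e b5) b7 b8 (fun e => hthree z b6 e b7 b8)
  · refine h.false_of_cover_three hpot d.hs d.ht d.hr d.st d.sr d.tr (by omega) (by omega)
      (by omega) (by omega) fun y hy e1 e2 e3 => ?_
    have := d.full y hy e1 e2 e3
    omega

lemma MinCounterexample.false_of_deficientTriple (h : MinCounterexample 1 m i a W)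
    (hpot : pot 1 m i a W = -1) (d : DeficientTriple m i W s t r) : False := by
  have hm := h.mult
  have e1 := hm.symm s t
  have e2 := hm.symm s r
  have e3 := hm.symm t r
  rcases Nat.eq_zero_or_pos (m s t) with h1 | h1 <;>
    rcases Nat.eq_zero_or_pos (m s r) with h2 | h2 <;>
    rcases Nat.eq_zero_or_pos (m t r) with h3 | h3
  · exact h.false_of_not_adj hpot d h1 h2 h3
  · exact h.false_of_one_adj hpot d.rotate h3 (by omega) (by omega)
  · exact h.false_of_one_adj hpot d.rotate.rotate (by omega) (by omega) h1
  · exact h.false_of_two_adj hpot d.rotate.rotate (by omega) (by omega)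
  · exact h.false_of_one_adj hpot d h1 h2 h3
  · exact h.false_of_two_adj hpot d.rotate h3 (by omega)
  · exact h.false_of_two_adj hpot d h1 h2
  · exact h.false_of_two_adj hpot d h1 h2

/-- Two deficient vertices. -/
lemma MinCounterexample.false_of_deficient_pair (h : MinCounterexample 1 m i a W)
    (hpot : pot 1 m i a W = -1) (hs : s ∈ W \ threes m i W) (ht : t ∈ W \ threes m i W)
    (hst : s ≠ t) (cs : nb m s (threes m i W) = 1) (ct : nb m t (threes m i W) = 2)
    (hfull : ∀ y ∈ W \ threes m i W, y ≠ s → y ≠ t → nb m y (threes m i W) = 3) : False := by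
  have hm := h.mult
  have hsW := (Finset.mem_sdiff.1 hs).1
  have htW := (Finset.mem_sdiff.1 ht).1
  -- If `s` and `t` are nonadjacent, `{s, t}` is a cover, since `s` has a single neighbour in
  -- `threes` and cannot produce a double edge. Otherwise `{s}` covers `t`.
  by_cases h1 : m s t = 0
  · refine h.false_of_cover_two hpot hs ht hst ?_ fun y hy b1 b2 => ?_
    · by_contra hc
      obtain ⟨v, hv, v', hv', hvv, -, -, b1, -, b2, -⟩ :=
        h.exists_of_two_le_shared (X := {s, t}) hsW htW (by omega)
      have hsub : ({v, v'} : Finset V) ⊆ threes m i W := by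
        intro z hz
        simp only [Finset.mem_insert, Finset.mem_singleton] at hz
        rcases hz with rfl | rfl <;> assumption
      have := nb_mono (m := m) (u := s) hsub
      rw [nb_insert (by simpa using hvv), nb_singleton, hm.symm s, hm.symm s] at this
      omega
    · have := hfull y hy b1 b2
      omega
  · refine h.false_of_cover_one hpot hs fun y hy hys => ?_
    by_cases hyt : y = t
    · subst hyt
      rw [hm.symm y s]
      omega
    · have := hfull y hy hys hyt
      omega

/-- The total deficit `3` is concentrated in one vertex, split as `2 + 1`, or spread over three
vertices with deficit one each. -/
theorem MinCounterexample.pot_ne_neg_one (h : MinCounterexample 1 m i a W) :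
    pot 1 m i a W ≠ -1 := by
  intro hpot
  have hsum := h.sum_deficit hpot
  set S := (W \ threes m i W).filter fun y => nb m y (threes m i W) < 3 with hS
  have hfull : ∀ y ∈ W \ threes m i W, y ∉ S → nb m y (threes m i W) = 3 := by
    intro y hy hyS
    have := (h.outside_threes hpot hy).2.2
    have : ¬ nb m y (threes m i W) < 3 := fun hc => hyS (Finset.mem_filter.2 ⟨hy, hc⟩)
    omega
  have hsum2 : ∑ y ∈ S, (3 - nb m y (threes m i W)) = 3 := by
    have hsub : S ⊆ W \ threes m i W := Finset.filter_subset _ _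
    refine (Finset.sum_subset hsub fun y hy hyS => ?_).trans hsum
    rw [hfull y hy hyS, Nat.sub_self]
  have hmem : ∀ y ∈ S, y ∈ W \ threes m i W ∧ nb m y (threes m i W) < 3 :=
    fun y hy => Finset.mem_filter.1 hy
  have hcard : S.card ≤ 3 := by
    refine le_trans ?_ hsum2.le
    rw [Finset.card_eq_sum_ones]
    refine Finset.sum_le_sum fun y hy => ?_
    have := (hmem y hy).2
    omega
  have hcases : S.card = 0 ∨ S.card = 1 ∨ S.card = 2 ∨ S.card = 3 := by omega
  rcases hcases with hc | hc | hc | hc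
  · rw [Finset.card_eq_zero.1 hc] at hsum2
    simp at hsum2
  · obtain ⟨s, hs⟩ := Finset.card_eq_one.1 hc
    rw [hs] at hfull hmem
    refine h.false_of_cover_one hpot (hmem s (by simp)).1 fun y hy hys => ?_
    have := hfull y hy (by simpa using hys)
    omega
  · obtain ⟨s, t, hst, hs⟩ := Finset.card_eq_two.1 hc
    rw [hs] at hfull hmem hsum2
    rw [Finset.sum_pair hst] at hsum2
    obtain ⟨h1, h2⟩ := hmem s (by simp)
    obtain ⟨h3, h4⟩ := hmem t (by simp)
    have : (nb m s (threes m i W) = 1 ∧ nb m t (threes m i W) = 2) ∨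
        (nb m t (threes m i W) = 1 ∧ nb m s (threes m i W) = 2) := by omega
    rcases this with ⟨h5, h6⟩ | ⟨h5, h6⟩
    · exact h.false_of_deficient_pair hpot h1 h3 hst h5 h6
        fun y hy b1 b2 => hfull y hy (by simp [b1, b2])
    · exact h.false_of_deficient_pair hpot h3 h1 hst.symm h5 h6
        fun y hy b1 b2 => hfull y hy (by simp [b1, b2])
  · obtain ⟨s, t, r, hst, hsr, htr, hs⟩ := Finset.card_eq_three.1 hc
    rw [hs] at hfull hmem hsum2
    rw [Finset.sum_insert (by simp [hst, hsr]), Finset.sum_pair htr] at hsum2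
    obtain ⟨h1, h2⟩ := hmem s (by simp)
    obtain ⟨h3, h4⟩ := hmem t (by simp)
    obtain ⟨h5, h6⟩ := hmem r (by simp)
    exact h.false_of_deficientTriple hpot ⟨h1, h3, h5, hst, hsr, htr, by omega, by omega,
      by omega, fun y hy b1 b2 b3 => hfull y hy (by simp [b1, b2, b3])⟩

end independent

/-! ### The potential theorem. -/

section main

variable {D : ℕ} {m : V → V → ℕ} {i a : V → ℕ} {W : Finset V}

lemma exists_minimal_not_colorable (h : ¬ Colorable D m i a W) :
    ∃ X ⊆ W, X.Nonempty ∧ ¬ Colorable D m i a X ∧ ∀ S ⊂ X, Colorable D m i a S := by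
  classical
  obtain ⟨X, hX, hmin⟩ := (W.powerset.filter fun X => ¬ Colorable D m i a X).exists_min_image
    Finset.card ⟨W, by simp [h]⟩
  simp only [Finset.mem_filter, Finset.mem_powerset] at hX hmin
  refine ⟨X, hX.1, ?_, hX.2, fun S hS => ?_⟩
  · rw [Finset.nonempty_iff_ne_empty]
    rintro rfl
    exact hX.2 colorable_empty
  · by_contra hc
    have := hmin S ⟨hS.1.trans hX.1, hc⟩
    have := Finset.card_lt_card hS
    omega

/-- A vertex-critical instance has potential at most `-2`. -/
theorem pot_le_neg_two (hD : 1 ≤ D) (hm : IsMult m) (hi : ∀ v, i v ≤ D + 1) (ha : ∀ v, a v ≤ 1)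
    (hW : ¬ Colorable D m i a W) (hS : ∀ S ⊂ W, Colorable D m i a S) : pot D m i a W ≤ -2 := by
  induction hn : W.card using Nat.strong_induction_on generalizing m i a W with
  | _ n IH =>
    subst hn
    by_contra! hlt
    have h : MinCounterexample D m i a W := by
      refine ⟨hm, hi, ha, hW, hS, by omega, ?_⟩
      -- A non-colourable smaller instance contains a vertex-critical subset, whose potential is at
      -- most `-2` by induction.
      intro m' i' a' W' hm' hi' ha' hcard hpot
      by_contra hc
      obtain ⟨X, hX, hne, hX1, hX2⟩ := exists_minimal_not_colorable hc
      have h1 := IH X.card ((Finset.card_le_card hX).trans_lt hcard) hm' hi' ha' hX1 hX2 rfl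
      have h2 := hpot X hX hne
      omega
    obtain ⟨rfl, h1⟩ := h.eq_one hD
    exact h.pot_ne_neg_one h1

theorem colorable_of_pot (hD : 1 ≤ D) (hm : IsMult m) (hi : ∀ v, i v ≤ D + 1) (ha : ∀ v, a v ≤ 1)
    (hpot : ∀ X ⊆ W, X.Nonempty → -1 ≤ pot D m i a X) : Colorable D m i a W := by
  by_contra hc
  obtain ⟨X, hX, hne, hX1, hX2⟩ := exists_minimal_not_colorable hc
  have h1 := pot_le_neg_two hD hm hi ha hX1 hX2
  have h2 := hpot X hX hne
  omega

end main

/-! ### Translation between multigraphs and multiplicity functions. -/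

section multigraph

variable {α β : Type*} {G H : Graph α β} {D : ℕ} {x y : α}

/-- The number of edges joining two vertices. -/
noncomputable def mul (G : Graph α β) (x y : α) : ℕ := {e | G.IsLink e x y}.ncard

lemma isMult_mul (hG : G.Loopless) : IsMult (mul G) where
  symm x y := by simp only [mul, G.isLink_comm]
  self x := by
    have : {e | G.IsLink e x x} = ∅ :=
      Set.eq_empty_of_forall_notMem fun e he => hG.not_isLoopAt e x he
    rw [mul, this, Set.ncard_empty]

lemma finite_of_isLink (hE : G.edgeSet.Finite) {S : Set β}
    (hS : ∀ e ∈ S, ∃ x y, G.IsLink e x y) : S.Finite :=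
  hE.subset fun e he => by
    obtain ⟨x, y, h⟩ := hS e he
    exact h.edge_mem

lemma finite_edges_to (hE : G.edgeSet.Finite) (x : α) (Y : Finset α) :
    {e | ∃ y ∈ Y, G.IsLink e x y}.Finite :=
  finite_of_isLink hE fun _ ⟨y, _, h⟩ => ⟨x, y, h⟩

lemma finite_edges_within (hE : G.edgeSet.Finite) (Y : Finset α) :
    {e | ∃ x ∈ Y, ∃ y ∈ Y, G.IsLink e x y}.Finite :=
  finite_of_isLink hE fun _ ⟨x, _, y, _, h⟩ => ⟨x, y, h⟩

variable [DecidableEq α]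

lemma nb_mul (hE : G.edgeSet.Finite) (x : α) (Y : Finset α) :
    nb (mul G) x Y = {e | ∃ y ∈ Y, G.IsLink e x y}.ncard := by
  induction Y using Finset.induction_on with
  | empty => simp
  | insert v Y hv ih =>
    have h1 : {e | ∃ y ∈ insert v Y, G.IsLink e x y}
        = {e | G.IsLink e x v} ∪ {e | ∃ y ∈ Y, G.IsLink e x y} := by
      ext e
      simp
    have h2 : {e | G.IsLink e x v}.Finite := finite_of_isLink hE fun e he => ⟨x, v, he⟩
    rw [nb_insert hv, ih, h1, Set.ncard_union_eq ?_ h2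
      (finite_edges_to hE x Y), mul]
    refine Set.disjoint_left.2 fun e he he' => ?_
    obtain ⟨y, hy, h2⟩ := he'
    exact hv (h2.right_unique he ▸ hy)

lemma cross_mul (hG : G.Loopless) (hE : G.edgeSet.Finite) (Y : Finset α) :
    cross (mul G) Y Y = 2 * {e | ∃ x ∈ Y, ∃ y ∈ Y, G.IsLink e x y}.ncard := by
  induction Y using Finset.induction_on with
  | empty => simp
  | insert v Y hv ih =>
    have h1 : {e | ∃ x ∈ insert v Y, ∃ y ∈ insert v Y, G.IsLink e x y}
        = {e | ∃ x ∈ Y, ∃ y ∈ Y, G.IsLink e x y} ∪ {e | ∃ y ∈ Y, G.IsLink e v y} := by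
      ext e
      simp only [Set.mem_ofPred_eq, Set.mem_union, Finset.mem_insert]
      constructor
      · rintro ⟨x, rfl | hx, y, rfl | hy, h⟩
        · exact absurd h (hG.not_isLoopAt e _)
        · exact Or.inr ⟨y, hy, h⟩
        · exact Or.inr ⟨x, hx, h.symm⟩
        · exact Or.inl ⟨x, hx, y, hy, h⟩
      · rintro (⟨x, hx, y, hy, h⟩ | ⟨y, hy, h⟩)
        · exact ⟨x, Or.inr hx, y, Or.inr hy, h⟩
        · exact ⟨v, Or.inl rfl, y, Or.inr hy, h⟩
    rw [cross_insert_self (isMult_mul hG) hv, ih, h1,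
      Set.ncard_union_eq ?_ (finite_edges_within hE Y) (finite_edges_to hE v Y), nb_mul hE, mul_add]
    refine Set.disjoint_left.2 fun e he he' => ?_
    obtain ⟨x, hx, y, hy, h2⟩ := he
    obtain ⟨z, hz, h3⟩ := he'
    rcases h3.left_eq_or_eq h2 with rfl | rfl
    · exact hv hx
    · exact hv hy

/-- A walk without immediate repetition of edges closes up to a cycle. -/
lemma exists_cycle_of_walk {x : ℕ → α} {e : ℕ → β} (hl : ∀ k, G.IsLink (e k) (x k) (x (k + 1)))
    (hne : ∀ k, e k ≠ e (k + 1)) (hfin : (Set.range x).Finite) : ¬ G.IsForest := by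
  have hrep : ∃ d, ∃ p, x p = x (p + (d + 1)) := by
    by_contra! hc
    refine Set.infinite_range_of_injective ?_ hfin
    intro p q hpq
    rcases lt_trichotomy p q with h | h | h
    · exact absurd (by rw [hpq]; congr 1; omega) (hc (q - p - 1) p)
    · exact h
    · exact absurd (by rw [← hpq]; congr 1; omega) (hc (p - q - 1) q)
  classical
  -- The shortest distance between two visits to the same vertex makes the vertices in between
  -- distinct.
  obtain ⟨n, ⟨p, hp⟩, hmin⟩ : ∃ n, (∃ p, x p = x (p + (n + 1))) ∧
      ∀ d < n, ∀ p, x p ≠ x (p + (d + 1)) :=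
    ⟨Nat.find hrep, Nat.find_spec hrep, fun d hd p h => Nat.find_min hrep hd ⟨p, h⟩⟩
  have hinj : ∀ k l, k < l → l < n + 1 → x (p + k) ≠ x (p + l) := by
    intro k l h1 h2
    have := hmin (l - k - 1) (by omega) (p + k)
    rwa [show p + k + (l - k - 1 + 1) = p + l by omega] at this
  -- Equal edges start at the same vertex or are traversed in opposite directions. In the latter
  -- case the end of the first is the start of the second, so they are consecutive, which `hne`
  -- excludes.
  have hinje : ∀ k l, k < l → l < n + 1 → e (p + k) ≠ e (p + l) := by
    intro k l h1 h2 h3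
    have h4 := hl (p + k)
    rw [h3] at h4
    rcases h4.eq_and_eq_or_eq_and_eq (hl (p + l)) with ⟨h5, -⟩ | ⟨-, h5⟩
    · exact hinj k l h1 h2 h5
    · rcases (Nat.succ_le_of_lt h1).eq_or_lt with h6 | h6
      · subst h6
        exact hne (p + k) h3
      · exact hinj (k + 1) l h6 h2 h5
  intro hf
  refine hf ⟨n, fun k => x (p + k), fun k => e (p + k), ?_, ?_, ?_⟩
  · intro k l hkl
    rcases lt_trichotomy k l with h | h | h
    · exact absurd hkl (hinj k l h l.2)
    · exact h
    · exact absurd hkl.symm (hinj l k h k.2)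
  · intro k l hkl
    rcases lt_trichotomy k l with h | h | h
    · exact absurd hkl (hinje k l h l.2)
    · exact h
    · exact absurd hkl.symm (hinje l k h k.2)
  · intro k
    have h1 := hl (p + k)
    have h2 : x (p + ((k + 1 : Fin (n + 1)) : ℕ)) = x (p + k + 1) := by
      by_cases hk : k = Fin.last n
      · subst hk
        simp only [Fin.last_add_one, Fin.val_zero, Fin.val_last, add_zero]
        exact hp
      · rw [Fin.val_add_one_of_lt (Fin.lt_last_iff_ne_last.2 hk)]
        rfl
    change G.IsLink (e (p + k)) (x (p + k)) (x (p + ((k + 1 : Fin (n + 1)) : ℕ)))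
    rw [h2]
    exact h1

/-- From every vertex of `Y` one can leave along an edge different from the one just used; the
resulting infinite walk stays in a finite set. -/
lemma not_isForest_of_two_le (hE : G.edgeSet.Finite) {Y : Finset α} (hne : Y.Nonempty)
    (h2 : ∀ y ∈ Y, 2 ≤ nb (mul G) y Y) : ¬ G.IsForest := by
  have step : ∀ y ∈ Y, ∀ e : β, ∃ e' z, z ∈ Y ∧ e' ≠ e ∧ G.IsLink e' y z := by
    intro y hy e
    have h3 := h2 y hy
    rw [nb_mul hE] at h3
    obtain ⟨e', ⟨z, hz, h4⟩, h5⟩ := Set.exists_ne_of_one_lt_ncard (by omega :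
      1 < {e | ∃ z ∈ Y, G.IsLink e y z}.ncard) e
    exact ⟨e', z, hz, h5, h4⟩
  obtain ⟨y₀, hy₀⟩ := hne
  have h0 := h2 y₀ hy₀
  rw [nb_mul hE] at h0
  obtain ⟨e₀, z₀, hz₀, h3⟩ : {e | ∃ z ∈ Y, G.IsLink e y₀ z}.Nonempty :=
    Set.nonempty_of_ncard_ne_zero (by omega)
  choose! f g hg hf hl using step
  let w : ℕ → β × α := fun k => Nat.rec (e₀, z₀) (fun _ s => (f s.2 s.1, g s.2 s.1)) k
  have hw : ∀ k, (w k).2 ∈ Y := by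
    intro k
    induction k with
    | zero => exact hz₀
    | succ k ih => exact hg _ ih _
  refine exists_cycle_of_walk (x := fun k => (w k).2) (e := fun k => (w (k + 1)).1)
    (fun k => hl _ (hw k) _) (fun k => (hf _ (hw (k + 1)) _).symm)
    (Y.finite_toSet.subset ?_)
  rintro _ ⟨k, rfl⟩
  exact hw k

lemma nb_mul_induce {X Y : Finset α} (hx : x ∈ X) (hY : Y ⊆ X) :
    nb (mul (G.induce X)) x Y = nb (mul G) x Y := by
  refine nb_congr fun y hy => ?_
  simp [mul, hx, hY hy]

lemma edgeSet_induce_finite (hE : G.edgeSet.Finite) (X : Set α) : (G.induce X).edgeSet.Finite :=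
  finite_of_isLink hE fun e he => by
    obtain ⟨x, y, h⟩ := he
    exact ⟨x, y, h.1⟩

/-- In a smallest subset violating sparsity every vertex has two edges, since a vertex with fewer
could be removed; this yields a cycle. Conversely a cycle has as many edges as vertices. -/
lemma isForest_induce_iff (hG : G.Loopless) (hE : G.edgeSet.Finite) (X : Finset α) :
    (G.induce X).IsForest ↔ Forest (mul G) X := by
  have hm := isMult_mul hG
  constructor
  · intro hf
    by_contra hc
    have hex : ∃ Y ⊆ X, Y.Nonempty ∧ 2 * Y.card ≤ cross (mul G) Y Y := by
      unfold Forest at hc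
      push Not at hc
      obtain ⟨Y, hY, hne, h⟩ := hc
      rw [cross_mul hG hE] at h
      exact ⟨Y, hY, hne, by rw [cross_mul hG hE]; omega⟩
    obtain ⟨Y, hY, hmin⟩ := (X.powerset.filter fun Y =>
      Y.Nonempty ∧ 2 * Y.card ≤ cross (mul G) Y Y).exists_min_image Finset.card (by
        obtain ⟨Y, h1, h2⟩ := hex
        exact ⟨Y, by simpa using ⟨h1, h2⟩⟩)
    simp only [Finset.mem_filter, Finset.mem_powerset] at hY hmin
    obtain ⟨hYX, hne, hY2⟩ := hY
    refine not_isForest_of_two_le (edgeSet_induce_finite hE X) hne (fun y hy => ?_) hf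
    rw [nb_mul_induce (hYX hy) hYX]
    by_contra hlt
    have h1 : cross (mul G) Y Y
        = cross (mul G) (Y.erase y) (Y.erase y) + 2 * nb (mul G) y Y := by
      conv_lhs => rw [← Finset.insert_erase hy]
      rw [cross_insert_self hm (Finset.notMem_erase y Y), nb_erase_self hm]
    have h2 := Finset.card_erase_add_one hy
    rcases (Y.erase y).eq_empty_or_nonempty with h3 | h3
    · have h4 : nb (mul G) y Y = 0 := by
        rw [← nb_erase_self hm, h3, nb_empty]
      rw [h3, cross_empty_left, h4] at h1
      omega
    · have := hmin (Y.erase y) ⟨(Finset.erase_subset _ _).trans hYX, h3, by omega⟩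
      omega
  · rintro hf ⟨n, v, e, hv, he, hl⟩
    have hsub : Finset.univ.image v ⊆ X := by
      intro x hx
      obtain ⟨k, -, rfl⟩ := Finset.mem_image.1 hx
      exact (hl k).left_mem
    have h1 := hf _ hsub ⟨v 0, Finset.mem_image_of_mem _ (Finset.mem_univ _)⟩
    rw [cross_mul hG hE, Finset.card_image_of_injective _ hv, Finset.card_univ,
      Fintype.card_fin] at h1
    have h2 : (Set.range e).ncard ≤
        {e | ∃ x ∈ Finset.univ.image v, ∃ y ∈ Finset.univ.image v, G.IsLink e x y}.ncard := by
      refine Set.ncard_le_ncard ?_ (finite_edges_within hE _)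
      rintro _ ⟨k, rfl⟩
      exact ⟨v k, by simp, v (k + 1), by simp, (hl k).1⟩
    rw [← Set.image_univ, Set.ncard_image_of_injective _ he, Set.ncard_univ, Nat.card_eq_fintype_card,
      Fintype.card_fin] at h2
    omega

lemma vertexDegree_induce (hG : G.Loopless) (hE : G.edgeSet.Finite) {X : Finset α} (hx : x ∈ X) :
    (G.induce X).vertexDegree x = nb (mul G) x X := by
  have h1 : (G.induce X).incidenceSet x = {e | ∃ y ∈ X, G.IsLink e x y} := by
    ext e
    simp only [Graph.mem_incidenceSet, Graph.Inc, Graph.induce_isLink, Finset.mem_coe,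
      Set.mem_ofPred_eq]
    constructor
    · rintro ⟨y, h, -, hy⟩
      exact ⟨y, hy, h⟩
    · rintro ⟨y, hy, h⟩
      exact ⟨y, h, hx, hy⟩
  have h2 : (G.induce X).loopSet x = ∅ :=
    Set.eq_empty_of_forall_notMem fun e he => hG.not_isLoopAt e x he.1
  rw [Graph.vertexDegree, h1, h2, nb_mul hE, Set.encard_empty, add_zero,
    (finite_edges_to hE x X).cast_ncard_eq]

lemma dffColorable_iff (hG : G.Loopless) (hV : G.vertexSet.Finite) (hE : G.edgeSet.Finite) :
    G.DFFColorable D ↔ Colorable D (mul G) 0 0 hV.toFinset := by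
  have key : ∀ M F : Finset α, G.IsDFFColoring D M F ↔
      Disjoint M F ∧ M ∪ F = hV.toFinset ∧ Coloring D (mul G) 0 0 M F := by
    intro M F
    have hdeg : ∀ x ∈ M, ((G.induce M).vertexDegree x ≤ D ↔ nb (mul G) x M ≤ D) := by
      intro x hx
      rw [vertexDegree_induce hG hE hx, Nat.cast_le]
    constructor
    · rintro ⟨h1, h2, h3, h4, h5⟩
      refine ⟨Finset.disjoint_coe.1 h2, ?_, (isForest_induce_iff hG hE M).1 h3,
        (isForest_induce_iff hG hE F).1 h5, fun v hv => (hdeg v hv).1 (h4 v hv), fun v _ => rfl⟩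
      rw [← Finset.coe_inj, Finset.coe_union, h1, Set.Finite.coe_toFinset]
    · rintro ⟨h1, h2, h3, h4, h5, -⟩
      refine ⟨?_, Finset.disjoint_coe.2 h1, (isForest_induce_iff hG hE M).2 h3,
        fun v hv => (hdeg v hv).2 (h5 v hv), (isForest_induce_iff hG hE F).2 h4⟩
      rw [← Finset.coe_union, h2, Set.Finite.coe_toFinset]
  constructor
  · rintro ⟨M, F, h⟩
    have hM : M.Finite := hV.subset (h.union_eq ▸ Set.subset_union_left)
    have hF : F.Finite := hV.subset (h.union_eq ▸ Set.subset_union_right)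
    refine ⟨hM.toFinset, hF.toFinset, (key _ _).1 ?_⟩
    rwa [hM.coe_toFinset, hF.coe_toFinset]
  · rintro ⟨M, F, h⟩
    exact ⟨M, F, (key M F).2 h⟩

/-- The potential of a set of vertices in terms of the number of edges it spans. -/
lemma pot_mul (hG : G.Loopless) (hE : G.edgeSet.Finite) (Y : Finset α) :
    pot D (mul G) 0 0 Y = (4 * D + 3) * Y.card
      - 2 * (D + 1) * {e | ∃ x ∈ Y, ∃ y ∈ Y, G.IsLink e x y}.ncard := by
  rw [pot, cross_mul hG hE]
  simp [wt]
  ring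

lemma colorable_of_lt (hG : G.Loopless) (hV : G.vertexSet.Finite) (hE : G.edgeSet.Finite)
    (hc : ∀ H < G, H.DFFColorable D) {S : Finset α} (hS : S ⊂ hV.toFinset) :
    Colorable D (mul G) 0 0 S := by
  have hSV : (S : Set α) ⊆ G.vertexSet := by
    simpa using Finset.coe_subset.2 hS.1
  have hlt : G.induce S < G := by
    refine lt_of_le_of_ne (Graph.induce_le hSV) fun he => hS.2 ?_
    have h1 : (S : Set α) = G.vertexSet := congrArg Graph.vertexSet he
    intro x hx
    rw [Set.Finite.mem_toFinset, ← h1] at hx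
    exact hx
  have h1 := hc _ hlt
  have hL : (G.induce S).Loopless := ⟨fun e x h => hG.not_isLoopAt e x h.1⟩
  rw [dffColorable_iff hL S.finite_toSet (edgeSet_induce_finite hE S)] at h1
  obtain ⟨M, F, hd, hu, hcol⟩ := h1
  replace hu : M ∪ F = S := hu.trans (Finset.finite_toSet_toFinset S)
  have hM : M ⊆ S := hu ▸ Finset.subset_union_left
  have hF : F ⊆ S := hu ▸ Finset.subset_union_right
  have he : ∀ x ∈ S, ∀ y ∈ S, mul G x y = mul (G.induce S) x y := by
    intro x hx y hy
    simp [mul, hx, hy]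
  refine ⟨M, F, hd, hu,
    hcol.forest_left.congr_le fun x hx y hy => (he x (hM hx) y (hM hy)).le,
    hcol.forest_right.congr_le fun x hx y hy => (he x (hF hx) y (hF hy)).le, fun v hv => ?_,
    hcol.free⟩
  rw [← nb_mul_induce (hM hv) hM]
  exact hcol.deg v hv

theorem card_edges_of_critical (hD : 1 ≤ D) (hG : G.Loopless) (hV : G.vertexSet.Finite)
    (hE : G.edgeSet.Finite) (hc : G.IsDFFCritical D) :
    (4 * D + 3) * G.vertexSet.ncard + 2 ≤ 2 * (D + 1) * G.edgeSet.ncard := by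
  have h1 := pot_le_neg_two (W := hV.toFinset) hD (isMult_mul hG) (i := 0) (a := 0)
    (fun _ => Nat.zero_le _) (fun _ => Nat.zero_le _)
    (fun h => hc.1 ((dffColorable_iff hG hV hE).2 h))
    (fun S hS => colorable_of_lt hG hV hE hc.2 hS)
  have h2 : {e | ∃ x ∈ hV.toFinset, ∃ y ∈ hV.toFinset, G.IsLink e x y} = G.edgeSet := by
    ext e
    simp only [Set.Finite.mem_toFinset, Set.mem_ofPred_eq]
    constructor
    · rintro ⟨x, -, y, -, h⟩
      exact h.edge_mem
    · intro he
      obtain ⟨x, y, h⟩ := Graph.exists_isLink_of_mem_edgeSet he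
      exact ⟨x, h.left_mem, y, h.right_mem, h⟩
  rw [pot_mul hG hE, h2, ← Set.ncard_eq_toFinset_card _ hV] at h1
  zify
  linarith

end multigraph

/-! ### Charging certificates for criticality. -/

section ends

variable {E α β : Type*} {s t : E → V} {f : V ↪ α} {g : E ↪ β} {D : ℕ}

/-- The multigraph with vertices `f v` and edges `g b`, where `b` joins `s b` and `t b`. -/
def ofEnds (s t : E → V) (f : V ↪ α) (g : E ↪ β) : Graph α β where
  vertexSet := Set.range f
  edgeSet := Set.range g
  IsLink e x y := ∃ b, g b = e ∧ (x = f (s b) ∧ y = f (t b) ∨ x = f (t b) ∧ y = f (s b))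
  isLink_symm _ _ := ⟨fun _ _ ⟨b, hb, h⟩ => ⟨b, hb, h.symm.imp And.symm And.symm⟩⟩
  eq_or_eq_of_isLink_of_isLink := by
    rintro e x y v w ⟨b, hb, h⟩ ⟨b', hb', h'⟩
    obtain rfl := g.injective (hb.trans hb'.symm)
    rcases h with h | h <;> rcases h' with h' | h' <;> simp [h.1, h'.1, h'.2]
  edge_mem_iff_exists_isLink e := by
    constructor
    · rintro ⟨b, rfl⟩
      exact ⟨f (s b), f (t b), b, rfl, Or.inl ⟨rfl, rfl⟩⟩
    · rintro ⟨-, -, b, hb, -⟩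
      exact ⟨b, hb⟩
  left_mem_of_isLink := by
    rintro e x y ⟨b, -, ⟨rfl, -⟩ | ⟨rfl, -⟩⟩ <;> exact Set.mem_range_self _

lemma isLink_ofEnds (b : E) : (ofEnds s t f g).IsLink (g b) (f (s b)) (f (t b)) :=
  ⟨b, rfl, Or.inl ⟨rfl, rfl⟩⟩

lemma loopless_ofEnds (hst : ∀ b, s b ≠ t b) : (ofEnds s t f g).Loopless where
  not_isLoopAt := by
    rintro e x ⟨b, -, ⟨h1, h2⟩ | ⟨h1, h2⟩⟩
    · exact hst b (f.injective (h1.symm.trans h2))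
    · exact hst b (f.injective (h2.symm.trans h1))

/-- Two parallel edges form a cycle. -/
lemma not_mem_of_parallel {X : Set α} (hX : ((ofEnds s t f g).induce X).IsForest) {b b' : E}
    (hb : b ≠ b') (hs : s b = s b') (ht : t b = t b') (hst : s b ≠ t b) :
    ¬ (f (s b) ∈ X ∧ f (t b) ∈ X) := by
  rintro ⟨h1, h2⟩
  refine hX ⟨1, ![f (s b), f (t b)], ![g b, g b'], ?_, ?_, ?_⟩
  · intro k l hkl
    fin_cases k <;> fin_cases l <;> simp_all
  · intro k l hkl
    fin_cases k <;> fin_cases l <;> simp_all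
  · intro k
    fin_cases k
    · exact ⟨isLink_ofEnds b, h1, h2⟩
    · refine ⟨?_, h2, h1⟩
      have := isLink_ofEnds (s := s) (t := t) (f := f) (g := g) b'
      rw [← hs, ← ht] at this
      exact this.symm

lemma card_le_of_vertexDegree_le {M : Set α} {v : V}
    (h : ((ofEnds s t f g).induce M).vertexDegree (f v) ≤ D) (hv : f v ∈ M) {T : Finset E}
    (hT : ∀ b ∈ T, (s b = v ∧ f (t b) ∈ M) ∨ (t b = v ∧ f (s b) ∈ M)) : T.card ≤ D := by
  have h1 : ((T.map g : Finset β) : Set β) ⊆ ((ofEnds s t f g).induce M).incidenceSet (f v) := by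
    intro e he
    obtain ⟨b, hb, rfl⟩ := Finset.mem_map.1 he
    rcases hT b hb with ⟨rfl, h2⟩ | ⟨rfl, h2⟩
    · exact ⟨_, isLink_ofEnds b, hv, h2⟩
    · exact ⟨_, (isLink_ofEnds b).symm, hv, h2⟩
  have h2 := (Set.encard_le_encard h1).trans (le_self_add.trans h)
  rw [Set.encard_coe_eq_coe_finsetCard, Finset.card_map] at h2
  exact_mod_cast h2

variable [Fintype V] [Fintype E]

/-- Every edge splits a charge `2 * (D + 1)` between its ends such that every vertex receives at
most `4 * D + 3`, except for `v₀`, which may receive two more. -/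
structure Charging (D : ℕ) (s t : E → V) (cs ct : E → ℕ) (v₀ : V) : Prop where
  ne : ∀ b, s b ≠ t b
  total : ∀ b, cs b + ct b = 2 * (D + 1)
  pos : ∀ b, 1 ≤ cs b ∧ 1 ≤ ct b
  le : ∀ v, ∑ b, ((if s b = v then cs b else 0) + if t b = v then ct b else 0)
    ≤ 4 * D + 3 + if v = v₀ then 2 else 0
  connected : ∀ X : Finset V, v₀ ∈ X → (∀ b, s b ∈ X ↔ t b ∈ X) → X = Finset.univ

/-- Summed over `X`, the charges exceed `(4D + 3) * X.card` by at most two, and only if `v₀` is in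
`X`. One unit is then lost because some edge at `X` is missing from `Y`; otherwise connectedness
would give all vertices and edges. -/
lemma Charging.card_le [DecidableEq E] {cs ct : E → ℕ} {v₀ : V} (h : Charging D s t cs ct v₀) {X : Finset V}
    {Y : Finset E} (hY : ∀ b ∈ Y, s b ∈ X ∧ t b ∈ X) (hne : X = Finset.univ → Y ≠ Finset.univ) :
    2 * (D + 1) * Y.card ≤ (4 * D + 3) * X.card + 1 := by
  set c : E → V → ℕ := fun b v => (if s b = v then cs b else 0) + if t b = v then ct b else 0
    with hc
  have h1 : 2 * (D + 1) * Y.card = ∑ v ∈ X, ∑ b ∈ Y, c b v := by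
    rw [Finset.sum_comm, mul_comm, ← smul_eq_mul, ← Finset.sum_const]
    refine Finset.sum_congr rfl fun b hb => ?_
    rw [hc, Finset.sum_add_distrib, Finset.sum_ite_eq, Finset.sum_ite_eq, if_pos (hY b hb).1,
      if_pos (hY b hb).2, h.total]
  have h2 : ∀ v ∈ X, ∑ b ∈ Y, c b v ≤ ∑ b, c b v := fun v _ =>
    Finset.sum_le_sum_of_subset (Finset.subset_univ _)
  have h3 : ∑ v ∈ X, ∑ b, c b v ≤ (4 * D + 3) * X.card + if v₀ ∈ X then 2 else 0 := by
    refine (Finset.sum_le_sum fun v _ => h.le v).trans ?_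
    rw [Finset.sum_add_distrib, Finset.sum_const, smul_eq_mul, Finset.sum_ite_eq', mul_comm]
  by_cases h0 : v₀ ∈ X
  · rw [if_pos h0] at h3
    suffices ∃ v ∈ X, ∑ b ∈ Y, c b v < ∑ b, c b v by
      have := Finset.sum_lt_sum h2 this
      omega
    by_contra! hcon
    have hmem : ∀ b, ∀ v ∈ X, s b = v ∨ t b = v → b ∈ Y := by
      intro b v hv hb
      by_contra hbY
      have h4 := hcon v hv
      have h5 : ∑ b' ∈ insert b Y, c b' v ≤ ∑ b', c b' v :=
        Finset.sum_le_sum_of_subset (Finset.subset_univ _)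
      rw [Finset.sum_insert hbY] at h5
      have h6 : 1 ≤ c b v := by
        obtain ⟨h7, h8⟩ := h.pos b
        simp only [hc]
        rcases hb with hb | hb
        · rw [if_pos hb]; omega
        · rw [if_pos hb]; omega
      omega
    have hX := h.connected X h0 fun b =>
      ⟨fun hb => (hY b (hmem b _ hb (Or.inl rfl))).2, fun hb => (hY b (hmem b _ hb (Or.inr rfl))).1⟩
    refine hne hX (Finset.eq_univ_of_forall fun b => hmem b (s b) ?_ (Or.inl rfl))
    rw [hX]
    exact Finset.mem_univ _
  · rw [if_neg h0] at h3
    have := Finset.sum_le_sum h2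
    omega

/-- The counting bound says that every vertex subset of a proper subgraph has potential at least
`-1`, so `colorable_of_pot` applies. -/
lemma Charging.colorable_of_lt [DecidableEq α] {cs ct : E → ℕ} {v₀ : V}
    (h : Charging D s t cs ct v₀)
    (hD : 1 ≤ D) {H : Graph α β} (hH : H < ofEnds s t f g) : H.DFFColorable D := by
  classical
  have hle := hH.le
  have hL : H.Loopless := ⟨fun e x he => (loopless_ofEnds h.ne).not_isLoopAt e x (he.mono hle)⟩
  have hV : H.vertexSet.Finite := (Set.finite_range f).subset hle.vertexSet_mono
  have hE : H.edgeSet.Finite := (Set.finite_range g).subset hle.edgeSet_mono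
  rw [dffColorable_iff hL hV hE]
  refine colorable_of_pot hD (isMult_mul hL) (fun _ => Nat.zero_le _) (fun _ => Nat.zero_le _) ?_
  intro X hX _
  rw [pot_mul hL hE]
  set S : Set β := {e | ∃ x ∈ X, ∃ y ∈ X, H.IsLink e x y} with hS
  have hXV : ∀ x ∈ X, x ∈ H.vertexSet := fun x hx => hV.mem_toFinset.1 (hX hx)
  set X' := Finset.univ.filter fun v => f v ∈ X with hX'
  set Y := Finset.univ.filter fun b => g b ∈ S with hY
  have hcX : X.card = X'.card := by
    rw [← Finset.card_map f]
    congr 1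
    ext x
    simp only [Finset.mem_map, hX', Finset.mem_filter, Finset.mem_univ, true_and]
    constructor
    · intro hx
      obtain ⟨v, rfl⟩ := hle.vertexSet_mono (hXV x hx)
      exact ⟨v, hx, rfl⟩
    · rintro ⟨v, hv, rfl⟩
      exact hv
  have hcS : S.ncard = Y.card := by
    rw [← Finset.card_map g, ← Set.ncard_coe_finset]
    congr 1
    ext e
    simp only [Finset.coe_map, Set.mem_image, hY, Finset.coe_filter, Finset.mem_univ, true_and,
      Set.mem_ofPred_eq]
    constructor
    · intro he
      have he' := he
      obtain ⟨x, -, y, -, hxy⟩ := he'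
      obtain ⟨b, rfl⟩ := (hxy.mono hle).edge_mem
      exact ⟨b, he, rfl⟩
    · rintro ⟨b, hb, rfl⟩
      exact hb
  have key := h.card_le (X := X') (Y := Y) (by
    intro b hb
    obtain ⟨x, hx, y, hy, hxy⟩ := (Finset.mem_filter.1 hb).2
    simp only [hX', Finset.mem_filter, Finset.mem_univ, true_and]
    rcases (hxy.mono hle).eq_and_eq_or_eq_and_eq (isLink_ofEnds b) with ⟨rfl, rfl⟩ | ⟨rfl, rfl⟩
    exacts [⟨hx, hy⟩, ⟨hy, hx⟩]) (by
    intro hX1 hY1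
    refine hH.not_ge ⟨?_, ?_⟩
    · rintro _ ⟨v, rfl⟩
      have : v ∈ X' := by rw [hX1]; exact Finset.mem_univ v
      exact hXV _ (Finset.mem_filter.1 this).2
    · intro e x y he
      obtain ⟨b, rfl⟩ := he.edge_mem
      have : b ∈ Y := by rw [hY1]; exact Finset.mem_univ b
      obtain ⟨x', -, y', -, hxy⟩ := (Finset.mem_filter.1 this).2
      exact (hle.isLink_iff hxy.edge_mem).2 he)
  rw [hcX, hcS]
  zify at key
  linarith

end ends

/-! ### The sharpness examples. -/

section sharp

variable {D k : ℕ}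

/-- The number of pairs attached to a centre. -/
def numPairs (D k : ℕ) (c : Fin (k + 1) × Bool) : ℕ :=
  if c.2 then (if c.1 = Fin.last k then D + 1 else 0) else (if c.1 = 0 then D + 1 else D)

abbrev Pair (D k : ℕ) : Type := Σ c : Fin (k + 1) × Bool, Fin (numPairs D k c)

/-- The centres `(i, false)` and `(i, true)` together with the vertices of the pairs. -/
abbrev SharpVertex (D k : ℕ) : Type := (Fin (k + 1) × Bool) ⊕ (Pair D k × Bool)

/-- Two edges inside each pair, two edges joining each pair to its centre, two edges joining
`(i, false)` and `(i, true)`, and an edge joining `(i, true)` and `(i + 1, false)`. -/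
abbrev SharpEdge (D k : ℕ) : Type :=
  (Pair D k × Bool) ⊕ (Pair D k × Bool) ⊕ (Fin (k + 1) × Bool) ⊕ Fin k

def sharpFst : SharpEdge D k → SharpVertex D k
  | .inl (p, _) => .inr (p, false)
  | .inr (.inl (p, b)) => .inr (p, b)
  | .inr (.inr (.inl (i, _))) => .inl (i, false)
  | .inr (.inr (.inr i)) => .inl (i.castSucc, true)

def sharpSnd : SharpEdge D k → SharpVertex D k
  | .inl (p, _) => .inr (p, true)
  | .inr (.inl (p, _)) => .inl p.1
  | .inr (.inr (.inl (i, _))) => .inl (i, true)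
  | .inr (.inr (.inr i)) => .inl (i.succ, false)

/-- With `chargeSnd`, the values are chosen so that every vertex receives exactly `4D + 3`, except
the last centre `(Fin.last k, true)`, which receives `4D + 5`. The double edge between centres is
split unevenly, `2D + 1` against `2D + 3`. -/
def chargeFst : SharpEdge D k → ℕ
  | .inl _ => D + 1
  | .inr (.inl _) => 2 * D + 1
  | .inr (.inr (.inl (_, b))) => if b then D + 1 else D
  | .inr (.inr (.inr _)) => 2 * D

def chargeSnd : SharpEdge D k → ℕ
  | .inl _ => D + 1
  | .inr (.inl _) => 1
  | .inr (.inr (.inl (_, b))) => if b then D + 1 else D + 2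
  | .inr (.inr (.inr _)) => 2

lemma sum_castSucc_eq (j : Fin (k + 1)) (n : ℕ) :
    ∑ i : Fin k, (if i.castSucc = j then n else 0) = if j = Fin.last k then 0 else n := by
  induction j using Fin.lastCases with
  | last => simp [Fin.castSucc_ne_last]
  | cast j => simp [Fin.castSucc_ne_last]

lemma sum_succ_eq (j : Fin (k + 1)) (n : ℕ) :
    ∑ i : Fin k, (if i.succ = j then n else 0) = if j = 0 then 0 else n := by
  induction j using Fin.cases with
  | zero => simp [Fin.succ_ne_zero]
  | succ j => simp [Fin.succ_ne_zero]

lemma card_filter_pair (c : Fin (k + 1) × Bool) :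
    (Finset.univ.filter fun p : Pair D k => p.1 = c).card = numPairs D k c := by
  rw [Finset.card_filter, Fintype.sum_sigma, Finset.sum_eq_single c]
  · simp
  · intro c' _ hc
    simp [hc]
  · simp

lemma sharp_charging (hD : 1 ≤ D) :
    Charging D (sharpFst (D := D) (k := k)) sharpSnd chargeFst chargeSnd
      (Sum.inl (Fin.last k, true)) where
  ne := by
    rintro (⟨p, b⟩ | ⟨p, b⟩ | ⟨i, b⟩ | i) <;> simp [sharpFst, sharpSnd]
  total := by
    rintro (⟨p, b⟩ | ⟨p, b⟩ | ⟨i, b⟩ | i)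
    · simp only [chargeFst, chargeSnd]; omega
    · simp only [chargeFst, chargeSnd]; omega
    · cases b <;> simp [chargeFst, chargeSnd]; all_goals omega
    · simp only [chargeFst, chargeSnd]; omega
  pos := by
    rintro (⟨p, b⟩ | ⟨p, b⟩ | ⟨i, b⟩ | i)
    · simp only [chargeFst, chargeSnd]; omega
    · simp only [chargeFst, chargeSnd]; omega
    · cases b <;> simp [chargeFst, chargeSnd]; all_goals omega
    · simp only [chargeFst, chargeSnd]; omega
  le := by
    intro v
    simp only [Fintype.sum_sum_type, sharpFst, sharpSnd, chargeFst, chargeSnd,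
      Finset.sum_add_distrib, Fintype.sum_prod_type, Fintype.sum_bool]
    rcases v with ⟨j, _ | _⟩ | ⟨p, _ | _⟩
    · simp only [reduceCtorEq, Sum.inl.injEq, Prod.mk.injEq, and_true, and_false, if_false,
        if_true, Bool.false_eq_true, Bool.true_eq_false, Finset.sum_const_zero, add_zero, zero_add,
        sum_succ_eq]
      simp [card_filter_pair, numPairs]
      split_ifs <;> omega
    · simp [sum_castSucc_eq, card_filter_pair, numPairs]
      split_ifs <;> omega
    · simp
      omega
    · simp
      omega
  connected := by
    intro X h0 hX
    have h1 : ∀ i : Fin (k + 1), Sum.inl (i, false) ∈ X ↔ Sum.inl (i, true) ∈ X :=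
      fun i => hX (.inr (.inr (.inl (i, true))))
    have h2 : ∀ i : Fin k, Sum.inl (i.castSucc, true) ∈ X ↔ Sum.inl (i.succ, false) ∈ X :=
      fun i => hX (.inr (.inr (.inr i)))
    have h3 : ∀ i : Fin (k + 1), Sum.inl (i, true) ∈ X := by
      intro i
      induction i using Fin.reverseInduction with
      | last => exact h0
      | cast i ih => exact (h2 i).2 ((h1 _).2 ih)
    have h4 : ∀ c, Sum.inl c ∈ X := by
      rintro ⟨i, _ | _⟩
      exacts [(h1 i).2 (h3 i), h3 i]
    refine Finset.eq_univ_of_forall ?_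
    rintro (c | ⟨p, b⟩)
    · exact h4 c
    · exact (hX (.inr (.inl (p, b)))).2 (h4 p.1)

/-- The sharpness examples. -/
def sharpGraph (D k : ℕ) (f : SharpVertex D k ↪ ℕ) (g : SharpEdge D k ↪ ℕ) : Graph ℕ ℕ :=
  ofEnds sharpFst sharpSnd f g

variable {f : SharpVertex D k ↪ ℕ} {g : SharpEdge D k ↪ ℕ} {M F : Set ℕ}

/-- The two ends of a double edge are in different classes. -/
lemma exactly_one_of_parallel (h : (sharpGraph D k f g).IsDFFColoring D M F) {b b' : SharpEdge D k}
    (hb : b ≠ b') (hs : sharpFst b = sharpFst b') (ht : sharpSnd b = sharpSnd b')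
    (hst : sharpFst b ≠ sharpSnd b) : f (sharpFst b) ∈ M ↔ f (sharpSnd b) ∉ M := by
  have h1 := not_mem_of_parallel h.isForest_left hb hs ht hst
  have h2 := not_mem_of_parallel h.isForest_right hb hs ht hst
  have h3 : ∀ v, f v ∈ M ∨ f v ∈ F := fun v => by
    have : f v ∈ M ∪ F := h.union_eq ▸ Set.mem_range_self v
    exact this
  have h4 := h3 (sharpFst b)
  have h5 := h3 (sharpSnd b)
  tauto

/-- Exactly one vertex of each pair is in `M` and both are joined to the centre, so each pair uses
up one unit of the degree of a centre in `M`. -/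
lemma numPairs_add_card_le (h : (sharpGraph D k f g).IsDFFColoring D M F)
    {c : Fin (k + 1) × Bool} (hc : f (.inl c) ∈ M) {T : Finset (Fin k)}
    (hT : ∀ i ∈ T, (i.succ, false) = c ∧ f (.inl (i.castSucc, true)) ∈ M) :
    numPairs D k c + T.card ≤ D := by
  classical
  have h1 : ∀ p : Pair D k, ∃ b, f (.inr (p, b)) ∈ M := by
    intro p
    by_contra! hcon
    have := exactly_one_of_parallel h (b := .inl (p, false)) (b' := .inl (p, true)) (by simp) rfl
      rfl (by simp [sharpFst, sharpSnd])
    exact hcon false (this.2 (hcon true))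
  choose φ hφ using h1
  set e₁ : Fin (numPairs D k c) → SharpEdge D k := fun j => .inr (.inl (⟨c, j⟩, φ ⟨c, j⟩)) with he₁
  set e₂ : Fin k → SharpEdge D k := fun i => .inr (.inr (.inr i)) with he₂
  have h2 : Function.Injective e₁ := by
    intro i j hij
    simp only [he₁, Sum.inr.injEq, Sum.inl.injEq, Prod.mk.injEq] at hij
    simpa using hij.1
  have h3 : Function.Injective e₂ := by
    intro i j hij
    simpa [he₂] using hij
  have h4 : Disjoint (Finset.univ.image e₁) (T.image e₂) := by
    rw [Finset.disjoint_left]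
    intro b hb hb'
    obtain ⟨j, -, rfl⟩ := Finset.mem_image.1 hb
    obtain ⟨i, -, hi⟩ := Finset.mem_image.1 hb'
    simp [he₁, he₂] at hi
  have h5 := card_le_of_vertexDegree_le (h.degree_le _ hc) hc
    (T := Finset.univ.image e₁ ∪ T.image e₂) (by
      intro b hb
      rcases Finset.mem_union.1 hb with hb | hb
      · obtain ⟨j, -, rfl⟩ := Finset.mem_image.1 hb
        exact Or.inr ⟨rfl, hφ ⟨c, j⟩⟩
      · obtain ⟨i, hi, rfl⟩ := Finset.mem_image.1 hb
        obtain ⟨h6, h7⟩ := hT i hi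
        exact Or.inr ⟨congrArg Sum.inl h6, h7⟩)
  rw [Finset.card_union_of_disjoint h4, Finset.card_image_of_injective _ h2,
    Finset.card_image_of_injective _ h3, Finset.card_univ, Fintype.card_fin] at h5
  exact h5

/-- The centre `(0, false)` has `D + 1` pairs and cannot be in `M`, so `(0, true)` is. Then `(i + 1,
false)`, with `D` pairs and the neighbour `(i, true)` in `M`, is excluded in turn. This propagates
to `(Fin.last k, true)`, whose `D + 1` pairs exclude it as well. -/
lemma not_dffColorable_sharpGraph : ¬ (sharpGraph D k f g).DFFColorable D := by
  rintro ⟨M, F, h⟩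
  have h1 : ∀ i : Fin (k + 1), f (.inl (i, false)) ∈ M ↔ f (.inl (i, true)) ∉ M := fun i =>
    exactly_one_of_parallel h (b := .inr (.inr (.inl (i, false))))
      (b' := .inr (.inr (.inl (i, true)))) (by simp) rfl rfl (by simp [sharpFst, sharpSnd])
  have h2 : ∀ i : Fin (k + 1), f (.inl (i, true)) ∈ M := by
    intro i
    induction i using Fin.induction with
    | zero =>
      by_contra hc
      have := numPairs_add_card_le h ((h1 0).2 hc) (T := ∅) (by simp)
      simp [numPairs] at this
    | succ i ih =>
      by_contra hc
      have := numPairs_add_card_le h ((h1 i.succ).2 hc) (T := {i}) (by simpa using ih)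
      simp [numPairs, Fin.succ_ne_zero] at this
  have := numPairs_add_card_le h (h2 (Fin.last k)) (T := ∅) (by simp)
  simp [numPairs] at this

lemma isDFFCritical_sharpGraph (hD : 1 ≤ D) : (sharpGraph D k f g).IsDFFCritical D :=
  ⟨not_dffColorable_sharpGraph, fun _ hH => (sharp_charging hD).colorable_of_lt hD hH⟩

lemma card_pair : Fintype.card (Pair D k) = (k + 1) * D + D + 2 := by
  have h1 : ∑ i : Fin (k + 1), (if i = Fin.last k then D + 1 else 0) = D + 1 := by simp
  have h2 : ∑ i : Fin (k + 1), (if i = 0 then D + 1 else D) = (k + 1) * D + 1 := by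
    rw [Fin.sum_univ_succ]
    simp [Fin.succ_ne_zero]
    ring
  simp only [Fintype.card_sigma, Fintype.card_fin]
  simp only [numPairs, Fintype.sum_prod_type,
    Fintype.sum_bool, if_true, Bool.false_eq_true, if_false, Finset.sum_add_distrib]
  rw [h1, h2]
  ring

lemma ncard_vertexSet_sharpGraph :
    (sharpGraph D k f g).vertexSet.ncard = (2 * D + 2) * k + 4 * D + 6 := by
  change (Set.range f).ncard = _
  rw [← Set.image_univ, Set.ncard_image_of_injective _ f.injective, Set.ncard_univ,
    Nat.card_eq_fintype_card, Fintype.card_sum, Fintype.card_prod, Fintype.card_prod, card_pair,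
    Fintype.card_fin, Fintype.card_bool]
  ring

lemma ncard_edgeSet_sharpGraph :
    (sharpGraph D k f g).edgeSet.ncard = (4 * D + 3) * k + 8 * D + 10 := by
  change (Set.range g).ncard = _
  rw [← Set.image_univ, Set.ncard_image_of_injective _ g.injective, Set.ncard_univ,
    Nat.card_eq_fintype_card, Fintype.card_sum, Fintype.card_sum, Fintype.card_sum,
    Fintype.card_prod, Fintype.card_prod, card_pair, Fintype.card_fin, Fintype.card_fin,
    Fintype.card_bool]
  ring

end sharp

end DFF

theorem mainTheorem1 (D : ℕ) (hD : 1 ≤ D) :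
    (∀ {α β : Type*} (G : Graph α β), G.Loopless →
      G.vertexSet.Finite → G.edgeSet.Finite → 3 ≤ G.vertexSet.ncard → G.IsDFFCritical D →
      ((4 * (D : ℝ) + 3) * (G.vertexSet.ncard : ℝ) + 2) / (2 * ((D : ℝ) + 1))
        ≤ (G.edgeSet.ncard : ℝ)) ∧
    (∀ n : ℕ, ∃ G : Graph ℕ ℕ, G.Loopless ∧
      G.vertexSet.Finite ∧ G.edgeSet.Finite ∧ 3 ≤ G.vertexSet.ncard ∧ n ≤ G.vertexSet.ncard ∧
      G.IsDFFCritical D ∧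
      (G.edgeSet.ncard : ℝ)
        = ((4 * (D : ℝ) + 3) * (G.vertexSet.ncard : ℝ) + 2) / (2 * ((D : ℝ) + 1))) := by
  classical
  have hpos : (0 : ℝ) < 2 * ((D : ℝ) + 1) := by positivity
  constructor
  · intro α β G hG hV hE _ hc
    have h : ((4 * D + 3) * G.vertexSet.ncard + 2 : ℝ) ≤ 2 * (D + 1) * G.edgeSet.ncard := by
      exact_mod_cast DFF.card_edges_of_critical hD hG hV hE hc
    rw [div_le_iff₀ hpos]
    linarith
  · intro n
    let f : DFF.SharpVertex D n ↪ ℕ := (Fintype.equivFin _).toEmbedding.trans Fin.valEmbedding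
    let g : DFF.SharpEdge D n ↪ ℕ := (Fintype.equivFin _).toEmbedding.trans Fin.valEmbedding
    refine ⟨DFF.sharpGraph D n f g, DFF.loopless_ofEnds (DFF.sharp_charging hD).ne,
      Set.finite_range f, Set.finite_range g, ?_, ?_, DFF.isDFFCritical_sharpGraph hD, ?_⟩
    · rw [DFF.ncard_vertexSet_sharpGraph]
      omega
    · rw [DFF.ncard_vertexSet_sharpGraph]
      nlinarith
    · rw [DFF.ncard_vertexSet_sharpGraph, DFF.ncard_edgeSet_sharpGraph, eq_div_iff hpos.ne']
      push_cast
      ring
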